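/- **Setting.** Let $n\ge 2$ and $T\ge 0$ be integers. Consider the $n$-node bidirected chain with self-loops: vertex set $\mathcal V=\{1,\dots,n\}$, edge set $\mathcal E=\{(i,i+1)\}_{i=1}^{n-1}\cup\{(i,i-1)\}_{i=2}^{n}\cup\{(i,i)\}_{i=1}^{n}$. Each edge $e$ carries a memoryless channel $K_e$ with finite input alphabet $\mathsf X_e$ and finite output alphabet $\mathsf Y_e$; channels on different edges are independent. Node $i$ has a local observation $W_i$ in a standard Borel space; the joint law of $W=(W_1,\dots,W_n)$ is arbitrary. Let $Z=f(W)$ for a measurable function $f$ with values in a standard Borel space. An algorithm of the class $\mathfrak A'(T)$ runs as follows. Write $Y_{i,t}=(Y_{(j,i),t})_{j:(j,i)\in\mathcal E}$ for what node $i$ receives at time $t$, and $A^{t}=(A_1,\dots,A_t)$. At each time $t\in\{1,\dots,T\}$, node $i$ computes, by fixed measurable maps, the messages $$X_{(i,i-1),t}=\overleftarrow{\varphi}_{i,t}(W_i,Y_i^{t-1}),\quad X_{(i,i+1),t}=\overrightarrow{\varphi}_{i,t}(W_i,Y_i^{t-1},U_i^{t-1}),\quad X_{(i,i),t}=\mathring\varphi_{i,t}(W_i,Y_i^{t-1},U_i^{t-1})$$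 (for those of these edges that exist) and the private message $U_{i,t}=\vartheta_{i,t}(W_i,Y_i^{t-1},U_i^{t-1},R_{i,t})$, where the $R_{i,t}$ are independent, uniform on $[0,1]$ and independent of $W$. The message $X_{e,t}$ is sent through $K_e$ and received as $Y_{e,t}$: given $W$, all the $R_{i,s}$ and everything received before time $t$, the received symbols $(Y_{e,t})_{e\in\mathcal E}$ have conditional law $\bigotimes_{e}K_e(\cdot\,|\,X_{e,t})$. At time $T$ node $i$ computes the estimate $\widehat Z_i=\psi_i(W_i,Y_i^T)$, where $\psi_i$ is measurable. All information quantities are in bits. $I(\cdot;\cdot|\cdot)$ is conditional mutual information; $H(W_1|W_{2:n})\in[0,\infty]$ is the mean over $w$ of the Shannon entropy of the conditional law of $W_1$ given $W_{2:n}=w$, where a law that is not discrete has entropy $+\infty$ (and $\infty\cdot 0=0$); $C_{(1,2)}$ is the Shannon capacity of $K_{(1,2)}$; and $\eta_i=\eta(K_i)$ is the SDPI constant of $K_i=\bigotimes_{j:(j,i)\in\mathcal E}K_{(j,i)}$, where $$\eta(K)=\sup_{P}\ \sup_{Q:\,0<D(Q\|P)<\infty}\frac{D(QK\|PK)}{D(Q\|P)},$$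 with $P,Q$ ranging over input distributions and $PK,QK$ the corresponding output distributions (a supremum over the empty set is $0$). Let $\mathcal B(m,k,p)=\binom mk p^k(1-p)^{m-k}$, with $0^0=1$; empty products are $1$. **Claim.** For every algorithm in $\mathfrak A'(T)$: 1. If $T\le n-2$, then $I(Z;\widehat Z_n|W_{2:n})=0$. 2. If $T\ge n-1$, then $$I(Z;\widehat Z_n|W_{2:n})\le\begin{cases}H(W_1|W_{2:n})\displaystyle\prod_{i=2}^n\bigl(1-(1-\eta_i)^{T-n+2}\bigr),\\[2mm] C_{(1,2)}\,(T-n+2)\displaystyle\prod_{i=3}^n\bigl(1-(1-\eta_i)^{T-n+2}\bigr).\end{cases}$$ 3. Let $\tilde\eta\le 1$ be such that $\eta_i\le\tilde\eta$ for all $i\in\mathcal V$. If $T\ge n-1$, then $$I(Z;\widehat Z_n|W_{2:n})\le\begin{cases}H(W_1|W_{2:n})\,\tilde\eta\displaystyle\sum_{i=1}^{T-n+2}\mathcal B(T-i,n-2,\tilde\eta),& n\ge 2,\\[2mm] C_{(1,2)}\,\tilde\eta\displaystyle\sum_{i=1}^{T-n+2}\mathcal B(T-i-1,n-3,\tilde\eta)\,i,&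 n\ge 3,\end{cases}$$ which can be weakened to $$I(Z;\widehat Z_n|W_{2:n})\le\begin{cases}H(W_1|W_{2:n})\bigl(1-(1-\tilde\eta)^{T-n+2}\bigr)^{n-1},& n\ge2,\\[1mm] C_{(1,2)}\,(T-n+2)\bigl(1-(1-\tilde\eta)^{T-n+2}\bigr)^{n-2},& n\ge 2,\end{cases}$$ that is, these two bounds also hold, and $\tilde\eta\sum_{i=1}^{T-n+2}\mathcal B(T-i,n-2,\tilde\eta)\le(1-(1-\tilde\eta)^{T-n+2})^{n-1}$ and, for $n\ge3$, $\tilde\eta\sum_{i=1}^{T-n+2}\mathcal B(T-i-1,n-3,\tilde\eta)\,i\le(T-n+2)(1-(1-\tilde\eta)^{T-n+2})^{n-2}$. 4. With $\tilde\eta$ as in 3, if moreover $\tilde\eta>0$, $n\ge4$ and $T\le 2+(n-3)\gamma/\tilde\eta$ for some $\gamma\in(0,1)$, then $$I(Z;\widehat Z_n|W_{2:n})\le C_{(1,2)}\,\frac{(n-3)^2\gamma^2}{\tilde\eta}\exp\Bigl(-2\Bigl(\frac{\tilde\eta}{\gamma}-\tilde\eta\Bigr)^2(n-3)\Bigr).$$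 -/

import Mathlib

open MeasureTheory ProbabilityTheory
open scoped ENNReal

/-! ### Information measures (all in bits) -/

/-- Relative entropy `D(Q ‖ P)` in bits. -/
noncomputable def relEntropy {α : Type*} [MeasurableSpace α] (Q P : Measure α) : ℝ≥0∞ :=
  InformationTheory.klDiv Q P / ENNReal.ofReal (Real.log 2)

/-- Shannon entropy in bits of a probability measure: `∑ ρ{x} log₂ (1/ρ{x})` if `ρ` is discrete
(carried by a countable set), and `∞` otherwise. -/
noncomputable def measureEntropy {α : Type*} [MeasurableSpace α] (ρ : Measure α) : ℝ≥0∞ :=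
  open Classical in
  if ∃ S : Set α, S.Countable ∧ ρ Sᶜ = 0 then
    ∑' x, ENNReal.ofReal (Real.negMulLog (ρ.real {x}) / Real.log 2)
  else ∞

/-- Conditional entropy `H(A | V)`: the average over `V` of the entropy of the conditional law
of `A` given `V = v`. -/
noncomputable def condEntropy {Ω α γ : Type*} [MeasurableSpace Ω] [MeasurableSpace α]
    [StandardBorelSpace α] [Nonempty α] [MeasurableSpace γ]
    (A : Ω → α) (V : Ω → γ) (μ : Measure Ω) [IsFiniteMeasure μ] : ℝ≥0∞ :=
  ∫⁻ v, measureEntropy (condDistrib A V μ v) ∂(μ.map V)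

/-- Conditional mutual information
`I(A; B | V) = D(P_{V,A,B} ‖ P_V ⊗ P_{A|V} ⊗ P_{B|V})`. -/
noncomputable def condMutualInfo {Ω α β γ : Type*} [MeasurableSpace Ω] [MeasurableSpace α]
    [StandardBorelSpace α] [Nonempty α] [MeasurableSpace β] [StandardBorelSpace β] [Nonempty β]
    [MeasurableSpace γ] (A : Ω → α) (B : Ω → β) (V : Ω → γ) (μ : Measure Ω)
    [IsFiniteMeasure μ] : ℝ≥0∞ :=
  relEntropy (μ.map fun ω => (V ω, A ω, B ω))
    (μ.map V ⊗ₘ (condDistrib A V μ ×ₖ condDistrib B V μ))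

/-! ### Channels -/

/-- Shannon capacity of a channel: the supremum over input laws `P` of the mutual information
between the input and the output. -/
noncomputable def capacity {α β : Type*} [MeasurableSpace α] [MeasurableSpace β]
    (K : Kernel α β) : ℝ≥0∞ :=
  ⨆ P : ProbabilityMeasure α,
    relEntropy ((P : Measure α) ⊗ₘ K) ((P : Measure α).prod (K ∘ₘ (P : Measure α)))

/-- The SDPI constant `η(K) = sup_P sup_{Q ≠ P} D(QK ‖ PK) / D(Q ‖ P)`. Pairs with
`D(Q ‖ P) = ∞` contribute `0` (division by `∞` in `ℝ≥0∞`), as usual. The supremum is at most `1`,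
so that it may be read as a real number. -/
noncomputable def sdpiConst {α β : Type*} [MeasurableSpace α] [MeasurableSpace β]
    (K : Kernel α β) : ℝ :=
  (⨆ (P : ProbabilityMeasure α) (Q : ProbabilityMeasure α) (_ : Q ≠ P),
    relEntropy (K ∘ₘ (Q : Measure α)) (K ∘ₘ (P : Measure α)) /
      relEntropy (Q : Measure α) (P : Measure α)).toReal

/-- The tensor product of finitely many channels with finite input alphabets. -/
noncomputable def prodChannel {ι : Type*} [Fintype ι] {α β : ι → Type*}
    [∀ i, MeasurableSpace (α i)] [∀ i, Finite (α i)] [∀ i, DiscreteMeasurableSpace (α i)]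
    [∀ i, MeasurableSpace (β i)] (K : ∀ i, Kernel (α i) (β i)) :
    Kernel (∀ i, α i) (∀ i, β i) :=
  Kernel.ofFunOfCountable fun x => Measure.pi fun i => K i (x i)

/-! ### The bidirected chain with self-loops -/

/-- `(i, j)` is an edge of the `n`-node bidirected chain: `j = i + 1`, `j = i - 1` or `j = i`. -/
abbrev ChainAdj {n : ℕ} (i j : Fin n) : Prop :=
  (j : ℕ) = i + 1 ∨ (i : ℕ) = j + 1 ∨ i = j

/-- Directed edges `(source, target)` of the chain. -/
abbrev ChainEdge (n : ℕ) : Type := {e : Fin n × Fin n // ChainAdj e.1 e.2}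

/-- Source node of an edge. -/
abbrev ChainEdge.src {n : ℕ} (e : ChainEdge n) : Fin n := e.1.1

/-- Target node of an edge. -/
abbrev ChainEdge.dst {n : ℕ} (e : ChainEdge n) : Fin n := e.1.2

/-- The in-neighborhood of a node. -/
abbrev InNbr {n : ℕ} (i : Fin n) : Type := {j : Fin n // ChainAdj j i}

/-- The edge `(j, i)` for an in-neighbor `j` of `i`. -/
abbrev inEdge {n : ℕ} {i : Fin n} (j : InNbr i) : ChainEdge n := ⟨(j.1, i), j.2⟩

/-- Tuples of symbols, one for each edge entering node `i`. -/
abbrev InMsg {n : ℕ} (Y : ChainEdge n → Type*) (i : Fin n) := ∀ j : InNbr i, Y (inEdge j)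

/-- The first node. -/
abbrev firstNode {n : ℕ} (hn : 2 ≤ n) : Fin n := ⟨0, by omega⟩

/-- The second node. -/
abbrev secondNode {n : ℕ} (hn : 2 ≤ n) : Fin n := ⟨1, by omega⟩

/-- The last node. -/
abbrev lastNode {n : ℕ} (hn : 2 ≤ n) : Fin n := ⟨n - 1, by omega⟩

/-- The edge from the first to the second node. -/
abbrev firstEdge {n : ℕ} (hn : 2 ≤ n) : ChainEdge n := ⟨(firstNode hn, secondNode hn), Or.inl rfl⟩

/-- The overall channel `K_i = ⨂_{j : (j,i) ∈ E} K_{(j,i)}` into node `i`. -/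
noncomputable def inChannel {n : ℕ} {X Y : ChainEdge n → Type*}
    [∀ e, MeasurableSpace (X e)] [∀ e, Finite (X e)] [∀ e, DiscreteMeasurableSpace (X e)]
    [∀ e, MeasurableSpace (Y e)] (K : ∀ e, Kernel (X e) (Y e)) (i : Fin n) :
    Kernel (InMsg X i) (InMsg Y i) :=
  prodChannel fun j : InNbr i => K (inEdge j)

/-! ### Algorithms and their runs -/

/-- A `T`-step algorithm of the class `𝔄'(T)` on the chain. Times are the elements of `Fin T`, and
`Set.Iio t` is the set of times before `t`. Node `i` observes `W i`, the edge `e` carries input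
symbols in `X e` and output symbols in `Y e`, the private message of node `i` at time `t` lives in
`U i t`, and estimates live in `Z`. Messages to the left and final estimates use only the local
observation and the received symbols; messages to the right and along the self-loop may also use
the past private messages; private messages may also use the fresh private randomness. -/
structure ChainAlgorithm {n : ℕ} (T : ℕ) (W : Fin n → Type*) (X Y : ChainEdge n → Type*)
    (U : Fin n → Fin T → Type*) (Z : Type*)
    [∀ i, MeasurableSpace (W i)] [∀ e, MeasurableSpace (X e)] [∀ e, MeasurableSpace (Y e)]
    [∀ i t, MeasurableSpace (U i t)] [MeasurableSpace Z] where
  /-- encoder of the message to the left neighbor -/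
  encLeft : ∀ e : ChainEdge n, e.dst < e.src → ∀ t : Fin T,
    W e.src × (Set.Iio t → InMsg Y e.src) → X e
  /-- encoder of the message to the right neighbor -/
  encRight : ∀ e : ChainEdge n, e.src < e.dst → ∀ t : Fin T,
    W e.src × (Set.Iio t → InMsg Y e.src) × (∀ s : Set.Iio t, U e.src s) → X e
  /-- encoder of the message along the self-loop -/
  encSelf : ∀ e : ChainEdge n, e.src = e.dst → ∀ t : Fin T,
    W e.src × (Set.Iio t → InMsg Y e.src) × (∀ s : Set.Iio t, U e.src s) → X e
  /-- generation of the private message -/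
  encPriv : ∀ (i : Fin n) (t : Fin T),
    W i × (Set.Iio t → InMsg Y i) × (∀ s : Set.Iio t, U i s) × unitInterval → U i t
  /-- final estimator -/
  est : ∀ i : Fin n, W i × (Fin T → InMsg Y i) → Z
  measurable_encLeft : ∀ e h t, Measurable (encLeft e h t)
  measurable_encRight : ∀ e h t, Measurable (encRight e h t)
  measurable_encSelf : ∀ e h t, Measurable (encSelf e h t)
  measurable_encPriv : ∀ i t, Measurable (encPriv i t)
  measurable_est : ∀ i, Measurable (est i)

/-- A run of an algorithm over the channels `K`, with observations of law `P`, on a probability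
space `(Ω, μ)`: the random variables that the algorithm generates. -/
structure ChainRun {n T : ℕ} {W : Fin n → Type*} {X Y : ChainEdge n → Type*}
    {U : Fin n → Fin T → Type*} {Z : Type*}
    [∀ i, MeasurableSpace (W i)] [∀ e, MeasurableSpace (X e)] [∀ e, MeasurableSpace (Y e)]
    [∀ i t, MeasurableSpace (U i t)] [MeasurableSpace Z]
    (alg : ChainAlgorithm T W X Y U Z) (K : ∀ e, Kernel (X e) (Y e)) (P : Measure (∀ i, W i))
    {Ω : Type*} [MeasurableSpace Ω] (μ : Measure Ω) where
  /-- the local observations -/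
  obs : Ω → ∀ i, W i
  /-- the private randomness -/
  rand : Ω → Fin n → Fin T → unitInterval
  /-- the private messages -/
  priv : ∀ (i : Fin n) (t : Fin T), Ω → U i t
  /-- the transmitted symbols -/
  sent : ∀ (e : ChainEdge n), Fin T → Ω → X e
  /-- the received symbols -/
  recv : ∀ (e : ChainEdge n), Fin T → Ω → Y e
  measurable_obs : Measurable obs
  measurable_rand : Measurable rand
  measurable_recv : ∀ e t, Measurable (recv e t)
  /-- The observations have law `P`; the private random variables are uniform on `[0,1]`,
  independent of each other and of the observations. -/
  law_init : μ.map (fun ω => (obs ω, rand ω)) =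
    P.prod (Measure.pi fun _ => Measure.pi fun _ => volume)
  priv_eq : ∀ i t ω, priv i t ω =
    alg.encPriv i t (obs ω i, (fun s j => recv (inEdge j) s ω), (fun s => priv i s ω), rand ω i t)
  sent_left : ∀ e h t ω, sent e t ω =
    alg.encLeft e h t (obs ω e.src, fun s j => recv (inEdge j) s ω)
  sent_right : ∀ e h t ω, sent e t ω =
    alg.encRight e h t
      (obs ω e.src, (fun s j => recv (inEdge j) s ω), fun s => priv e.src s ω)
  sent_self : ∀ e h t ω, sent e t ω =
    alg.encSelf e h t
      (obs ω e.src, (fun s j => recv (inEdge j) s ω), fun s => priv e.src s ω)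
  /-- Memoryless independent channels: given the observations, the private randomness and the
  symbols received before time `t` (which determine everything sent up to time `t`), the
  conditional probability that the symbols received at time `t` are `y` is
  `∏_e K_e(y_e | X_{e,t})`. -/
  channel : ∀ (t : Fin T) (y : ∀ e, Y e)
    (B : Set ((∀ i, W i) × (Fin n → Fin T → unitInterval) × (Set.Iio t → ∀ e, Y e))),
    MeasurableSet B →
    μ {ω | (obs ω, rand ω, fun (s : Set.Iio t) e => recv e s ω) ∈ B ∧ ∀ e, recv e t ω = y e} =
      ∫⁻ ω in {ω | (obs ω, rand ω, fun (s : Set.Iio t) e => recv e s ω) ∈ B},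
        ∏ e, K e (sent e t ω) {y e} ∂μ

/-- The final estimate of node `i`. -/
def ChainRun.estimate {n T : ℕ} {W : Fin n → Type*} {X Y : ChainEdge n → Type*}
    {U : Fin n → Fin T → Type*} {Z : Type*}
    [∀ i, MeasurableSpace (W i)] [∀ e, MeasurableSpace (X e)] [∀ e, MeasurableSpace (Y e)]
    [∀ i t, MeasurableSpace (U i t)] [MeasurableSpace Z]
    {alg : ChainAlgorithm T W X Y U Z} {K : ∀ e, Kernel (X e) (Y e)} {P : Measure (∀ i, W i)}
    {Ω : Type*} [MeasurableSpace Ω] {μ : Measure Ω} (run : ChainRun alg K P μ)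
    (i : Fin n) (ω : Ω) : Z :=
  alg.est i (run.obs ω i, fun t j => run.recv (inEdge j) t ω)

/-- The observations `W_{2:n}` of all nodes but the first. -/
def ChainRun.obsTail {n T : ℕ} {W : Fin n → Type*} {X Y : ChainEdge n → Type*}
    {U : Fin n → Fin T → Type*} {Z : Type*}
    [∀ i, MeasurableSpace (W i)] [∀ e, MeasurableSpace (X e)] [∀ e, MeasurableSpace (Y e)]
    [∀ i t, MeasurableSpace (U i t)] [MeasurableSpace Z]
    {alg : ChainAlgorithm T W X Y U Z} {K : ∀ e, Kernel (X e) (Y e)} {P : Measure (∀ i, W i)}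
    {Ω : Type*} [MeasurableSpace Ω] {μ : Measure Ω} (run : ChainRun alg K P μ)
    (hn : 2 ≤ n) (ω : Ω) (i : {i : Fin n // i ≠ firstNode hn}) : W i :=
  run.obs ω i

/-- The binomial probability `B(m, k, p) = (m choose k) p^k (1-p)^(m-k)`; it is only used with
`k ≤ m`. -/
def binomProb (m k : ℕ) (p : ℝ) : ℝ :=
  (m.choose k : ℝ) * p ^ k * (1 - p) ^ (m - k)

/-! Fix the value of $W_{2:n}$. Only $a=W_1$ then remains random among the observations, with law
$\kappa$, and given $a$ everything received has an explicit law on a finite set: a product of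
transition probabilities, averaged over the private randomness (`pathLaw`). Let $I_j(t)$ be the
mutual information between $a$ and what node $j$ received in the first $t$ steps (`nodeInfo`). The
theorem comes down to a recursion for $I_j(t)$.

The SDPI, applied for each value of the past, gives $I_j(t+1)\le(1-\eta_j)I_j(t)+\eta_j J_j(t)$,
where $J_j(t)$ also counts the symbols about to enter node $j$ (`finMI_sdpi`, `nodeInfo_succ_le`).
For $j\ge3$ one has $J_j(t)\le I_{j-1}(t)$: what node $j-1$ received separates the two sides of the
chain (`inputInfo_le`). This is where the class $\mathfrak A'(T)$ enters. Messages to the left use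
no private randomness, so the weight of a history splits at each node into a left factor and a right
factor (`stepLaw_eq_prod`). If two histories agree in what node $j-1$ received, exchanging their
right sides preserves the product of their weights (`stepLaw_mul_stepLaw_mix`). This is conditional
independence without division, and `finMI_push_le` turns it into a data processing inequality.

At node 2 there are two ways to start: $J_2(t)\le H(\kappa)$ (`finMI_le_measureEntropy`), or a gain
of at most the capacity of the edge $(1,2)$ per step (`nodeInfo_second_succ_le`).

The coefficients of the recursion are nonnegative, so any supersolution bounds $I_j(t)$
(`le_of_recursion`). With different $\eta_i$, a supersolution is the product in the theorem, with
$t$ delayed by one step per edge. With a common $\tilde\eta$, the exact solutions are the tail of a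
binomial law and its sum over time, `binTail` and `binTailSum`. Comparing these solutions with the
product gives the weakened bounds, and Hoeffding's inequality applied to each term gives the
exponential one.

Finally, $Z$ and $\widehat Z_n$ are functions of $(W_{2:n},W_1)$ and of $(W_{2:n},Y_n^T)$, so by
data processing $I(Z;\widehat Z_n|W_{2:n})$ is at most the average of $I_n(T)$ over $W_{2:n}$
(`condMutualInfo_le_lintegral_finMI`). The finite computations are in nats and become bits only at
the end. -/

set_option linter.unusedSectionVars false

/-! ### Relative entropy of nonnegative functions on finite types -/

/-- Relative entropy, in nats, of nonnegative functions on a finite type. -/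
noncomputable def finRelEnt {β : Type*} [Fintype β] (u v : β → ℝ) : ℝ :=
  ∑ b, u b * Real.log (u b / v b)

/-- The hypothesis on zeros is essential here and below: since `Real.log (u / 0) = 0`, the term that
should be infinite would count as zero. -/
lemma sub_le_mul_log_div {u v : ℝ} (hu : 0 ≤ u) (hv : 0 ≤ v) (h : v = 0 → u = 0) :
    u - v ≤ u * Real.log (u / v) := by
  rcases hu.eq_or_lt with rfl | hu'
  · simpa using hv
  have hv' : 0 < v := lt_of_le_of_ne hv fun h' => hu'.ne' (h h'.symm)
  have h1 : Real.log (v / u) ≤ v / u - 1 := Real.log_le_sub_one_of_pos (by positivity)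
  have h2 : Real.log (u / v) = -Real.log (v / u) := by rw [← Real.log_inv, inv_div]
  rw [h2]
  have h3 : u * (v / u - 1) = v - u := by field_simp
  nlinarith [mul_le_mul_of_nonneg_left h1 hu]

lemma mul_log_div_mul {u v c d : ℝ} (hc : 0 < c) (hd : 0 < d) (h : v = 0 → u = 0) :
    u * Real.log (c * u / (d * v)) = u * Real.log (u / v) + u * Real.log (c / d) := by
  by_cases hu : u = 0
  · simp [hu]
  have hv : v ≠ 0 := fun hv => hu (h hv)
  rw [mul_div_mul_comm, Real.log_mul (by positivity) (div_ne_zero hu hv)]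
  ring

/-- The log-sum inequality. -/
lemma log_sum_le {ι : Type*} (s : Finset ι) (u v : ι → ℝ) (hu : ∀ i ∈ s, 0 ≤ u i)
    (hv : ∀ i ∈ s, 0 ≤ v i) (h : ∀ i ∈ s, v i = 0 → u i = 0) :
    (∑ i ∈ s, u i) * Real.log ((∑ i ∈ s, u i) / ∑ i ∈ s, v i) ≤
      ∑ i ∈ s, u i * Real.log (u i / v i) := by
  set U := ∑ i ∈ s, u i with hU
  set V := ∑ i ∈ s, v i with hV
  rcases (Finset.sum_nonneg hu : 0 ≤ U).eq_or_lt with h0 | hU0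
  · have h1 : ∀ i ∈ s, u i = 0 := (Finset.sum_eq_zero_iff_of_nonneg hu).1 h0.symm
    rw [show U = 0 from h0.symm, zero_mul, Finset.sum_eq_zero]
    intro i hi
    rw [h1 i hi, zero_mul]
  have hV0 : 0 < V := by
    refine lt_of_le_of_ne (Finset.sum_nonneg hv) fun h0 => hU0.ne' ?_
    have h1 : ∀ i ∈ s, v i = 0 := (Finset.sum_eq_zero_iff_of_nonneg hv).1 h0.symm
    exact Finset.sum_eq_zero fun i hi => h i hi (h1 i hi)
  -- `sub_le_mul_log_div` is used for $V u_i$ and $U v_i$: both families have sum $UV$, so the left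
  -- sides cancel on summation.
  have key : ∀ i ∈ s, V * u i - U * v i ≤
      V * (u i * Real.log (u i / v i) + u i * Real.log (V / U)) := by
    intro i hi
    have h1 := sub_le_mul_log_div (mul_nonneg hV0.le (hu i hi)) (mul_nonneg hU0.le (hv i hi))
      (fun h' => by rw [h i hi ((mul_eq_zero.1 h').resolve_left hU0.ne'), mul_zero])
    rwa [mul_assoc, mul_log_div_mul hV0 hU0 (h i hi)] at h1
  have h2 := Finset.sum_le_sum key
  rw [Finset.sum_sub_distrib, ← Finset.mul_sum, ← Finset.mul_sum, ← Finset.mul_sum,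
    Finset.sum_add_distrib, ← Finset.sum_mul, ← hU, ← hV, mul_comm U V, sub_self] at h2
  have h3 := nonneg_of_mul_nonneg_right h2 hV0
  have h4 : Real.log (V / U) = -Real.log (U / V) := by rw [← Real.log_inv, inv_div]
  rw [h4] at h3
  linarith

lemma finRelEnt_smul {β : Type*} [Fintype β] {u v : β → ℝ} {c d : ℝ} (hc : 0 < c) (hd : 0 < d)
    (h : ∀ b, v b = 0 → u b = 0) :
    finRelEnt (fun b => c * u b) (fun b => d * v b) =
      c * (finRelEnt u v + (∑ b, u b) * Real.log (c / d)) := by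
  simp only [finRelEnt, mul_assoc, mul_log_div_mul hc hd (h _), Finset.sum_mul,
    ← Finset.sum_add_distrib, Finset.mul_sum]

lemma finRelEnt_prod {ζ χ : Type*} [Fintype ζ] [Fintype χ] (u v : ζ × χ → ℝ) :
    finRelEnt u v = ∑ z, finRelEnt (fun x => u (z, x)) (fun x => v (z, x)) :=
  Fintype.sum_prod_type _

/-- The log-sum inequality at each output. Rows of `M` need to be normalized only where `u` is
nonzero; this allows zero rows at values that never occur. -/
lemma finRelEnt_channel_le {ζ β : Type*} [Fintype ζ] [Fintype β] {u v : ζ → ℝ}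
    {M : ζ → β → ℝ} (hu : ∀ z, 0 ≤ u z) (hv : ∀ z, 0 ≤ v z) (h : ∀ z, v z = 0 → u z = 0)
    (hM : ∀ z b, 0 ≤ M z b) (hM1 : ∀ z, u z ≠ 0 → ∑ b, M z b = 1) :
    finRelEnt (fun b => ∑ z, u z * M z b) (fun b => ∑ z, v z * M z b) ≤ finRelEnt u v := by
  calc finRelEnt (fun b => ∑ z, u z * M z b) (fun b => ∑ z, v z * M z b)
      ≤ ∑ b, ∑ z, u z * M z b * Real.log (u z * M z b / (v z * M z b)) :=
        Finset.sum_le_sum fun b _ => log_sum_le _ _ _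
          (fun z _ => mul_nonneg (hu z) (hM z b)) (fun z _ => mul_nonneg (hv z) (hM z b))
          (fun z _ h0 => by
            rcases mul_eq_zero.1 h0 with h0 | h0
            · rw [h z h0, zero_mul]
            · rw [h0, mul_zero])
    _ = ∑ z, ∑ b, M z b * (u z * Real.log (u z / v z)) := by
        rw [Finset.sum_comm]
        refine Finset.sum_congr rfl fun z _ => Finset.sum_congr rfl fun b _ => ?_
        by_cases h0 : M z b = 0
        · simp [h0]
        · rw [mul_div_mul_right _ _ h0]; ring
    _ = finRelEnt u v := by
        refine Finset.sum_congr rfl fun z _ => ?_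
        rw [← Finset.sum_mul]
        by_cases h0 : u z = 0
        · simp [h0]
        · rw [hM1 z h0, one_mul]

/-- `c` is a contraction constant of the finite channel `k` for the relative entropy. -/
def FinSDPI {χ β : Type*} [Fintype χ] [Fintype β] (k : χ → β → ℝ) (c : ℝ) : Prop :=
  ∀ u v : χ → ℝ, (∀ x, 0 ≤ u x) → (∀ x, 0 ≤ v x) → (∀ x, v x = 0 → u x = 0) →
    ∑ x, u x = 1 → ∑ x, v x = 1 →
    finRelEnt (fun y => ∑ x, u x * k x y) (fun y => ∑ x, v x * k x y) ≤ c * finRelEnt u v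

lemma channel_abs {χ : Type*} [Fintype χ] {u v k : χ → ℝ}
    (hv : ∀ x, 0 ≤ v x) (h : ∀ x, v x = 0 → u x = 0) (hk : ∀ x, 0 ≤ k x)
    (h0 : ∑ x, v x * k x = 0) : ∑ x, u x * k x = 0 := by
  rw [Finset.sum_eq_zero_iff_of_nonneg fun x _ => mul_nonneg (hv x) (hk x)] at h0
  refine Finset.sum_eq_zero fun x hx => ?_
  rcases mul_eq_zero.1 (h0 x hx) with h1 | h1
  · rw [h x h1, zero_mul]
  · rw [h1, mul_zero]

/-- After normalization, $D(u\|v)$ is $U\log(U/V)$ plus $U$ times the divergence of probability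
vectors. A channel keeps the masses $U,V$, so only the second part contracts. The unnormalized form
is what applies to the slice at a fixed past; the mass terms then add up to the divergence of the
past alone. -/
lemma FinSDPI.homogeneous {χ β : Type*} [Fintype χ] [Fintype β] {k : χ → β → ℝ} {c : ℝ}
    (hk : FinSDPI k c) (hk0 : ∀ x y, 0 ≤ k x y) (hk1 : ∀ x, ∑ y, k x y = 1)
    {u v : χ → ℝ} (hu : ∀ x, 0 ≤ u x) (hv : ∀ x, 0 ≤ v x) (h : ∀ x, v x = 0 → u x = 0) :
    finRelEnt (fun y => ∑ x, u x * k x y) (fun y => ∑ x, v x * k x y) ≤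
      (1 - c) * ((∑ x, u x) * Real.log ((∑ x, u x) / ∑ x, v x)) + c * finRelEnt u v := by
  set U := ∑ x, u x with hU
  set V := ∑ x, v x with hV
  rcases (Finset.sum_nonneg fun x _ => hu x : 0 ≤ U).eq_or_lt with h0 | hU0
  · have h1 : ∀ x, u x = 0 := fun x =>
      (Finset.sum_eq_zero_iff_of_nonneg fun x _ => hu x).1 h0.symm x (Finset.mem_univ x)
    simp [finRelEnt, h1, show U = 0 from h0.symm]
  have hV0 : 0 < V := by
    refine lt_of_le_of_ne (Finset.sum_nonneg fun x _ => hv x) fun h0 => hU0.ne' ?_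
    have h1 := (Finset.sum_eq_zero_iff_of_nonneg fun x _ => hv x).1 h0.symm
    exact Finset.sum_eq_zero fun i hi => h i (h1 i hi)
  have h1 := hk (fun x => U⁻¹ * u x) (fun x => V⁻¹ * v x)
    (fun x => mul_nonneg (by positivity) (hu x)) (fun x => mul_nonneg (by positivity) (hv x))
    (fun x hx => by rw [h x ((mul_eq_zero.1 hx).resolve_left (by positivity)), mul_zero])
    (by rw [← Finset.mul_sum, ← hU, inv_mul_cancel₀ hU0.ne'])
    (by rw [← Finset.mul_sum, ← hV, inv_mul_cancel₀ hV0.ne'])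
  simp only [mul_assoc, ← Finset.mul_sum] at h1
  rw [finRelEnt_smul (by positivity) (by positivity) h, finRelEnt_smul (by positivity)
    (by positivity) (fun y => channel_abs hv h (fun x => hk0 x y)), ← hU] at h1
  have h2 : ∑ y, ∑ x, u x * k x y = U := by
    rw [Finset.sum_comm]
    simp only [← Finset.mul_sum, hk1, mul_one, hU]
  have h3 : Real.log (U⁻¹ / V⁻¹) = -Real.log (U / V) := by
    rw [← Real.log_inv]; congr 1; field_simp
  rw [h2, h3, mul_left_comm] at h1
  have h4 := le_of_mul_le_mul_left h1 (by positivity)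
  linarith

/-- `C` bounds the mutual information (in nats) between input and output of the channel `k`. -/
def FinCapLE {χ β : Type*} [Fintype χ] [Fintype β] (k : χ → β → ℝ) (C : ℝ) : Prop :=
  ∀ v : χ → ℝ, (∀ x, 0 ≤ v x) → ∑ x, v x = 1 →
    ∑ x, v x * finRelEnt (k x) (fun y => ∑ x', v x' * k x' y) ≤ C

/-- Convexity of the relative entropy of the output of a channel in its input. -/
lemma finRelEnt_output_le {χ β : Type*} [Fintype χ] [Fintype β] {k : χ → β → ℝ}
    (hk0 : ∀ x y, 0 ≤ k x y) (hk1 : ∀ x, ∑ y, k x y = 1)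
    {u v : χ → ℝ} (hu : ∀ x, 0 ≤ u x) (hv : ∀ x, 0 ≤ v x) (h : ∀ x, v x = 0 → u x = 0)
    (hV0 : 0 < ∑ x, v x) :
    finRelEnt (fun y => ∑ x, u x * k x y) (fun y => ∑ x, v x * k x y) ≤
      (∑ x, u x) * Real.log ((∑ x, u x) / ∑ x, v x) +
      ∑ x, u x * finRelEnt (k x) (fun y => ∑ x', (v x' / ∑ x'', v x'') * k x' y) := by
  set U := ∑ x, u x with hU
  set V := ∑ x, v x with hV
  rcases (Finset.sum_nonneg fun x _ => hu x : 0 ≤ U).eq_or_lt with h0 | hU0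
  · have h1 : ∀ x, u x = 0 := fun x =>
      (Finset.sum_eq_zero_iff_of_nonneg fun x _ => hu x).1 h0.symm x (Finset.mem_univ x)
    simp [finRelEnt, h1, show U = 0 from h0.symm]
  set m : β → ℝ := fun y => ∑ x', (v x' / V) * k x' y with hm
  have hmk : ∀ y, m y = V⁻¹ * ∑ x', v x' * k x' y := fun y => by
    rw [Finset.mul_sum]
    exact Finset.sum_congr rfl fun x _ => by ring
  have hm0 : ∀ y, 0 ≤ m y := fun y =>
    Finset.sum_nonneg fun x _ => mul_nonneg (div_nonneg (hv x) hV0.le) (hk0 x y)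
  have habs : ∀ x y, u x * m y = 0 → u x * k x y = 0 := by
    intro x y h0
    rcases mul_eq_zero.1 h0 with h1 | h1
    · rw [h1, zero_mul]
    · by_contra hne
      rw [hm, Finset.sum_eq_zero_iff_of_nonneg fun x _ =>
        mul_nonneg (div_nonneg (hv x) hV0.le) (hk0 x y)] at h1
      rcases mul_eq_zero.1 (h1 x (Finset.mem_univ x)) with h2 | h2
      · exact hne (by rw [h x ((div_eq_zero_iff.1 h2).resolve_right hV0.ne'), zero_mul])
      · exact hne (by rw [h2, mul_zero])
  -- Log-sum against $u_x m(y)$, whose sum over $x$ is $U m(y)$. Since $m$ is the output of `v`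
  -- divided by $V$, this reference costs exactly the term $U\log(U/V)$.
  have key : ∀ y, (∑ x, u x * k x y) * Real.log ((∑ x, u x * k x y) / ∑ x, u x * m y) ≤
      ∑ x, u x * (k x y * Real.log (k x y / m y)) := by
    intro y
    refine (log_sum_le _ _ _ (fun x _ => mul_nonneg (hu x) (hk0 x y))
      (fun x _ => mul_nonneg (hu x) (hm0 y)) (fun x _ => habs x y)).trans (le_of_eq ?_)
    refine Finset.sum_congr rfl fun x _ => ?_
    by_cases hx : u x = 0
    · simp [hx]
    · rw [mul_div_mul_left _ _ hx, mul_assoc]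
  have h2 := Finset.sum_le_sum fun y (_ : y ∈ Finset.univ) => key y
  have h3 : ∑ y, (∑ x, u x * k x y) * Real.log ((∑ x, u x * k x y) / ∑ x, u x * m y) =
      finRelEnt (fun y => ∑ x, u x * k x y) (fun y => ∑ x, v x * k x y) - U * Real.log (U / V) := by
    have h4 := finRelEnt_smul (c := 1) (d := U * V⁻¹) one_pos (by positivity)
      (fun y => channel_abs hv h (fun x => hk0 x y))
    have h5 : ∑ y, ∑ x, u x * k x y = U := by
      rw [Finset.sum_comm]
      simp only [← Finset.mul_sum, hk1, mul_one, hU]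
    rw [h5] at h4
    have h6 : Real.log (1 / (U * V⁻¹)) = -Real.log (U / V) := by
      rw [← Real.log_inv]; congr 1; field_simp
    rw [h6] at h4
    simp only [one_mul] at h4
    rw [sub_eq_add_neg, ← mul_neg, ← h4, finRelEnt]
    refine Finset.sum_congr rfl fun y _ => ?_
    rw [← Finset.sum_mul, ← hU, hmk, mul_assoc]
  rw [h3, Finset.sum_comm] at h2
  simp only [← Finset.mul_sum] at h2
  have h7 : ∑ x, u x * ∑ y, k x y * Real.log (k x y / m y) = ∑ x, u x * finRelEnt (k x) m := rfl
  linarith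

/-! ### Mutual information with a finite-valued variable -/

/-- `p a` is a probability vector that depends measurably on `a`. -/
structure IsFinKernel {α β : Type*} [MeasurableSpace α] [Fintype β] (p : α → β → ℝ) : Prop where
  nonneg : ∀ a b, 0 ≤ p a b
  sum_eq_one : ∀ a, ∑ b, p a b = 1
  measurable : ∀ b, Measurable fun a => p a b

/-- Mutual information, in nats, between a variable of law `κ` and a finite-valued variable of
conditional law `p`. -/
noncomputable def finMI {α β : Type*} [MeasurableSpace α] [Fintype β] (κ : Measure α)
    (p : α → β → ℝ) : ℝ :=
  ∫ a, finRelEnt (p a) (fun b => ∫ a', p a' b ∂κ) ∂κ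

namespace IsFinKernel

variable {α β : Type*} [MeasurableSpace α] [Fintype β] {p : α → β → ℝ}

lemma le_one (hp : IsFinKernel p) (a : α) (b : β) : p a b ≤ 1 := by
  rw [← hp.sum_eq_one a]
  exact Finset.single_le_sum (fun b _ => hp.nonneg a b) (Finset.mem_univ b)

lemma integrable (hp : IsFinKernel p) (κ : Measure α) [IsFiniteMeasure κ] (b : β) :
    Integrable (fun a => p a b) κ :=
  Integrable.of_bound (hp.measurable b).aestronglyMeasurable 1 (ae_of_all _ fun a => by
    rw [Real.norm_of_nonneg (hp.nonneg a b)]; exact hp.le_one a b)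

lemma integral_nonneg (hp : IsFinKernel p) (κ : Measure α) (b : β) : 0 ≤ ∫ a, p a b ∂κ :=
  MeasureTheory.integral_nonneg fun a => hp.nonneg a b

lemma sum_integral (hp : IsFinKernel p) (κ : Measure α) [IsProbabilityMeasure κ] :
    ∑ b, ∫ a, p a b ∂κ = 1 := by
  rw [← integral_finsetSum _ fun b _ => hp.integrable κ b]
  simp [hp.sum_eq_one]

/-- A nonnegative function with zero integral vanishes almost everywhere. This supplies the absolute
continuity on which every use of `finRelEnt` depends. -/
lemma ae_abs (hp : IsFinKernel p) (κ : Measure α) [IsFiniteMeasure κ] :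
    ∀ᵐ a ∂κ, ∀ b, ∫ a', p a' b ∂κ = 0 → p a b = 0 := by
  rw [ae_all_iff]
  intro b
  by_cases h : ∫ a', p a' b ∂κ = 0
  · filter_upwards [(integral_eq_zero_iff_of_nonneg (fun a => hp.nonneg a b)
      (hp.integrable κ b)).1 h] with a ha _ using ha
  · exact ae_of_all _ fun a h' => absurd h' h

lemma integrable_finRelEnt (hp : IsFinKernel p) (κ : Measure α) [IsFiniteMeasure κ]
    (v : β → ℝ) : Integrable (fun a => finRelEnt (p a) v) κ := by
  refine integrable_finsetSum _ fun b _ => ?_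
  by_cases hv : v b = 0
  · simp [hv]
  have hc : Continuous fun x : ℝ => x * Real.log (x / v b) := by
    have : (fun x : ℝ => x * Real.log (x / v b)) =
        fun x => v b * ((x / v b) * Real.log (x / v b)) := by
      ext x; field_simp
    rw [this]
    exact continuous_const.mul (Real.continuous_mul_log.comp (continuous_id.div_const _))
  obtain ⟨C, hC⟩ := isCompact_Icc.exists_bound_of_continuousOn (s := Set.Icc (0 : ℝ) 1)
    hc.continuousOn
  exact Integrable.of_bound (hc.measurable.comp (hp.measurable b)).aestronglyMeasurable C
    (ae_of_all _ fun a => hC _ ⟨hp.nonneg a b, hp.le_one a b⟩)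

end IsFinKernel

section FinMI

variable {α : Type*} [MeasurableSpace α] {κ : Measure α} [IsProbabilityMeasure κ]

/-- Data processing, pointwise in `a`: the channel carries `p a` to `p' a` and, by linearity, also
the mean of `p` to the mean of `p'`. -/
lemma finMI_le_of_channel {ζ β : Type*} [Fintype ζ] [Fintype β] {p : α → ζ → ℝ}
    {p' : α → β → ℝ} (hp : IsFinKernel p) (hp' : IsFinKernel p') (M : ζ → β → ℝ)
    (hM : ∀ z b, 0 ≤ M z b) (hM1 : ∀ z, (∃ a, p a z ≠ 0) → ∑ b, M z b = 1)
    (h : ∀ a b, p' a b = ∑ z, p a z * M z b) : finMI κ p' ≤ finMI κ p := by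
  refine integral_mono_ae (hp'.integrable_finRelEnt κ _) (hp.integrable_finRelEnt κ _) ?_
  filter_upwards [hp.ae_abs κ] with a ha
  have h1 : ∀ b, ∫ a', p' a' b ∂κ = ∑ z, (∫ a', p a' z ∂κ) * M z b := by
    intro b
    simp only [h]
    rw [integral_finsetSum _ fun z _ => (hp.integrable κ z).mul_const _]
    simp only [integral_mul_const]
  simp only [h1]
  have h2 : p' a = fun b => ∑ z, p a z * M z b := funext (h a)
  rw [h2]
  exact finRelEnt_channel_le (hp.nonneg a) (hp.integral_nonneg κ) ha hM
    fun z hz => hM1 z ⟨a, hz⟩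

/-- A conditional SDPI, with `z` the past, `x` the new input and `y` the new output:
$I(a;z,y)\le(1-c)I(a;z)+c\,I(a;z,x)$. It is `FinSDPI.homogeneous` on each slice of fixed `z`, summed
over `z`. -/
lemma finMI_sdpi {ζ χ β : Type*} [Fintype ζ] [Fintype χ] [Fintype β] {k : χ → β → ℝ} {c : ℝ}
    (hk : FinSDPI k c) (hk0 : ∀ x y, 0 ≤ k x y) (hk1 : ∀ x, ∑ y, k x y = 1)
    {p : α → ζ × χ → ℝ} {p' : α → ζ × β → ℝ} {q : α → ζ → ℝ}
    (hp : IsFinKernel p) (hp' : IsFinKernel p') (hq : IsFinKernel q)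
    (h' : ∀ a z y, p' a (z, y) = ∑ x, p a (z, x) * k x y)
    (h : ∀ a z, q a z = ∑ x, p a (z, x)) :
    finMI κ p' ≤ (1 - c) * finMI κ q + c * finMI κ p := by
  rw [finMI, finMI, finMI, ← integral_const_mul, ← integral_const_mul, ← integral_add
    ((hq.integrable_finRelEnt κ _).const_mul _) ((hp.integrable_finRelEnt κ _).const_mul _)]
  refine integral_mono_ae (hp'.integrable_finRelEnt κ _)
    (((hq.integrable_finRelEnt κ _).const_mul _).add
      ((hp.integrable_finRelEnt κ _).const_mul _)) ?_
  filter_upwards [hp.ae_abs κ] with a ha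
  rw [finRelEnt_prod (p' a), finRelEnt_prod (p a), finRelEnt, Finset.mul_sum, Finset.mul_sum,
    ← Finset.sum_add_distrib]
  refine Finset.sum_le_sum fun z _ => ?_
  have h1 : ∀ y, ∫ a', p' a' (z, y) ∂κ = ∑ x, (∫ a', p a' (z, x) ∂κ) * k x y := by
    intro y
    simp only [h']
    rw [integral_finsetSum _ fun x _ => (hp.integrable κ (z, x)).mul_const _]
    simp only [integral_mul_const]
  have h2 : ∫ a', q a' z ∂κ = ∑ x, ∫ a', p a' (z, x) ∂κ := by
    simp only [h]
    rw [integral_finsetSum _ fun x _ => hp.integrable κ (z, x)]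
  simp only [h1, h2]
  simp only [h', h]
  exact hk.homogeneous hk0 hk1 (fun x => hp.nonneg a (z, x))
    (fun x => hp.integral_nonneg κ (z, x)) (fun x => ha (z, x))

/-- Given the past `z`, the new output adds at most the information through the channel under the
conditional input law given `z`, hence at most `C`; the masses of the slices sum to one. -/
lemma finMI_capacity {ζ χ β : Type*} [Fintype ζ] [Fintype χ] [Fintype β] {k : χ → β → ℝ} {C : ℝ}
    (hk : FinCapLE k C) (hk0 : ∀ x y, 0 ≤ k x y) (hk1 : ∀ x, ∑ y, k x y = 1)
    {p : α → ζ × χ → ℝ} {p' : α → ζ × β → ℝ} {q : α → ζ → ℝ}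
    (hp : IsFinKernel p) (hp' : IsFinKernel p') (hq : IsFinKernel q)
    (h' : ∀ a z y, p' a (z, y) = ∑ x, p a (z, x) * k x y)
    (h : ∀ a z, q a z = ∑ x, p a (z, x)) :
    finMI κ p' ≤ finMI κ q + C := by
  set v : ζ → χ → ℝ := fun z x => ∫ a, p a (z, x) ∂κ with hv
  have hv0 : ∀ z x, 0 ≤ v z x := fun z x => hp.integral_nonneg κ (z, x)
  set m : ζ → β → ℝ := fun z y => ∑ x', (v z x' / ∑ x'', v z x'') * k x' y with hm
  have hint : Integrable (fun a => ∑ z, ∑ x, p a (z, x) * finRelEnt (k x) (m z)) κ :=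
    integrable_finsetSum _ fun z _ => integrable_finsetSum _ fun x _ =>
      (hp.integrable κ (z, x)).mul_const _
  have hC : ∫ a, ∑ z, ∑ x, p a (z, x) * finRelEnt (k x) (m z) ∂κ ≤ C := by
    rw [integral_finsetSum _ fun z _ => integrable_finsetSum _ fun x _ =>
      (hp.integrable κ (z, x)).mul_const _]
    have h1 : ∀ z, ∫ a, ∑ x, p a (z, x) * finRelEnt (k x) (m z) ∂κ ≤ (∑ x, v z x) * C := by
      intro z
      rw [integral_finsetSum _ fun x _ => (hp.integrable κ (z, x)).mul_const _]
      simp only [integral_mul_const]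
      rcases (Finset.sum_nonneg fun x _ => hv0 z x : 0 ≤ ∑ x, v z x).eq_or_lt with h0 | hV0
      · have h1 := (Finset.sum_eq_zero_iff_of_nonneg fun x _ => hv0 z x).1 h0.symm
        rw [← h0, zero_mul, Finset.sum_eq_zero]
        intro x hx
        rw [show ∫ a, p a (z, x) ∂κ = 0 from h1 x hx, zero_mul]
      · have h2 := hk (fun x => v z x / ∑ x', v z x') (fun x => div_nonneg (hv0 z x) hV0.le)
          (by rw [← Finset.sum_div, div_self hV0.ne'])
        rw [← mul_le_mul_iff_right₀ hV0, Finset.mul_sum] at h2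
        refine le_trans (le_of_eq ?_) h2
        refine Finset.sum_congr rfl fun x _ => ?_
        rw [← mul_assoc, mul_div_cancel₀ _ hV0.ne']
    calc _ ≤ ∑ z, (∑ x, v z x) * C := Finset.sum_le_sum fun z _ => h1 z
      _ = C := by
        have h2 := hp.sum_integral κ
        rw [Fintype.sum_prod_type] at h2
        rw [← Finset.sum_mul, h2, one_mul]
  refine le_trans ?_ (add_le_add_right hC _)
  rw [finMI, finMI, ← integral_add (hq.integrable_finRelEnt κ _) hint]
  refine integral_mono_ae (hp'.integrable_finRelEnt κ _)
    ((hq.integrable_finRelEnt κ _).add hint) ?_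
  filter_upwards [hp.ae_abs κ] with a ha
  rw [finRelEnt_prod (p' a), finRelEnt, ← Finset.sum_add_distrib]
  refine Finset.sum_le_sum fun z _ => ?_
  have h1 : ∀ y, ∫ a', p' a' (z, y) ∂κ = ∑ x, v z x * k x y := by
    intro y
    simp only [h']
    rw [integral_finsetSum _ fun x _ => (hp.integrable κ (z, x)).mul_const _]
    simp only [integral_mul_const, hv]
  have h2 : ∫ a', q a' z ∂κ = ∑ x, v z x := by
    simp only [h]
    rw [integral_finsetSum _ fun x _ => hp.integrable κ (z, x)]
  simp only [h1, h2]
  simp only [h', h]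
  rcases (Finset.sum_nonneg fun x _ => hv0 z x : 0 ≤ ∑ x, v z x).eq_or_lt with h0 | hV0
  · have h1 := (Finset.sum_eq_zero_iff_of_nonneg fun x _ => hv0 z x).1 h0.symm
    have h3 : ∀ x, p a (z, x) = 0 := fun x => ha (z, x) (h1 x (Finset.mem_univ x))
    simp [h3, finRelEnt]
  · exact finRelEnt_output_le hk0 hk1 (fun x => hp.nonneg a (z, x)) (hv0 z)
      (fun x => ha (z, x)) hV0

lemma finMI_eq_zero_of_subsingleton {β : Type*} [Fintype β] [Subsingleton β] {p : α → β → ℝ}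
    (hp : IsFinKernel p) : finMI κ p = 0 := by
  have h1 : ∀ a b, p a b = 1 := fun a b => by
    rw [← hp.sum_eq_one a]
    exact (Finset.sum_eq_single b (fun b' _ hb => absurd (Subsingleton.elim b' b) hb)
      (by simp)).symm
  simp [finMI, finRelEnt, h1]

/-- At an atom `a`, the mean of `p` at `b` is at least $\kappa\{a\}\,p_a(b)$. So each log-ratio is
at most $-\log\kappa\{a\}$, and averaging over the atoms gives the entropy. -/
lemma finMI_le_measureEntropy [MeasurableSingletonClass α] {β : Type*} [Fintype β]
    {p : α → β → ℝ} (hp : IsFinKernel p) :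
    ENNReal.ofReal (finMI κ p / Real.log 2) ≤ measureEntropy κ := by
  have hl2 : 0 < Real.log 2 := Real.log_pos one_lt_two
  rw [measureEntropy]
  split_ifs with hS
  swap
  · exact le_top
  obtain ⟨S, hSc, hS0⟩ := hS
  have hpt : ∀ a, finRelEnt (p a) (fun b => ∫ a', p a' b ∂κ) ≤ -Real.log (κ.real {a}) ∨
      κ {a} = 0 := by
    intro a
    by_cases h0 : κ {a} = 0
    · exact Or.inr h0
    left
    have hpos : 0 < κ.real {a} := ENNReal.toReal_pos h0 (measure_ne_top _ _)
    have h1 : ∀ b, p a b * κ.real {a} ≤ ∫ a', p a' b ∂κ := by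
      intro b
      have h2 : ∫ a' in {a}, p a' b ∂κ ≤ ∫ a', p a' b ∂κ :=
        setIntegral_le_integral (hp.integrable κ b) (ae_of_all _ fun a => hp.nonneg a b)
      rwa [integral_singleton, smul_eq_mul, mul_comm] at h2
    calc finRelEnt (p a) (fun b => ∫ a', p a' b ∂κ) ≤ ∑ b, p a b * -Real.log (κ.real {a}) := by
          refine Finset.sum_le_sum fun b _ => ?_
          rcases (hp.nonneg a b).eq_or_lt with hb | hb
          · simp [← hb]
          refine mul_le_mul_of_nonneg_left ?_ hb.le
          rw [← Real.log_inv]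
          have h3 : 0 < p a b * κ.real {a} := by positivity
          refine Real.log_le_log (div_pos hb (h3.trans_le (h1 b))) ?_
          rw [div_le_iff₀ (h3.trans_le (h1 b)), ← div_eq_inv_mul, le_div_iff₀ hpos]
          exact h1 b
      _ = -Real.log (κ.real {a}) := by rw [← Finset.sum_mul, hp.sum_eq_one, one_mul]
  calc ENNReal.ofReal (finMI κ p / Real.log 2)
      ≤ ∫⁻ a, ENNReal.ofReal
          (finRelEnt (p a) (fun b => ∫ a', p a' b ∂κ) / Real.log 2) ∂κ := by
        rw [finMI, ← integral_div]
        set g := fun a => finRelEnt (p a) (fun b => ∫ a', p a' b ∂κ) / Real.log 2 with hg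
        have hgi : Integrable g κ := (hp.integrable_finRelEnt κ _).div_const _
        calc ENNReal.ofReal (∫ a, g a ∂κ) ≤ ENNReal.ofReal (∫ a, max (g a) 0 ∂κ) :=
              ENNReal.ofReal_le_ofReal (integral_mono hgi hgi.pos_part fun a => le_max_left _ _)
          _ = ∫⁻ a, ENNReal.ofReal (max (g a) 0) ∂κ :=
              ofReal_integral_eq_lintegral_ofReal hgi.pos_part
                (ae_of_all _ fun a => le_max_right _ _)
          _ = _ := by
            refine lintegral_congr fun a => ?_
            rcases le_total (g a) 0 with h | h
            · rw [max_eq_right h, ENNReal.ofReal_zero, ENNReal.ofReal_of_nonpos h]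
            · rw [max_eq_left h]
    _ = ∫⁻ a in S, ENNReal.ofReal
          (finRelEnt (p a) (fun b => ∫ a', p a' b ∂κ) / Real.log 2) ∂κ := by
        rw [Measure.restrict_eq_self_of_ae_mem]
        exact mem_ae_iff.2 hS0
    _ = ∑' a : S, ENNReal.ofReal
          (finRelEnt (p a) (fun b => ∫ a', p a' b ∂κ) / Real.log 2) * κ {(a : α)} :=
        lintegral_countable _ hSc
    _ ≤ ∑' a : S, ENNReal.ofReal (Real.negMulLog (κ.real {(a : α)}) / Real.log 2) := by
        refine ENNReal.tsum_le_tsum fun a => ?_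
        rcases hpt a with h1 | h1
        · rw [← ofReal_measureReal, ← ENNReal.ofReal_mul' measureReal_nonneg]
          refine ENNReal.ofReal_le_ofReal ?_
          rw [Real.negMulLog, div_mul_eq_mul_div]
          refine div_le_div_of_nonneg_right ?_ hl2.le
          nlinarith [mul_le_mul_of_nonneg_right h1 (measureReal_nonneg (μ := κ) (s := {(a : α)}))]
        · simp [h1]
    _ ≤ ∑' a, ENNReal.ofReal (Real.negMulLog (κ.real {a}) / Real.log 2) :=
        ENNReal.tsum_comp_le_tsum_of_injective Subtype.val_injective _

end FinMI

/-! ### Push-forward of finite kernels and conditional independence -/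

open Classical in
/-- The conditional law of a function `f` of a variable of conditional law `q`. -/
noncomputable def finPush {α O β : Type*} [Fintype O] (f : O → β) (q : α → O → ℝ) (a : α)
    (b : β) : ℝ :=
  ∑ o with f o = b, q a o

lemma finPush_comp {α O β γ : Type*} [Fintype O] [Fintype β] {q : α → O → ℝ}
    (f : O → β) (g : β → γ) (a : α) (c : γ) :
    finPush (fun o => g (f o)) q a c = finPush g (finPush f q) a c := by
  classical
  simp only [finPush]
  rw [← Finset.sum_fiberwise_of_maps_to (s := Finset.univ.filter fun o => g (f o) = c)
    (t := Finset.univ.filter fun b => g b = c) (g := f) (by simp)]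
  refine Finset.sum_congr (by congr) fun b hb => Finset.sum_congr ?_ fun _ _ => rfl
  ext o
  simp only [Finset.mem_filter, Finset.mem_univ, true_and] at hb ⊢
  constructor
  · exact fun h => h.2
  · exact fun h => ⟨by rw [h, hb], h⟩

section Push

variable {α O : Type*} [MeasurableSpace α] [Fintype O] {q : α → O → ℝ}

lemma IsFinKernel.push (hq : IsFinKernel q) {β : Type*} [Fintype β] (f : O → β) :
    IsFinKernel (finPush f q) where
  nonneg a b := Finset.sum_nonneg fun o _ => hq.nonneg a o
  sum_eq_one a := by
    classical
    rw [← hq.sum_eq_one a]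
    exact Finset.sum_fiberwise _ _ _
  measurable b := Finset.measurable_sum _ fun o _ => hq.measurable o

/-- Conditional independence of `B` from `a` given `Z`, stated through an exchange of pairs: `(mix o
o', mix o' o)` carries the `B`-value of `o` in its second entry, keeps both `Z`-values and preserves
the product of weights under `a` and `a'`. Hence the law of `B` given `Z` is the same for all `a`,
and `B` arises from `Z` through a fixed channel. -/
lemma finMI_push_le {κ : Measure α} [IsProbabilityMeasure κ] (hq : IsFinKernel q)
    {ζ β : Type*} [Fintype ζ] [Fintype β] (Z : O → ζ) (B : O → β) (mix : O → O → O)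
    (hinv : ∀ o o', Z o = Z o' → mix (mix o o') (mix o' o) = o)
    (hZ : ∀ o o', Z o = Z o' → Z (mix o o') = Z o)
    (hB : ∀ o o', Z o = Z o' → B (mix o o') = B o')
    (hmix : ∀ a a' o o', Z o = Z o' → q a o * q a' o' = q a (mix o o') * q a' (mix o' o)) :
    finMI κ (finPush B q) ≤ finMI κ (finPush Z q) := by
  classical
  set r : α → ζ → β → ℝ := fun a z b => ∑ o with Z o = z ∧ B o = b, q a o with hr
  have hr0 : ∀ a z b, 0 ≤ r a z b := fun a z b => Finset.sum_nonneg fun o _ => hq.nonneg a o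
  have hrZ : ∀ a z, ∑ b, r a z b = finPush Z q a z := by
    intro a z
    rw [finPush, ← Finset.sum_fiberwise _ B]
    refine Finset.sum_congr rfl fun b _ => Finset.sum_congr ?_ fun _ _ => rfl
    ext o; simp
  have hrB : ∀ a b, ∑ z, r a z b = finPush B q a b := by
    intro a b
    rw [finPush, ← Finset.sum_fiberwise _ Z]
    refine Finset.sum_congr rfl fun z _ => Finset.sum_congr ?_ fun _ _ => rfl
    ext o; simp [and_comm]
  have cross : ∀ a a' z b, r a z b * finPush Z q a' z = finPush Z q a z * r a' z b := by
    intro a a' z b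
    simp only [hr, finPush]
    rw [Finset.sum_mul_sum, Finset.sum_mul_sum, ← Finset.sum_product', ← Finset.sum_product']
    -- The exchange is its own inverse on pairs with equal `Z`, and moves the constraint on `B` from
    -- the first entry to the second.
    refine Finset.sum_nbij' (fun o => (mix o.1 o.2, mix o.2 o.1))
      (fun o => (mix o.1 o.2, mix o.2 o.1)) ?_ ?_ ?_ ?_ ?_
    · rintro ⟨o, o'⟩ ho
      simp only [Finset.mem_product, Finset.mem_filter, Finset.mem_univ, true_and] at ho ⊢
      obtain ⟨⟨h1, h2⟩, h3⟩ := ho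
      have h4 : Z o = Z o' := h1.trans h3.symm
      exact ⟨(hZ _ _ h4).trans h1, (hZ _ _ h4.symm).trans h3, (hB _ _ h4.symm).trans h2⟩
    · rintro ⟨o, o'⟩ ho
      simp only [Finset.mem_product, Finset.mem_filter, Finset.mem_univ, true_and] at ho ⊢
      obtain ⟨h1, h3, h2⟩ := ho
      have h4 : Z o = Z o' := h1.trans h3.symm
      exact ⟨⟨(hZ _ _ h4).trans h1, (hB _ _ h4).trans h2⟩, (hZ _ _ h4.symm).trans h3⟩
    · rintro ⟨o, o'⟩ ho
      simp only [Finset.mem_product, Finset.mem_filter, Finset.mem_univ, true_and] at ho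
      have h4 : Z o = Z o' := ho.1.1.trans ho.2.symm
      simp only [hinv _ _ h4, hinv _ _ h4.symm]
    · rintro ⟨o, o'⟩ ho
      simp only [Finset.mem_product, Finset.mem_filter, Finset.mem_univ, true_and] at ho
      have h4 : Z o = Z o' := ho.1.trans ho.2.1.symm
      simp only [hinv _ _ h4, hinv _ _ h4.symm]
    · rintro ⟨o, o'⟩ ho
      simp only [Finset.mem_product, Finset.mem_filter, Finset.mem_univ, true_and] at ho
      exact hmix a a' o o' (ho.1.1.trans ho.2.symm)
  have hrle : ∀ a z b, finPush Z q a z = 0 → r a z b = 0 := by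
    intro a z b h0
    rw [← hrZ, Finset.sum_eq_zero_iff_of_nonneg fun b _ => hr0 a z b] at h0
    exact h0 b (Finset.mem_univ b)
  refine finMI_le_of_channel (hq.push Z) (hq.push B)
    -- The conditional law is read off at any `a` that gives `z` positive weight; `cross` makes this
    -- choice irrelevant. Values `z` of weight zero for all `a` get a zero row.
    (fun z b => if h : ∃ a, finPush Z q a z ≠ 0 then r h.choose z b / finPush Z q h.choose z else 0)
    ?_ ?_ ?_
  · intro z b
    split_ifs with h
    · exact div_nonneg (hr0 _ _ _) ((hq.push Z).nonneg _ _)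
    · exact le_rfl
  · intro z h
    simp only [dif_pos h]
    rw [← Finset.sum_div, hrZ, div_self h.choose_spec]
  · intro a b
    rw [← hrB]
    refine Finset.sum_congr rfl fun z _ => ?_
    split_ifs with h
    · rw [← mul_div_assoc, eq_div_iff h.choose_spec, cross]
    · rw [mul_zero]
      push Not at h
      exact hrle a z b (h a)

end Push

/-! ### Relative entropy of measures with explicit densities -/

lemma klDiv_withDensity {α : Type*} [MeasurableSpace α] {P : Measure α} [IsFiniteMeasure P]
    {g : α → ℝ} (hg : Measurable g) (hg0 : ∀ x, 0 ≤ g x)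
    [IsFiniteMeasure (P.withDensity fun x => ENNReal.ofReal (g x))] :
    InformationTheory.klDiv (P.withDensity fun x => ENNReal.ofReal (g x)) P =
      ∫⁻ x, ENNReal.ofReal (InformationTheory.klFun (g x)) ∂P := by
  rw [InformationTheory.klDiv_eq_lintegral_klFun_of_ac (withDensity_absolutelyContinuous _ _)]
  refine lintegral_congr_ae ?_
  filter_upwards [Measure.rnDeriv_withDensity P hg.ennreal_ofReal] with x hx
  rw [hx, ENNReal.toReal_ofReal (hg0 x)]

lemma mul_klFun_div {u v : ℝ} (h : v = 0 → u = 0) :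
    v * InformationTheory.klFun (u / v) = u * Real.log (u / v) + v - u := by
  rw [InformationTheory.klFun_apply]
  by_cases hv : v = 0
  · simp [hv, h hv]
  · field_simp

/-- `klFun` adds the correction $v-u$ to $u\log(u/v)$; with equal total masses the corrections
cancel. -/
lemma sum_ofReal_klFun {β : Type*} [Fintype β] {u v : β → ℝ} (hu : ∀ b, 0 ≤ u b)
    (hv : ∀ b, 0 ≤ v b) (h : ∀ b, v b = 0 → u b = 0) (hsum : ∑ b, u b = ∑ b, v b) :
    ∑ b, ENNReal.ofReal (InformationTheory.klFun (u b / v b)) * ENNReal.ofReal (v b) =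
      ENNReal.ofReal (finRelEnt u v) := by
  have h0 : ∀ b, 0 ≤ v b * InformationTheory.klFun (u b / v b) := fun b =>
    mul_nonneg (hv b) (InformationTheory.klFun_nonneg (div_nonneg (hu b) (hv b)))
  calc _ = ∑ b, ENNReal.ofReal (v b * InformationTheory.klFun (u b / v b)) := by
        refine Finset.sum_congr rfl fun b _ => ?_
        rw [ENNReal.ofReal_mul (hv b), mul_comm]
    _ = ENNReal.ofReal (∑ b, v b * InformationTheory.klFun (u b / v b)) :=
        (ENNReal.ofReal_sum_of_nonneg fun b _ => h0 b).symm
    _ = _ := by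
        simp only [mul_klFun_div (h _), Finset.sum_sub_distrib, Finset.sum_add_distrib, hsum,
          add_sub_cancel_right, finRelEnt]

lemma finRelEnt_nonneg {β : Type*} [Fintype β] {u v : β → ℝ} (hu : ∀ b, 0 ≤ u b)
    (hv : ∀ b, 0 ≤ v b) (h : ∀ b, v b = 0 → u b = 0) (hsum : ∑ b, u b = ∑ b, v b) :
    0 ≤ finRelEnt u v := by
  have h1 := Finset.sum_le_sum fun b (_ : b ∈ Finset.univ) => sub_le_mul_log_div (hu b) (hv b) (h b)
  rw [Finset.sum_sub_distrib, hsum, sub_self] at h1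
  exact h1

lemma relEntropy_of_fintype {β : Type*} [Fintype β] [MeasurableSpace β]
    [MeasurableSingletonClass β] (Q P : Measure β) [IsProbabilityMeasure Q] [IsProbabilityMeasure P]
    (h : ∀ b, P.real {b} = 0 → Q.real {b} = 0) :
    relEntropy Q P =
      ENNReal.ofReal (finRelEnt (fun b => Q.real {b}) (fun b => P.real {b}) / Real.log 2) := by
  have hQ : Q = P.withDensity fun b => ENNReal.ofReal (Q.real {b} / P.real {b}) := by
    refine Measure.ext_of_singleton fun b => ?_
    rw [withDensity_apply _ (measurableSet_singleton b), lintegral_singleton]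
    by_cases hb : P.real {b} = 0
    · have hb' := h b hb
      rw [measureReal_eq_zero_iff] at hb hb'
      simp [hb, hb']
    · rw [← ofReal_measureReal (μ := P), ← ENNReal.ofReal_mul (by positivity), div_mul_cancel₀ _ hb,
        ofReal_measureReal]
  have hfin : IsFiniteMeasure
      (P.withDensity fun b => ENNReal.ofReal (Q.real {b} / P.real {b})) := by
    rw [← hQ]; infer_instance
  have hsum : ∀ (R : Measure β) [IsProbabilityMeasure R], ∑ b, R.real {b} = 1 := by
    intro R _
    rw [sum_measureReal_singleton]; simp
  rw [relEntropy, ENNReal.ofReal_div_of_pos (Real.log_pos one_lt_two)]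
  congr 1
  conv_lhs => rw [hQ]
  rw [klDiv_withDensity (measurable_of_finite _) (fun b => by positivity), lintegral_fintype]
  rw [← sum_ofReal_klFun (fun b => measureReal_nonneg) (fun b => measureReal_nonneg) h
    ((hsum Q).trans (hsum P).symm)]
  exact Finset.sum_congr rfl fun b _ => by rw [ofReal_measureReal]

/-! ### Channels between finite alphabets -/

/-- The transition matrix of a channel. -/
noncomputable def kernelMatrix {χ β : Type*} [MeasurableSpace χ] [MeasurableSpace β]
    (K : Kernel χ β) (x : χ) (y : β) : ℝ := (K x).real {y}

/-- The measure with given point masses. -/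
noncomputable def finMeasure {χ : Type*} [Fintype χ] [MeasurableSpace χ] (u : χ → ℝ) :
    Measure χ := ∑ x, ENNReal.ofReal (u x) • Measure.dirac x

lemma le_toReal_ofReal (a : ℝ) : a ≤ (ENNReal.ofReal a).toReal := by
  rw [ENNReal.toReal_ofReal']
  exact le_max_left _ _

lemma kernelMatrix_nonneg {χ β : Type*} [MeasurableSpace χ] [MeasurableSpace β] (K : Kernel χ β)
    (x : χ) (y : β) : 0 ≤ kernelMatrix K x y :=
  measureReal_nonneg

lemma sum_kernelMatrix {χ β : Type*} [MeasurableSpace χ] [MeasurableSpace β]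
    [Fintype β] [MeasurableSingletonClass β] (K : Kernel χ β) [IsMarkovKernel K] (x : χ) :
    ∑ y, kernelMatrix K x y = 1 := by
  simp only [kernelMatrix]
  rw [sum_measureReal_singleton]; simp

lemma sdpiSup_le_one {χ β : Type*} [MeasurableSpace χ] [MeasurableSpace β]
    (K : Kernel χ β) [IsMarkovKernel K] :
    (⨆ (P : ProbabilityMeasure χ) (Q : ProbabilityMeasure χ) (_ : Q ≠ P),
      relEntropy (K ∘ₘ (Q : Measure χ)) (K ∘ₘ (P : Measure χ)) /
        relEntropy (Q : Measure χ) (P : Measure χ)) ≤ 1 := by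
  refine iSup_le fun P => iSup_le fun Q => iSup_le fun _ => ?_
  refine ENNReal.div_le_of_le_mul ?_
  rw [one_mul]
  exact ENNReal.div_le_div_right (InformationTheory.klDiv_comp_right_le _ _ K) _

lemma sdpiConst_nonneg {χ β : Type*} [MeasurableSpace χ] [MeasurableSpace β]
    (K : Kernel χ β) : 0 ≤ sdpiConst K := ENNReal.toReal_nonneg

lemma sdpiConst_le_one {χ β : Type*} [MeasurableSpace χ] [MeasurableSpace β]
    (K : Kernel χ β) [IsMarkovKernel K] : sdpiConst K ≤ 1 := by
  have := ENNReal.toReal_mono ENNReal.one_ne_top (sdpiSup_le_one K)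
  simpa [sdpiConst] using this

/-- A crude bound, whose only role is to be finite: $\log r\le r$, and the output mass at `y` is at
least $v_xk(x,y)$, so each input contributes at most 1. -/
lemma finCapLE_card {χ β : Type*} [Fintype χ] [Fintype β] {k : χ → β → ℝ}
    (hk0 : ∀ x y, 0 ≤ k x y) (hk1 : ∀ x, ∑ y, k x y = 1) :
    FinCapLE k (Fintype.card χ) := by
  intro v hv hv1
  calc ∑ x, v x * finRelEnt (k x) (fun y => ∑ x', v x' * k x' y) ≤ ∑ _x : χ, (1 : ℝ) := by
        refine Finset.sum_le_sum fun x _ => ?_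
        rcases (hv x).eq_or_lt with hx | hx
        · simp [← hx]
        have h1 : finRelEnt (k x) (fun y => ∑ x', v x' * k x' y) ≤ ∑ y, k x y * (v x)⁻¹ := by
          refine Finset.sum_le_sum fun y _ => ?_
          rcases (hk0 x y).eq_or_lt with hy | hy
          · simp [← hy]
          have hle : v x * k x y ≤ ∑ x', v x' * k x' y :=
            Finset.single_le_sum (f := fun x' => v x' * k x' y)
              (fun x' _ => mul_nonneg (hv x') (hk0 x' y)) (Finset.mem_univ x)
          have hpos : 0 < v x * k x y := mul_pos hx hy
          refine mul_le_mul_of_nonneg_left ?_ hy.le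
          refine (Real.log_le_self (div_pos hy (hpos.trans_le hle)).le).trans ?_
          rw [div_le_iff₀ (hpos.trans_le hle), ← div_eq_inv_mul, le_div_iff₀ hx, mul_comm]
          exact hle
        rw [← Finset.sum_mul, hk1, one_mul] at h1
        have h2 := mul_le_mul_of_nonneg_left h1 hx.le
        rwa [mul_inv_cancel₀ hx.ne'] at h2
    _ = Fintype.card χ := by simp

section FiniteChannel

variable {χ β : Type*} [Fintype χ] [MeasurableSpace χ] [MeasurableSingletonClass χ]
  [Fintype β] [MeasurableSpace β] [MeasurableSingletonClass β]

lemma finMeasure_singleton (u : χ → ℝ) (x : χ) : finMeasure u {x} = ENNReal.ofReal (u x) := by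
  classical
  rw [finMeasure, Measure.finsetSum_apply, Finset.sum_eq_single x]
  · simp
  · intro y _ hy
    simp [hy]
  · simp

lemma finMeasure_real_singleton {u : χ → ℝ} (hu : ∀ x, 0 ≤ u x) (x : χ) :
    (finMeasure u).real {x} = u x := by
  rw [Measure.real, finMeasure_singleton, ENNReal.toReal_ofReal (hu x)]

lemma lintegral_finMeasure (u : χ → ℝ) (g : χ → ℝ≥0∞) :
    ∫⁻ x, g x ∂finMeasure u = ∑ x, g x * ENNReal.ofReal (u x) := by
  rw [lintegral_fintype]
  simp only [finMeasure_singleton]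

lemma isProbabilityMeasure_finMeasure {u : χ → ℝ} (hu : ∀ x, 0 ≤ u x) (h1 : ∑ x, u x = 1) :
    IsProbabilityMeasure (finMeasure u) := by
  refine ⟨?_⟩
  have h := lintegral_finMeasure u 1
  simp only [Pi.one_apply, lintegral_one, one_mul] at h
  rw [h, ← ENNReal.ofReal_sum_of_nonneg fun x _ => hu x, h1, ENNReal.ofReal_one]

lemma comp_finMeasure_real (K : Kernel χ β) [IsMarkovKernel K] {u : χ → ℝ} (hu : ∀ x, 0 ≤ u x)
    (y : β) : (K ∘ₘ finMeasure u).real {y} = ∑ x, u x * kernelMatrix K x y := by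
  rw [Measure.real, Measure.bind_apply (measurableSet_singleton y) K.aemeasurable,
    lintegral_finMeasure, ENNReal.toReal_sum fun x _ => ENNReal.mul_ne_top (measure_ne_top _ _)
      ENNReal.ofReal_ne_top]
  refine Finset.sum_congr rfl fun x _ => ?_
  rw [ENNReal.toReal_mul, ENNReal.toReal_ofReal (hu x), mul_comm]
  rfl

/-- The supremum behind `sdpiConst` is at most one by data processing, so passing to the reals loses
nothing, and the ratio for a given pair can be compared with it. -/
lemma finSDPI_of_sdpiConst_le (K : Kernel χ β) [IsMarkovKernel K] {c : ℝ}
    (hc : sdpiConst K ≤ c) : FinSDPI (kernelMatrix K) c := by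
  intro u v hu hv habs hu1 hv1
  have hl2 : 0 < Real.log 2 := Real.log_pos one_lt_two
  have hnn := finRelEnt_nonneg hu hv habs (hu1.trans hv1.symm)
  refine le_trans ?_ (mul_le_mul_of_nonneg_right hc hnn)
  -- Equal inputs are excluded from the supremum; for them the output divergence is zero.
  by_cases huv : u = v
  · subst huv
    have h0' : finRelEnt (fun y => ∑ x, u x * kernelMatrix K x y)
        (fun y => ∑ x, u x * kernelMatrix K x y) = 0 := by
      refine Finset.sum_eq_zero fun b _ => ?_
      by_cases hw : ∑ x, u x * kernelMatrix K x b = 0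
      · simp [hw]
      · simp [div_self hw]
    rw [h0']
    exact mul_nonneg (sdpiConst_nonneg K) hnn
  have := isProbabilityMeasure_finMeasure hu hu1
  have := isProbabilityMeasure_finMeasure hv hv1
  have hne : (⟨finMeasure u, inferInstance⟩ : ProbabilityMeasure χ) ≠
      ⟨finMeasure v, inferInstance⟩ := by
    intro h
    apply huv
    ext x
    have h1 : finMeasure u = finMeasure v := congrArg Subtype.val h
    rw [← finMeasure_real_singleton hu, h1, finMeasure_real_singleton hv]
  have hle : relEntropy (K ∘ₘ finMeasure u) (K ∘ₘ finMeasure v) /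
      relEntropy (finMeasure u) (finMeasure v) ≤
      (⨆ (P : ProbabilityMeasure χ) (Q : ProbabilityMeasure χ) (_ : Q ≠ P),
      relEntropy (K ∘ₘ (Q : Measure χ)) (K ∘ₘ (P : Measure χ)) /
        relEntropy (Q : Measure χ) (P : Measure χ)) :=
    le_iSup_of_le ⟨finMeasure v, inferInstance⟩ (le_iSup_of_le ⟨finMeasure u, inferInstance⟩
      (le_iSup_of_le hne le_rfl))
  have hin : relEntropy (finMeasure u) (finMeasure v) =
      ENNReal.ofReal (finRelEnt u v / Real.log 2) := by
    rw [relEntropy_of_fintype]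
    · simp only [finMeasure_real_singleton hu, finMeasure_real_singleton hv]
    · simpa only [finMeasure_real_singleton hu, finMeasure_real_singleton hv] using habs
  have hout : relEntropy (K ∘ₘ finMeasure u) (K ∘ₘ finMeasure v) =
      ENNReal.ofReal (finRelEnt (fun y => ∑ x, u x * kernelMatrix K x y)
        (fun y => ∑ x, v x * kernelMatrix K x y) / Real.log 2) := by
    rw [relEntropy_of_fintype]
    · simp only [comp_finMeasure_real K hu, comp_finMeasure_real K hv]
    · simp only [comp_finMeasure_real K hu, comp_finMeasure_real K hv]
      exact fun y => channel_abs hv habs fun x => kernelMatrix_nonneg K x y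
  have hpos : finRelEnt u v ≠ 0 := by
    intro h0
    rw [h0, zero_div, ENNReal.ofReal_zero, relEntropy, ENNReal.div_eq_zero_iff] at hin
    rcases hin with hin | hin
    · exact hne (Subtype.ext (InformationTheory.klDiv_eq_zero_iff.1 hin))
    · exact ENNReal.ofReal_ne_top hin
  have hpos' : 0 < finRelEnt u v := lt_of_le_of_ne hnn (Ne.symm hpos)
  have h1 := ENNReal.toReal_mono (ne_top_of_le_ne_top ENNReal.one_ne_top (sdpiSup_le_one K)) hle
  rw [hin, hout, ENNReal.toReal_div, ENNReal.toReal_ofReal (div_pos hpos' hl2).le] at h1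
  have h2 := (div_le_iff₀ (div_pos hpos' hl2)).1 h1
  have h3 := (le_toReal_ofReal _).trans h2
  rw [← mul_div_assoc, div_le_div_iff_of_pos_right hl2] at h3
  exact h3

lemma ofReal_le_capacity (K : Kernel χ β) [IsMarkovKernel K] {v : χ → ℝ} (hv : ∀ x, 0 ≤ v x)
    (hv1 : ∑ x, v x = 1) :
    ENNReal.ofReal ((∑ x, v x * finRelEnt (kernelMatrix K x)
      (fun y => ∑ x', v x' * kernelMatrix K x' y)) / Real.log 2) ≤ capacity K := by
  have := isProbabilityMeasure_finMeasure hv hv1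
  refine le_trans (le_of_eq ?_) (le_iSup (fun P : ProbabilityMeasure χ =>
    relEntropy ((P : Measure χ) ⊗ₘ K) ((P : Measure χ).prod (K ∘ₘ (P : Measure χ))))
      ⟨finMeasure v, inferInstance⟩)
  have h1 : ∀ x y, (finMeasure v ⊗ₘ K).real {(x, y)} = v x * kernelMatrix K x y := by
    intro x y
    rw [Measure.real, ← Set.singleton_prod_singleton, Measure.compProd_apply_prod
      (measurableSet_singleton x) (measurableSet_singleton y), lintegral_singleton,
      finMeasure_singleton, ENNReal.toReal_mul, ENNReal.toReal_ofReal (hv x), mul_comm]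
    rfl
  have h2 : ∀ x y, ((finMeasure v).prod (K ∘ₘ finMeasure v)).real {(x, y)} =
      v x * ∑ x', v x' * kernelMatrix K x' y := by
    intro x y
    rw [← comp_finMeasure_real K hv, ← Set.singleton_prod_singleton, measureReal_prod_prod,
      finMeasure_real_singleton hv]
  rw [ProbabilityMeasure.coe_mk, relEntropy_of_fintype]
  · simp only [finRelEnt, Fintype.sum_prod_type, h1, h2, Finset.mul_sum]
    congr 2
    refine Finset.sum_congr rfl fun x _ => Finset.sum_congr rfl fun y _ => ?_
    by_cases hx : v x = 0
    · simp [hx]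
    · rw [← Finset.mul_sum, mul_div_mul_left _ _ hx, mul_assoc]
  · rintro ⟨x, y⟩ h0
    rw [h2] at h0
    rw [h1]
    rcases mul_eq_zero.1 h0 with h0 | h0
    · rw [h0, zero_mul]
    · exact (Finset.sum_eq_zero_iff_of_nonneg fun x _ =>
        mul_nonneg (hv x) (kernelMatrix_nonneg K x y)).1 h0 x (Finset.mem_univ x)

/-- A real constant makes the recursions real inequalities. If the capacity were infinite, any valid
finite constant would do. -/
lemma exists_finCapLE (K : Kernel χ β) [IsMarkovKernel K] :
    ∃ C : ℝ, 0 ≤ C ∧ FinCapLE (kernelMatrix K) C ∧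
      ENNReal.ofReal (C / Real.log 2) ≤ capacity K := by
  have hl2 : 0 < Real.log 2 := Real.log_pos one_lt_two
  by_cases hC : capacity K = ∞
  · exact ⟨Fintype.card χ, Nat.cast_nonneg _, finCapLE_card (kernelMatrix_nonneg K)
      (sum_kernelMatrix K), hC ▸ le_top⟩
  · refine ⟨(capacity K).toReal * Real.log 2, by positivity, fun v hv hv1 => ?_, ?_⟩
    · have h1 := ENNReal.toReal_mono hC (ofReal_le_capacity K hv hv1)
      exact (div_le_iff₀ hl2).1 ((le_toReal_ofReal _).trans h1)
    · rw [mul_div_cancel_right₀ _ hl2.ne', ENNReal.ofReal_toReal hC]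

end FiniteChannel

/-! ### Conditional mutual information with a function of a finite-valued variable -/

/-- The Markov kernel with a given finite transition matrix. -/
noncomputable def finKernel {α β : Type*} [MeasurableSpace α] [Fintype β] [MeasurableSpace β]
    {p : α → β → ℝ} (hp : IsFinKernel p) : Kernel α β where
  toFun a := finMeasure (p a)
  measurable' := by
    refine Measure.measurable_of_measurable_coe _ fun s _ => ?_
    simp only [finMeasure, Measure.finsetSum_apply, Measure.smul_apply, smul_eq_mul]
    exact Finset.measurable_sum _ fun b _ => (hp.measurable b).ennreal_ofReal.mul_const _

lemma IsFinKernel.prodMk {α β γ : Type*} [MeasurableSpace α] [MeasurableSpace γ]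
    [Fintype β] {p : γ × α → β → ℝ} (hp : IsFinKernel p) (s : γ) :
    IsFinKernel fun a => p (s, a) :=
  ⟨fun _ => hp.nonneg _, fun _ => hp.sum_eq_one _,
    fun b => (hp.measurable b).comp measurable_prodMk_left⟩

lemma IsFinKernel.average {α β γ : Type*} [MeasurableSpace α] [MeasurableSpace γ]
    [Fintype β] {p : γ × α → β → ℝ} (hp : IsFinKernel p) (κ : Kernel γ α)
    [IsMarkovKernel κ] : IsFinKernel fun s b => ∫ a, p (s, a) b ∂κ s where
  nonneg _ _ := MeasureTheory.integral_nonneg fun _ => hp.nonneg _ _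
  sum_eq_one s := (hp.prodMk s).sum_integral (κ s)
  measurable b :=
    ((hp.measurable b).stronglyMeasurable.integral_kernel_prod_right' (κ := κ)).measurable

lemma ofReal_finMI {α β : Type*} [MeasurableSpace α] [Fintype β] {κ : Measure α}
    [IsProbabilityMeasure κ] {p : α → β → ℝ}
    (hp : IsFinKernel p) :
    ENNReal.ofReal (finMI κ p) =
      ∫⁻ a, ENNReal.ofReal (finRelEnt (p a) fun b => ∫ a', p a' b ∂κ) ∂κ := by
  refine ofReal_integral_eq_lintegral_ofReal (hp.integrable_finRelEnt κ _) ?_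
  filter_upwards [hp.ae_abs κ] with a ha
  exact finRelEnt_nonneg (hp.nonneg a) (hp.integral_nonneg κ) ha
    ((hp.sum_eq_one a).trans (hp.sum_integral κ).symm)

section CondMutualInfo

variable {α β γ : Type*} [MeasurableSpace α] [MeasurableSpace γ] [Fintype β] [MeasurableSpace β]
  [MeasurableSingletonClass β]

instance {p : α → β → ℝ} (hp : IsFinKernel p) : IsMarkovKernel (finKernel hp) :=
  ⟨fun a => isProbabilityMeasure_finMeasure (hp.nonneg a) (hp.sum_eq_one a)⟩

lemma lintegral_finKernel {p : α → β → ℝ} (hp : IsFinKernel p) (a : α) (g : β → ℝ≥0∞) :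
    ∫⁻ b, g b ∂finKernel hp a = ∑ b, g b * ENNReal.ofReal (p a b) :=
  lintegral_finMeasure _ _

lemma lintegral_compProd_finKernel {p : α → β → ℝ} (hp : IsFinKernel p) (P : Measure α)
    [SFinite P] {g : α × β → ℝ≥0∞} (hg : Measurable g) :
    ∫⁻ x, g x ∂(P ⊗ₘ finKernel hp) = ∫⁻ a, ∑ b, g (a, b) * ENNReal.ofReal (p a b) ∂P := by
  rw [Measure.lintegral_compProd hg]
  exact lintegral_congr fun a => lintegral_finKernel hp a _

/-- Replacing the conditional law of `b` by its average over `κ s` makes `b` independent of `a`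
given `s`. The joint law has density $p/p'$ against this one, and its divergence is the average over
`s` of the mutual information under `κ s`. -/
lemma klDiv_compProd_finKernel {ν : Measure γ} [IsProbabilityMeasure ν] {κ : Kernel γ α}
    [IsMarkovKernel κ] {p : γ × α → β → ℝ} (hp : IsFinKernel p) :
    InformationTheory.klDiv ((ν ⊗ₘ κ) ⊗ₘ finKernel hp)
      ((ν ⊗ₘ κ) ⊗ₘ (Kernel.prodMkRight α (finKernel (hp.average κ)))) =
      ∫⁻ s, ENNReal.ofReal (finMI (κ s) fun a => p (s, a)) ∂ν := by
  set p' : γ × α → β → ℝ := fun x b => ∫ a, p (x.1, a) b ∂κ x.1 with hp'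
  have hp'k : IsFinKernel p' :=
    ⟨fun x => (hp.average κ).nonneg x.1, fun x => (hp.average κ).sum_eq_one x.1,
      fun b => ((hp.average κ).measurable b).comp measurable_fst⟩
  have hker : Kernel.prodMkRight α (finKernel (hp.average κ)) = finKernel hp'k := rfl
  rw [hker]
  set g : (γ × α) × β → ℝ := fun x => p x.1 x.2 / p' x.1 x.2 with hg
  have hpm : ∀ {r : γ × α → β → ℝ}, IsFinKernel r →
      Measurable fun x : (γ × α) × β => r x.1 x.2 := fun hr =>
    measurable_from_prod_countable_left fun b => hr.measurable b
  have hgm : Measurable g := (hpm hp).div (hpm hp'k)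
  -- Almost everywhere absolute continuity holds for each `s` by `ae_abs`; measurability of the
  -- event carries it over to the joint law.
  have habs : ∀ᵐ x ∂(ν ⊗ₘ κ), ∀ b, p' x b = 0 → p x b = 0 := by
    refine (Measure.ae_compProd_iff ?_).2 (ae_of_all _ fun s => (hp.prodMk s).ae_abs (κ s))
    have : {x : γ × α | ∀ b, p' x b = 0 → p x b = 0} =
        ⋂ b, {x | p' x b = 0}ᶜ ∪ {x | p x b = 0} := by
      ext x; simp [imp_iff_not_or]
    rw [this]
    exact MeasurableSet.iInter fun b =>
      ((hp'k.measurable b) (measurableSet_singleton 0)).compl.union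
        ((hp.measurable b) (measurableSet_singleton 0))
  have hdens : (ν ⊗ₘ κ) ⊗ₘ finKernel hp =
      ((ν ⊗ₘ κ) ⊗ₘ finKernel hp'k).withDensity fun x => ENNReal.ofReal (g x) := by
    refine Measure.ext_of_lintegral _ fun f hf => ?_
    rw [lintegral_withDensity_eq_lintegral_mul _ hgm.ennreal_ofReal hf,
      lintegral_compProd_finKernel hp _ hf,
      lintegral_compProd_finKernel hp'k _ (hgm.ennreal_ofReal.mul hf)]
    refine lintegral_congr_ae ?_
    filter_upwards [habs] with x hx
    refine Finset.sum_congr rfl fun b _ => ?_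
    simp only [Pi.mul_apply, hg]
    rw [mul_right_comm, ← ENNReal.ofReal_mul (div_nonneg (hp.nonneg _ _) (hp'k.nonneg _ _)),
      mul_comm]
    congr 2
    by_cases h0 : p' x b = 0
    · rw [h0, hx b h0, mul_zero]
    · rw [div_mul_cancel₀ _ h0]
  have hfin : IsFiniteMeasure
      (((ν ⊗ₘ κ) ⊗ₘ finKernel hp'k).withDensity fun x => ENNReal.ofReal (g x)) := by
    rw [← hdens]; infer_instance
  have hkg : Measurable fun x => ENNReal.ofReal (InformationTheory.klFun (g x)) :=
    (InformationTheory.measurable_klFun.comp hgm).ennreal_ofReal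
  rw [hdens, klDiv_withDensity hgm fun x => div_nonneg (hp.nonneg _ _) (hp'k.nonneg _ _),
    lintegral_compProd_finKernel hp'k _ hkg,
    lintegral_congr_ae (g := fun x => ENNReal.ofReal (finRelEnt (p x) (p' x))),
    Measure.lintegral_compProd]
  · exact lintegral_congr fun s => (ofReal_finMI (hp.prodMk s)).symm
  · refine Measurable.ennreal_ofReal (Finset.measurable_sum _ fun b _ => ?_)
    exact (hp.measurable b).mul
      (Real.measurable_log.comp ((hp.measurable b).div (hp'k.measurable b)))
  · filter_upwards [habs] with x hx
    exact sum_ofReal_klFun (hp.nonneg x) (hp'k.nonneg x) hx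
      ((hp.sum_eq_one x).trans (hp'k.sum_eq_one x).symm)

/-- Given `V`, the laws of `f` and `ψ` are images of those of `A` and `Y`. So the joint law and the
conditionally independent one are images, under the same map, of the two laws on `(V, A, Y)`
compared in `klDiv_compProd_finKernel`; data processing for `klDiv` finishes. -/
theorem condMutualInfo_le_lintegral_finMI {Ω Z₁ Z₂ : Type*} [MeasurableSpace Ω]
    [StandardBorelSpace α] [Nonempty α]
    [MeasurableSpace Z₁] [StandardBorelSpace Z₁] [Nonempty Z₁]
    [MeasurableSpace Z₂] [StandardBorelSpace Z₂] [Nonempty Z₂]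
    (μ : Measure Ω) [IsProbabilityMeasure μ] {A : Ω → α} {V : Ω → γ} {Y : Ω → β}
    (hA : Measurable A) (hV : Measurable V) (hY : Measurable Y)
    {f : γ × α → Z₁} {ψ : γ × β → Z₂} (hf : Measurable f) (hψ : Measurable ψ)
    {p : γ × α → β → ℝ} (hp : IsFinKernel p)
    (hlaw : μ.map (fun ω => ((V ω, A ω), Y ω)) = μ.map (fun ω => (V ω, A ω)) ⊗ₘ finKernel hp) :
    condMutualInfo (fun ω => f (V ω, A ω)) (fun ω => ψ (V ω, Y ω)) V μ ≤
      ∫⁻ s, ENNReal.ofReal (finMI (condDistrib A V μ s) (fun a => p (s, a)) / Real.log 2)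
        ∂(μ.map V) := by
  have hl2 : 0 < Real.log 2 := Real.log_pos one_lt_two
  set ν := μ.map V with hν
  have : IsProbabilityMeasure ν := Measure.isProbabilityMeasure_map hV.aemeasurable
  set κ := condDistrib A V μ with hκ
  have hVA : μ.map (fun ω => (V ω, A ω)) = ν ⊗ₘ κ := (compProd_map_condDistrib hA.aemeasurable).symm
  rw [hVA] at hlaw
  set η := finKernel (hp.average κ) with hη
  set κf : Kernel γ Z₁ := (Kernel.id ×ₖ κ).map f with hκf
  set ηψ : Kernel γ Z₂ := (Kernel.id ×ₖ η).map ψ with hηψ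
  have : IsMarkovKernel κf := Kernel.IsMarkovKernel.map _ hf
  have : IsMarkovKernel ηψ := Kernel.IsMarkovKernel.map _ hψ
  have hκfl : ∀ s (g : Z₁ → ℝ≥0∞), Measurable g → ∫⁻ z, g z ∂κf s = ∫⁻ a, g (f (s, a)) ∂κ s := by
    intro s g hg
    have hgf : Measurable fun c => g (f c) := hg.comp hf
    rw [hκf, Kernel.map_apply _ hf, lintegral_map hg hf, Kernel.lintegral_prod _ _ _ hgf,
      Kernel.id_apply]
    exact lintegral_dirac' _
      (Measurable.lintegral_kernel_prod_right' (κ := Kernel.const γ (κ s)) hgf)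
  have hηψl : ∀ s (g : Z₂ → ℝ≥0∞), Measurable g →
      ∫⁻ z, g z ∂ηψ s = ∫⁻ b, g (ψ (s, b)) ∂η s := by
    intro s g hg
    have hgf : Measurable fun c => g (ψ c) := hg.comp hψ
    rw [hηψ, Kernel.map_apply _ hψ, lintegral_map hg hψ, Kernel.lintegral_prod _ _ _ hgf,
      Kernel.id_apply]
    exact lintegral_dirac' _
      (Measurable.lintegral_kernel_prod_right' (κ := Kernel.const γ (η s)) hgf)
  have h1 : condDistrib (fun ω => f (V ω, A ω)) V μ =ᵐ[ν] κf := by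
    refine condDistrib_ae_eq_of_measure_eq_compProd V (hf.comp (hV.prodMk hA)).aemeasurable ?_
    refine Measure.ext_of_lintegral _ fun g hg => ?_
    have hm : Measurable fun x : γ × α => (x.1, f x) := measurable_fst.prodMk hf
    have e1 : μ.map (fun ω => (V ω, f (V ω, A ω))) = (ν ⊗ₘ κ).map (fun x => (x.1, f x)) := by
      rw [← hVA, Measure.map_map hm (hV.prodMk hA)]
      rfl
    have hgm : Measurable fun x : γ × α => g (x.1, f x) := hg.comp hm
    change ∫⁻ a, g a ∂(μ.map fun ω => (V ω, f (V ω, A ω))) = _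
    rw [e1, lintegral_map hg hm, Measure.lintegral_compProd hgm,
      Measure.lintegral_compProd hg]
    exact lintegral_congr fun s => (hκfl s _ (hg.comp measurable_prodMk_left)).symm
  have h2 : condDistrib (fun ω => ψ (V ω, Y ω)) V μ =ᵐ[ν] ηψ := by
    refine condDistrib_ae_eq_of_measure_eq_compProd V (hψ.comp (hV.prodMk hY)).aemeasurable ?_
    refine Measure.ext_of_lintegral _ fun g hg => ?_
    have hm : Measurable fun x : (γ × α) × β => (x.1.1, ψ (x.1.1, x.2)) := by fun_prop
    have e1 : μ.map (fun ω => (V ω, ψ (V ω, Y ω))) =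
        ((ν ⊗ₘ κ) ⊗ₘ finKernel hp).map (fun x => (x.1.1, ψ (x.1.1, x.2))) := by
      rw [← hlaw, Measure.map_map hm ((hV.prodMk hA).prodMk hY)]
      rfl
    have hgm : Measurable fun x : (γ × α) × β => g (x.1.1, ψ (x.1.1, x.2)) := hg.comp hm
    change ∫⁻ a, g a ∂(μ.map fun ω => (V ω, ψ (V ω, Y ω))) = _
    rw [e1, lintegral_map hg hm, lintegral_compProd_finKernel hp _ hgm,
      Measure.lintegral_compProd hg, Measure.lintegral_compProd]
    · refine lintegral_congr fun s => ?_
      rw [hηψl s (fun z => g (s, z)) (hg.comp measurable_prodMk_left), hη, lintegral_finKernel,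
        lintegral_finsetSum]
      · refine Finset.sum_congr rfl fun b _ => ?_
        dsimp only
        rw [lintegral_const_mul _ ((hp.prodMk s).measurable b).ennreal_ofReal,
          ofReal_integral_eq_lintegral_ofReal ((hp.prodMk s).integrable (κ s) b)
            (ae_of_all _ fun a => hp.nonneg _ _)]
      · intro b _
        dsimp only
        exact ((hp.prodMk s).measurable b).ennreal_ofReal.const_mul _
    · refine Finset.measurable_sum _ fun b _ => ?_
      exact ((hg.comp hm).comp measurable_prodMk_right).mul (hp.measurable b).ennreal_ofReal
  have hG : Measurable fun x : (γ × α) × β => (x.1.1, f x.1, ψ (x.1.1, x.2)) := by fun_prop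
  have hjoint : μ.map (fun ω => (V ω, f (V ω, A ω), ψ (V ω, Y ω))) =
      ((ν ⊗ₘ κ) ⊗ₘ finKernel hp).map fun x => (x.1.1, f x.1, ψ (x.1.1, x.2)) := by
    rw [← hlaw, Measure.map_map hG ((hV.prodMk hA).prodMk hY)]
    rfl
  -- Conditional distributions are determined only almost everywhere, so they are first replaced by
  -- the explicit kernels `κf` and `ηψ`.
  have hprod : ν ⊗ₘ (condDistrib (fun ω => f (V ω, A ω)) V μ ×ₖ
      condDistrib (fun ω => ψ (V ω, Y ω)) V μ) =
      ((ν ⊗ₘ κ) ⊗ₘ Kernel.prodMkRight α η).map fun x => (x.1.1, f x.1, ψ (x.1.1, x.2)) := by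
    have e1 : ν ⊗ₘ (condDistrib (fun ω => f (V ω, A ω)) V μ ×ₖ
        condDistrib (fun ω => ψ (V ω, Y ω)) V μ) = ν ⊗ₘ (κf ×ₖ ηψ) := by
      refine Measure.compProd_congr ?_
      filter_upwards [h1, h2] with s hs1 hs2
      rw [Kernel.prod_apply, Kernel.prod_apply, hs1, hs2]
    rw [e1]
    refine Measure.ext_of_lintegral _ fun g hg => ?_
    have hgG : Measurable fun x : (γ × α) × β => g (x.1.1, f x.1, ψ (x.1.1, x.2)) := hg.comp hG
    rw [lintegral_map hg hG, Measure.lintegral_compProd hg,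
      Measure.lintegral_compProd hgG, Measure.lintegral_compProd
        (Measurable.lintegral_kernel_prod_right' hgG)]
    refine lintegral_congr fun s => ?_
    have hgs : Measurable fun c : Z₁ × Z₂ => g (s, c) := hg.comp measurable_prodMk_left
    rw [Kernel.lintegral_prod _ _ _ hgs, hκfl]
    · refine lintegral_congr fun a => ?_
      rw [hηψl s (fun z => g (s, f (s, a), z)) (hgs.comp measurable_prodMk_left)]
      rfl
    · exact Measurable.lintegral_kernel_prod_right' (κ := Kernel.const Z₁ (ηψ s)) hgs
  rw [condMutualInfo, relEntropy, hjoint, hprod]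
  refine (ENNReal.div_le_div_right (InformationTheory.klDiv_map_le _ _ hG) _).trans ?_
  rw [hη, klDiv_compProd_finKernel hp, div_eq_mul_inv, ← lintegral_mul_const']
  · refine le_of_eq (lintegral_congr fun s => ?_)
    rw [ENNReal.ofReal_div_of_pos hl2, div_eq_mul_inv]
  · exact ENNReal.inv_ne_top.2 (ENNReal.ofReal_pos.2 hl2).ne'

end CondMutualInfo

/-! ### Recursive inequalities -/

/-- Comparison principle: the right side of the recursion is monotone in the earlier values because
`c` lies in $[0,1]$; induction on the position, then on time. -/
lemma le_of_recursion {a b : ℕ → ℕ → ℝ} {c : ℕ → ℝ} {N T : ℕ} (hc0 : ∀ j, 0 ≤ c j)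
    (hc1 : ∀ j, c j ≤ 1)
    (ha : ∀ j < N, ∀ t < T, a (j + 1) (t + 1) ≤ (1 - c (j + 1)) * a (j + 1) t + c (j + 1) * a j t)
    (hb : ∀ j < N, ∀ t < T, (1 - c (j + 1)) * b (j + 1) t + c (j + 1) * b j t ≤ b (j + 1) (t + 1))
    (h0 : ∀ j ≤ N, a j 0 ≤ b j 0) (hfirst : ∀ t ≤ T, a 0 t ≤ b 0 t) :
    ∀ j ≤ N, ∀ t ≤ T, a j t ≤ b j t := by
  intro j
  induction j with
  | zero => exact fun _ => hfirst
  | succ j ihj =>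
    intro hj t
    induction t with
    | zero => exact fun _ => h0 _ hj
    | succ t iht =>
      intro ht
      refine (ha j hj t ht).trans (le_trans ?_ (hb j hj t ht))
      exact add_le_add
        (mul_le_mul_of_nonneg_left (iht (by omega)) (sub_nonneg.2 (hc1 _)))
        (mul_le_mul_of_nonneg_left (ihj (by omega) t (by omega)) (hc0 _))

lemma one_sub_pow_mono {c : ℝ} (hc0 : 0 ≤ c) (hc1 : c ≤ 1) {k l : ℕ} (h : k ≤ l) :
    1 - (1 - c) ^ k ≤ 1 - (1 - c) ^ l :=
  sub_le_sub_left (pow_le_pow_of_le_one (by linarith) (by linarith) h) 1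

lemma one_sub_pow_nonneg {c : ℝ} (hc0 : 0 ≤ c) (hc1 : c ≤ 1) (k : ℕ) : 0 ≤ 1 - (1 - c) ^ k :=
  sub_nonneg.2 (pow_le_one₀ (by linarith) (by linarith))

/-- The supersolution is $Q_j(t-j)$ with $Q_j(k)=M(k)\prod_{i\le j}(1-(1-c_i)^k)$: information needs
one step per edge, so position `j` has had only `t - j` useful steps. Truncated subtraction and
$M(0)=0$ give zero before the first arrival. -/
lemma le_prod_of_recursion {a : ℕ → ℕ → ℝ} {c : ℕ → ℝ} {M : ℕ → ℝ} {N T : ℕ}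
    (hc0 : ∀ j, 0 ≤ c j) (hc1 : ∀ j, c j ≤ 1)
    (ha : ∀ j < N, ∀ t < T, a (j + 1) (t + 1) ≤ (1 - c (j + 1)) * a (j + 1) t + c (j + 1) * a j t)
    (h0 : ∀ j ≤ N, a j 0 ≤ 0) (hfirst : ∀ t ≤ T, a 0 t ≤ M t) (hM : Monotone M) (hM0 : M 0 = 0) :
    a N T ≤ M (T - N) * ∏ i ∈ Finset.range N, (1 - (1 - c (i + 1)) ^ (T - N)) := by
  have hMn : ∀ k, 0 ≤ M k := fun k => hM0 ▸ hM (Nat.zero_le k)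
  set Q : ℕ → ℕ → ℝ := fun j k => M k * ∏ i ∈ Finset.range j, (1 - (1 - c (i + 1)) ^ k) with hQ
  have hQ0 : ∀ j k, 0 ≤ Q j k := fun j k =>
    mul_nonneg (hMn k) (Finset.prod_nonneg fun i _ => one_sub_pow_nonneg (hc0 _) (hc1 _) k)
  have hQm : ∀ j, Monotone (Q j) := fun j k l hkl =>
    mul_le_mul (hM hkl) (Finset.prod_le_prod
      (fun i _ => one_sub_pow_nonneg (hc0 _) (hc1 _) k)
      (fun i _ => one_sub_pow_mono (hc0 _) (hc1 _) hkl))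
      (Finset.prod_nonneg fun i _ => one_sub_pow_nonneg (hc0 _) (hc1 _) k) (hMn l)
  have hQs : ∀ j k, Q (j + 1) k = Q j k * (1 - (1 - c (j + 1)) ^ k) := fun j k => by
    simp only [hQ, Finset.prod_range_succ, mul_assoc]
  have hQz : ∀ j, Q j 0 = 0 := fun j => by simp [hQ, hM0]
  refine le_of_recursion (b := fun j t => Q j (t - j)) hc0 hc1 ha ?_ ?_ ?_ N le_rfl T le_rfl
  · intro j _ t _
    rw [Nat.add_sub_add_right]
    rcases Nat.lt_or_ge j t with hjt | hjt
    · obtain ⟨k, rfl⟩ : ∃ k, t = j + 1 + k := ⟨t - (j + 1), by omega⟩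
      rw [show j + 1 + k - (j + 1) = k by omega, show j + 1 + k - j = k + 1 by omega, hQs, hQs]
      -- Replacing $Q_j(k)$ by $Q_j(k+1)$ suffices, because $(1-c)(1-(1-c)^k)+c=1-(1-c)^{k+1}$.
      have h1 : Q j k * (1 - (1 - c (j + 1)) ^ k) ≤ Q j (k + 1) * (1 - (1 - c (j + 1)) ^ k) :=
        mul_le_mul_of_nonneg_right (hQm j (Nat.le_succ k))
          (one_sub_pow_nonneg (hc0 _) (hc1 _) k)
      have h2 := mul_le_mul_of_nonneg_left h1 (sub_nonneg.2 (hc1 (j + 1)))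
      rw [pow_succ]
      linarith
    · rw [show t - (j + 1) = 0 by omega, show t - j = 0 by omega, hQz, hQz]
      simp
  · intro j hj
    exact (h0 j hj).trans (hQ0 _ _)
  · intro t ht
    simpa [hQ] using hfirst t ht

/-! ### Binomial tails -/

/-- The probability of at least `j` successes in `t` independent trials with success probability
`p`, expressed through the time of the `j`-th success. -/
noncomputable def binTail (p : ℝ) : ℕ → ℕ → ℝ
  | 0, _ => 1
  | j + 1, t => p * ∑ k ∈ Finset.range t, binomProb k j p

/-- The sum of `binTail p j s` over the times `s < t`. -/
noncomputable def binTailSum (p : ℝ) (j t : ℕ) : ℝ := ∑ s ∈ Finset.range t, binTail p j s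

lemma binomProb_eq_zero {m k : ℕ} (h : m < k) (p : ℝ) : binomProb m k p = 0 := by
  simp [binomProb, Nat.choose_eq_zero_of_lt h]

lemma binomProb_zero_right (m : ℕ) (p : ℝ) : binomProb m 0 p = (1 - p) ^ m := by
  simp [binomProb]

lemma binomProb_succ_succ (m k : ℕ) (p : ℝ) :
    binomProb (m + 1) (k + 1) p = (1 - p) * binomProb m (k + 1) p + p * binomProb m k p := by
  rcases Nat.lt_or_ge k m with h | h
  · simp only [binomProb, Nat.choose_succ_succ, Nat.cast_add, Nat.add_sub_add_right]
    rw [show m - k = m - (k + 1) + 1 by omega]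
    ring
  · rw [binomProb_eq_zero (m := m) (k := k + 1) (by omega)]
    simp only [binomProb, Nat.choose_succ_succ, Nat.choose_eq_zero_of_lt (show m < k + 1 by omega),
      Nat.add_sub_add_right]
    push_cast
    ring

lemma binTail_zero_right (p : ℝ) (j : ℕ) : binTail p (j + 1) 0 = 0 := by simp [binTail]

/-- Pascal's rule for `binomProb`, summed over time. Thus `binTail` solves the recursion with
equality, and so does its sum over time. -/
lemma binTail_succ (p : ℝ) (j t : ℕ) :
    binTail p (j + 1) (t + 1) = (1 - p) * binTail p (j + 1) t + p * binTail p j t := by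
  cases j with
  | zero =>
    simp only [binTail, binomProb_zero_right]
    rw [Finset.sum_range_succ', pow_zero]
    simp only [pow_succ']
    rw [← Finset.mul_sum]
    ring
  | succ j =>
    simp only [binTail]
    rw [Finset.sum_range_succ', binomProb_eq_zero (Nat.succ_pos j), add_zero]
    simp only [binomProb_succ_succ, Finset.sum_add_distrib, ← Finset.mul_sum]
    ring

lemma binTail_one (p : ℝ) (t : ℕ) : binTail p 1 t = 1 - (1 - p) ^ t := by
  induction t with
  | zero => simp [binTail]
  | succ t ih =>
    rw [binTail_succ, ih, binTail, pow_succ]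
    ring

lemma binTailSum_zero_left (p : ℝ) (t : ℕ) : binTailSum p 0 t = t := by
  simp [binTailSum, binTail]

lemma binTailSum_zero_right (p : ℝ) (j : ℕ) : binTailSum p j 0 = 0 := by simp [binTailSum]

lemma binTailSum_succ (p : ℝ) (j t : ℕ) :
    binTailSum p (j + 1) (t + 1) = (1 - p) * binTailSum p (j + 1) t + p * binTailSum p j t := by
  simp only [binTailSum]
  rw [Finset.sum_range_succ', binTail_zero_right, add_zero]
  simp only [binTail_succ, Finset.sum_add_distrib, ← Finset.mul_sum]

/-- The exact solution satisfies the recursion, so the product supersolution bounds it too, starting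
from `binTail p 1 t`, which is $1-(1-p)^t$. -/
lemma binTail_le_pow {p : ℝ} (hp0 : 0 ≤ p) (hp1 : p ≤ 1) (N T : ℕ) :
    binTail p (N + 1) T ≤ (1 - (1 - p) ^ (T - N)) ^ (N + 1) := by
  have h := le_prod_of_recursion (a := fun j t => binTail p (j + 1) t) (c := fun _ => p)
    (M := fun k => 1 - (1 - p) ^ k) (N := N) (T := T) (fun _ => hp0) (fun _ => hp1)
    (fun j _ t _ => (binTail_succ p (j + 1) t).le) (fun j _ => (binTail_zero_right p j).le)
    (fun t _ => (binTail_one p t).le) (fun k l => one_sub_pow_mono hp0 hp1) (by simp)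
  rwa [Finset.prod_const, Finset.card_range, ← pow_succ'] at h

lemma binTailSum_le_pow {p : ℝ} (hp0 : 0 ≤ p) (hp1 : p ≤ 1) (N T : ℕ) :
    binTailSum p N T ≤ ((T - N : ℕ) : ℝ) * (1 - (1 - p) ^ (T - N)) ^ N := by
  have h := le_prod_of_recursion (a := binTailSum p) (c := fun _ => p)
    (M := fun k => (k : ℝ)) (N := N) (T := T) (fun _ => hp0) (fun _ => hp1)
    (fun j _ t _ => (binTailSum_succ p j t).le) (fun j _ => (binTailSum_zero_right p j).le)
    (fun t _ => (binTailSum_zero_left p t).le) Nat.mono_cast (by simp)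
  rwa [Finset.prod_const, Finset.card_range] at h

lemma binTail_eq_sum {n T : ℕ} (hn : 2 ≤ n) (p : ℝ) :
    binTail p (n - 1) T =
      p * ∑ i ∈ Finset.Icc 1 (T + 2 - n), binomProb (T - i) (n - 2) p := by
  obtain ⟨j, rfl⟩ : ∃ j, n = j + 2 := ⟨n - 2, by omega⟩
  rw [show j + 2 - 1 = j + 1 by omega, Nat.add_sub_cancel, Nat.add_sub_add_right, binTail]
  congr 1
  -- Terms with $i>T+2-n$ vanish because $T-i<n-2$; over the full range the substitution is $i=T-k$.
  rw [Finset.sum_subset (Finset.Icc_subset_Icc_right (Nat.sub_le T j))]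
  · refine Finset.sum_nbij' (fun k => T - k) (fun i => T - i) ?_ ?_ ?_ ?_ ?_
    · intro k hk; simp only [Finset.mem_range, Finset.mem_Icc] at hk ⊢; omega
    · intro k hk; simp only [Finset.mem_range, Finset.mem_Icc] at hk ⊢; omega
    · intro k hk; simp only [Finset.mem_range] at hk; omega
    · intro k hk; simp only [Finset.mem_Icc] at hk; omega
    · intro k hk
      simp only [Finset.mem_range] at hk
      rw [Nat.sub_sub_self hk.le]
  · intro i hi hi'
    simp only [Finset.mem_Icc] at hi hi'
    exact binomProb_eq_zero (by omega) p

/-- The term `f k` is counted once for each `s` with $k<s<T$, that is $T-1-k$ times. -/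
lemma sum_range_sum_range (f : ℕ → ℝ) (T : ℕ) :
    ∑ s ∈ Finset.range T, ∑ k ∈ Finset.range s, f k =
      ∑ i ∈ Finset.range T, f (T - 1 - i) * i := by
  have h1 : ∑ i ∈ Finset.range T, f (T - 1 - i) * i =
      ∑ k ∈ Finset.range T, f k * ((T : ℝ) - 1 - k) := by
    rw [← Finset.sum_range_reflect]
    refine Finset.sum_congr rfl fun k hk => ?_
    rw [Finset.mem_range] at hk
    rw [show T - 1 - (T - 1 - k) = k by omega, Nat.cast_sub (by omega), Nat.cast_sub (by omega)]
    simp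
  rw [h1]
  clear h1
  induction T with
  | zero => simp
  | succ T ih =>
    rw [Finset.sum_range_succ, ih, Finset.sum_range_succ _ T, ← Finset.sum_add_distrib]
    push_cast
    have : f T * ((T : ℝ) + 1 - 1 - T) = 0 := by ring
    rw [this, add_zero]
    exact Finset.sum_congr rfl fun k _ => by ring

lemma binTailSum_eq_sum {n T : ℕ} (hn : 3 ≤ n) (p : ℝ) :
    binTailSum p (n - 2) T =
      p * ∑ i ∈ Finset.Icc 1 (T + 2 - n), binomProb (T - i - 1) (n - 3) p * (i : ℝ) := by
  obtain ⟨j, rfl⟩ : ∃ j, n = j + 3 := ⟨n - 3, by omega⟩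
  rw [show j + 3 - 2 = j + 1 by omega, Nat.add_sub_cancel]
  simp only [binTailSum, binTail]
  rw [← Finset.mul_sum, sum_range_sum_range]
  congr 1
  symm
  refine (Finset.sum_subset ?_ ?_).trans (Finset.sum_congr rfl fun i _ => ?_)
  · intro i hi
    simp only [Finset.mem_range, Finset.mem_Icc] at hi ⊢
    omega
  · intro i hi hi'
    simp only [Finset.mem_range, Finset.mem_Icc] at hi hi'
    rcases Nat.eq_zero_or_pos i with rfl | hi0
    · simp
    · rw [binomProb_eq_zero (by omega), zero_mul]
  · rw [Nat.sub_right_comm]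

/-! ### Hoeffding's inequality for binomial probabilities -/

/-- Hoeffding's lemma for the law $(1-p)\delta_0+p\,\delta_1$ on $[0,1]$, with the centring moved to
the right side. -/
lemma hoeffding_bernoulli {p : ℝ} (hp0 : 0 ≤ p) (hp1 : p ≤ 1) (l : ℝ) :
    1 - p + p * Real.exp l ≤ Real.exp (l * p + l ^ 2 / 8) := by
  set P : Measure ℝ := ENNReal.ofReal (1 - p) • Measure.dirac 0 + ENNReal.ofReal p • Measure.dirac 1
    with hP
  have hP1 : IsProbabilityMeasure P := ⟨by
    simp only [hP, Measure.add_apply, Measure.smul_apply, measure_univ, smul_eq_mul, mul_one]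
    rw [← ENNReal.ofReal_add (by linarith) hp0]
    simp⟩
  have hint : ∀ g : ℝ → ℝ, ∫ x, g x ∂P = (1 - p) * g 0 + p * g 1 := by
    intro g
    rw [hP, integral_add_measure, integral_smul_measure, integral_smul_measure, integral_dirac,
      integral_dirac, ENNReal.toReal_ofReal (by linarith), ENNReal.toReal_ofReal hp0]
    · rfl
    · exact (integrable_dirac (by simp)).smul_measure ENNReal.ofReal_ne_top
    · exact (integrable_dirac (by simp)).smul_measure ENNReal.ofReal_ne_top
  have hmem : ∀ᵐ x ∂P, id x ∈ Set.Icc (0 : ℝ) 1 := by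
    rw [hP, ae_add_measure_iff]
    constructor
    · exact Measure.ae_smul_measure (by rw [ae_dirac_eq]; simp) _
    · exact Measure.ae_smul_measure (by rw [ae_dirac_eq]; simp) _
  have h := (hasSubgaussianMGF_of_mem_Icc (μ := P) aemeasurable_id hmem).mgf_le l
  rw [mgf, hint, hint] at h
  have e1 : ((‖(1 : ℝ) - 0‖₊ / 2) ^ 2 : NNReal) * l ^ 2 / 2 = l ^ 2 / 8 := by
    push_cast
    simp
    ring
  rw [e1] at h
  simp only [id_eq, mul_zero, mul_one, zero_add, zero_sub, mul_neg] at h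
  have h2 := mul_le_mul_of_nonneg_right h (Real.exp_pos (l * p)).le
  rw [add_mul, mul_assoc, mul_assoc, ← Real.exp_add, ← Real.exp_add, ← Real.exp_add] at h2
  rw [show -(l * p) + l * p = 0 by ring, show l * (1 - p) + l * p = l by ring, Real.exp_zero,
    mul_one, add_comm (l ^ 2 / 8)] at h2
  exact h2

/-- Chernoff's argument: $\mathcal B(m,k,p)e^{lk}$ is a single term in the binomial expansion of
$(1-p+pe^l)^m$. No sign of $k/m-p$ is needed. -/
lemma binomProb_le_exp {p : ℝ} (hp0 : 0 ≤ p) (hp1 : p ≤ 1) {m k : ℕ} (hk : k ≤ m) (hm : 0 < m) :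
    binomProb m k p ≤ Real.exp (-2 * m * ((k : ℝ) / m - p) ^ 2) := by
  have hm' : (0 : ℝ) < m := Nat.cast_pos.2 hm
  set d : ℝ := (k : ℝ) / m - p with hd
  -- This value of `l` minimizes the exponent $m(l^2/8-ld)$, with minimum $-2md^2$.
  set l : ℝ := 4 * d with hl
  have h1 : binomProb m k p * Real.exp (l * k) ≤ (1 - p + p * Real.exp l) ^ m := by
    rw [add_comm, add_pow]
    refine le_trans (le_of_eq ?_) (Finset.single_le_sum (f := fun j =>
      (p * Real.exp l) ^ j * (1 - p) ^ (m - j) * (m.choose j : ℝ)) (fun j _ => ?_)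
      (Finset.mem_range.2 (Nat.lt_succ_of_le hk)))
    · rw [binomProb, mul_pow, ← Real.exp_nat_mul, mul_comm l]
      ring
    · exact mul_nonneg (mul_nonneg (pow_nonneg (mul_nonneg hp0 (Real.exp_pos _).le) _)
        (pow_nonneg (by linarith) _)) (Nat.cast_nonneg _)
  have h2 : (1 - p + p * Real.exp l) ^ m ≤ Real.exp (m * (l * p + l ^ 2 / 8)) := by
    rw [Real.exp_nat_mul]
    exact pow_le_pow_left₀ (add_nonneg (by linarith) (mul_nonneg hp0 (Real.exp_pos _).le))
      (hoeffding_bernoulli hp0 hp1 l) m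
  have h3 := h1.trans h2
  rw [← le_div_iff₀ (Real.exp_pos _), ← Real.exp_sub] at h3
  refine h3.trans (le_of_eq ?_)
  congr 1
  have hk' : (k : ℝ) = m * (d + p) := by rw [hd]; field_simp; ring
  rw [hk', hl]
  ring

/-- With $k=n-3\ge1$, the number of terms and each factor `i` are at most $T-2\le k\gamma/p$. This
gives the prefactor; each binomial probability is at most `E`. -/
lemma binTailSum_le_exp {n T : ℕ} {p γ : ℝ} (hp0 : 0 < p) (hp1 : p ≤ 1) (hn : 4 ≤ n)
    (hT : n ≤ T + 1) (hγ0 : 0 < γ) (hγ1 : γ < 1) (h : (T : ℝ) ≤ 2 + ((n : ℝ) - 3) * γ / p) :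
    binTailSum p (n - 2) T ≤ ((n : ℝ) - 3) ^ 2 * γ ^ 2 / p *
      Real.exp (-2 * (p / γ - p) ^ 2 * ((n : ℝ) - 3)) := by
  rw [binTailSum_eq_sum (by omega)]
  obtain ⟨k, rfl⟩ : ∃ k, n = k + 3 := ⟨n - 3, by omega⟩
  have hk : (((k + 3 : ℕ) : ℝ) - 3) = k := by push_cast; ring
  rw [hk] at h ⊢
  have hk0 : (0 : ℝ) < k := Nat.cast_pos.2 (by omega)
  set E := Real.exp (-2 * (p / γ - p) ^ 2 * (k : ℝ)) with hE
  have hd0 : 0 ≤ p / γ - p := by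
    rw [sub_nonneg, le_div_iff₀ hγ0]
    nlinarith
  have hT2 : ((T - 2 : ℕ) : ℝ) ≤ k * γ / p := by
    rw [Nat.cast_sub (by omega)]
    push_cast
    linarith
  have hterm : ∀ i ∈ Finset.Icc 1 (T + 2 - (k + 3)),
      binomProb (T - i - 1) (k + 3 - 3) p * (i : ℝ) ≤ E * ((T - 2 : ℕ) : ℝ) := by
    intro i hi
    rw [Finset.mem_Icc] at hi
    rw [Nat.add_sub_cancel]
    refine mul_le_mul ?_ (Nat.cast_le.2 (by omega)) (Nat.cast_nonneg _) (Real.exp_pos _).le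
    have hkm : k ≤ T - i - 1 := by omega
    refine (binomProb_le_exp hp0.le hp1 hkm (by omega)).trans (Real.exp_le_exp.2 ?_)
    have hm0 : (0 : ℝ) < ((T - i - 1 : ℕ) : ℝ) := Nat.cast_pos.2 (by omega)
    have hmT : ((T - i - 1 : ℕ) : ℝ) ≤ k * γ / p :=
      le_trans (Nat.cast_le.2 (by omega)) hT2
    have hkm' : (k : ℝ) ≤ ((T - i - 1 : ℕ) : ℝ) := Nat.cast_le.2 hkm
    set m := ((T - i - 1 : ℕ) : ℝ)
    -- The number `m` of trials satisfies $k\le m\le k\gamma/p$. The upper bound makes the deviation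
    -- at least $p/\gamma-p$, and the lower one replaces `m` by `k` in the exponent.
    have h1 : p / γ - p ≤ k / m - p := by
      refine sub_le_sub_right ?_ p
      rw [div_le_div_iff₀ hγ0 hm0]
      rw [le_div_iff₀ hp0] at hmT
      linarith
    have h2 : (p / γ - p) ^ 2 ≤ (k / m - p) ^ 2 := pow_le_pow_left₀ hd0 h1 2
    have h3 : k * (p / γ - p) ^ 2 ≤ m * (k / m - p) ^ 2 :=
      mul_le_mul hkm' h2 (sq_nonneg _) hm0.le
    linarith
  calc p * ∑ i ∈ Finset.Icc 1 (T + 2 - (k + 3)), binomProb (T - i - 1) (k + 3 - 3) p * (i : ℝ)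
      ≤ p * ∑ _i ∈ Finset.Icc 1 (T + 2 - (k + 3)), E * ((T - 2 : ℕ) : ℝ) :=
        mul_le_mul_of_nonneg_left (Finset.sum_le_sum hterm) hp0.le
    _ = p * (((T + 2 - (k + 3) : ℕ) : ℝ) * (E * ((T - 2 : ℕ) : ℝ))) := by
        rw [Finset.sum_const, Nat.card_Icc, Nat.add_sub_cancel, nsmul_eq_mul]
    _ ≤ p * ((k * γ / p) * (E * (k * γ / p))) := by
        have h1 : ((T + 2 - (k + 3) : ℕ) : ℝ) ≤ k * γ / p :=
          le_trans (Nat.cast_le.2 (by omega)) hT2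
        have h2 : 0 ≤ k * γ / p := by positivity
        refine mul_le_mul_of_nonneg_left (mul_le_mul h1 ?_ ?_ h2) hp0.le
        · exact mul_le_mul_of_nonneg_left hT2 (Real.exp_pos _).le
        · exact mul_nonneg (Real.exp_pos _).le (Nat.cast_nonneg _)
    _ = (k : ℝ) ^ 2 * γ ^ 2 / p * E := by
        field_simp

/-! ### The law of the received symbols given the observations -/

-- Summing a product law over the coordinates outside the range of `ε` leaves the product over that
-- range: the constraint defines a box, and each free coordinate sums to one.
open Classical in
lemma sum_prod_marginal {E ι : Type*} [Fintype E] [DecidableEq E] [Fintype ι] {V : E → Type*}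
    [∀ e, Fintype (V e)] {g : ∀ e, V e → ℝ} (h1 : ∀ e, ∑ v, g e v = 1) {ε : ι → E}
    (hε : Function.Injective ε) (u : ∀ j, V (ε j)) :
    ∑ v ∈ Finset.univ.filter (fun v : ∀ e, V e => (fun j : ι => v (ε j)) = u), ∏ e, g e (v e) =
      ∏ j, g (ε j) (u j) := by
  set S : ∀ e, Finset (V e) := fun e => Finset.univ.filter fun x => ∀ j, ∀ h : ε j = e, h ▸ u j = x
    with hS
  have h2 : (Finset.univ.filter fun v : ∀ e, V e => (fun j : ι => v (ε j)) = u) =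
      Fintype.piFinset S := by
    ext v
    simp only [Finset.mem_filter, Finset.mem_univ, true_and, Fintype.mem_piFinset, hS]
    constructor
    · rintro rfl e j rfl
      rfl
    · intro h
      funext j
      exact (h (ε j) j rfl).symm
  rw [h2, ← Finset.prod_univ_sum]
  symm
  refine Fintype.prod_of_injective ε hε _ _ ?_ ?_
  · intro e he
    have : S e = Finset.univ := by
      rw [hS, Finset.filter_eq_self]
      exact fun x _ j h => absurd ⟨j, h⟩ he
    rw [this, h1]
  · intro j
    have : S (ε j) = {u j} := by
      ext x
      simp only [hS, Finset.mem_filter, Finset.mem_univ, true_and, Finset.mem_singleton]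
      constructor
      · exact fun h => (h j rfl).symm
      · rintro rfl j' h
        obtain rfl := hε h
        rfl
    rw [this, Finset.sum_singleton]

namespace ChainAlgorithm

variable {n T : ℕ} {W : Fin n → Type*} {X Y : ChainEdge n → Type*}
  {U : Fin n → Fin T → Type*} {Z : Type*}
  [∀ i, MeasurableSpace (W i)] [∀ e, MeasurableSpace (X e)] [∀ e, MeasurableSpace (Y e)]
  [∀ i t, MeasurableSpace (U i t)] [MeasurableSpace Z]

/-- The private message of node `i` at time `t`, as a function of the observation, the private
randomness and the symbols received before. -/
def privMsg (alg : ChainAlgorithm T W X Y U Z) (i : Fin n) (w : W i) (r : Fin T → unitInterval) :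
    ∀ t : Fin T, (Set.Iio t → InMsg Y i) → U i t
  | t, past => alg.encPriv i t (w, past,
      fun s => privMsg alg i w r s.1 fun u =>
        past ⟨u.1, (Set.mem_Iio.1 u.2).trans (Set.mem_Iio.1 s.2)⟩, r t)
termination_by t => t
decreasing_by exact s.2

/-- The symbol sent along the edge `e` at time `t`, as a function of the observation, the private
randomness and the symbols received before at the source of `e`. -/
def input (alg : ChainAlgorithm T W X Y U Z) (e : ChainEdge n) (t : Fin T) (w : W e.src)
    (r : Fin T → unitInterval) (past : Set.Iio t → InMsg Y e.src) : X e :=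
  if h : e.dst < e.src then alg.encLeft e h t (w, past)
  else if h' : e.src < e.dst then alg.encRight e h' t (w, past,
    fun s => alg.privMsg e.src w r s.1 fun u =>
        past ⟨u.1, (Set.mem_Iio.1 u.2).trans (Set.mem_Iio.1 s.2)⟩)
  else alg.encSelf e (le_antisymm (not_lt.1 h) (not_lt.1 h')) t (w, past,
    fun s => alg.privMsg e.src w r s.1 fun u =>
        past ⟨u.1, (Set.mem_Iio.1 u.2).trans (Set.mem_Iio.1 s.2)⟩)

/-- The restriction of the class that makes the cut argument work: messages to the left do not
reveal private randomness. -/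
lemma input_eq_of_left (alg : ChainAlgorithm T W X Y U Z) {e : ChainEdge n} (h : e.dst < e.src)
    (t : Fin T) (w : W e.src) (r r' : Fin T → unitInterval) (past : Set.Iio t → InMsg Y e.src) :
    alg.input e t w r past = alg.input e t w r' past := by
  simp only [input, dif_pos h]

lemma measurable_privMsg (alg : ChainAlgorithm T W X Y U Z) (i : Fin n) (t : Fin T)
    (past : Set.Iio t → InMsg Y i) :
    Measurable fun p : W i × (Fin T → unitInterval) => alg.privMsg i p.1 p.2 t past := by
  induction t using WellFoundedLT.induction with
  | ind t ih =>
    have h : (fun p : W i × (Fin T → unitInterval) => alg.privMsg i p.1 p.2 t past) = fun p =>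
        alg.encPriv i t (p.1, past, fun s => alg.privMsg i p.1 p.2 s.1
          fun u =>
        past ⟨u.1, (Set.mem_Iio.1 u.2).trans (Set.mem_Iio.1 s.2)⟩, p.2 t) :=
      funext fun p => by rw [privMsg]
    rw [h]
    refine (alg.measurable_encPriv i t).comp (measurable_fst.prodMk (measurable_const.prodMk
      (Measurable.prodMk ?_ (measurable_snd.eval (a := t)))))
    exact measurable_pi_lambda _ fun s => ih s.1 s.2 _

lemma measurable_input (alg : ChainAlgorithm T W X Y U Z) (e : ChainEdge n) (t : Fin T)
    (past : Set.Iio t → InMsg Y e.src) :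
    Measurable fun p : W e.src × (Fin T → unitInterval) => alg.input e t p.1 p.2 past := by
  have hU : Measurable fun p : W e.src × (Fin T → unitInterval) => (fun s : Set.Iio t =>
      alg.privMsg e.src p.1 p.2 s.1 fun u =>
        past ⟨u.1, (Set.mem_Iio.1 u.2).trans (Set.mem_Iio.1 s.2)⟩) :=
    measurable_pi_lambda _ fun s => alg.measurable_privMsg e.src s.1 _
  unfold input
  split_ifs with h h'
  · exact (alg.measurable_encLeft e h t).comp (measurable_fst.prodMk measurable_const)
  · exact (alg.measurable_encRight e h' t).comp
      (measurable_fst.prodMk (measurable_const.prodMk hU))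
  · exact (alg.measurable_encSelf e _ t).comp
      (measurable_fst.prodMk (measurable_const.prodMk hU))

/-- What node `i` received before time `s`, given everything received before time `t`. -/
def pathPast {i : Fin n} {t : ℕ} (y : Fin t → ∀ e, Y e) (s : Fin T) (h : (s : ℕ) ≤ t) :
    Set.Iio s → InMsg Y i := fun u j => y ⟨u.1, lt_of_lt_of_le (Fin.lt_def.1 u.2) h⟩ (inEdge j)

/-- The symbol sent along `e` at time `t` if `y` was received before. -/
def lastInput (alg : ChainAlgorithm T W X Y U Z) (e : ChainEdge n) {t : ℕ} (ht : t < T)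
    (w : ∀ i, W i) (r : Fin T → unitInterval) (y : Fin t → ∀ e, Y e) : X e :=
  alg.input e ⟨t, ht⟩ (w e.src) r (pathPast y ⟨t, ht⟩ le_rfl)

/-- The probability that the edge `e` delivers the symbols `y` before time `t`. -/
noncomputable def edgeWt (alg : ChainAlgorithm T W X Y U Z) (K : ∀ e, Kernel (X e) (Y e))
    (e : ChainEdge n) {t : ℕ} (ht : t ≤ T) (w : ∀ i, W i) (r : Fin T → unitInterval)
    (y : Fin t → ∀ e, Y e) : ℝ :=
  ∏ s : Fin t, kernelMatrix (K e)
    (alg.input e (Fin.castLE ht s) (w e.src) r (pathPast y (Fin.castLE ht s) s.2.le)) (y s e)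

/-- The conditional probability of the symbols `y` before time `t`. -/
noncomputable def pathWt (alg : ChainAlgorithm T W X Y U Z) (K : ∀ e, Kernel (X e) (Y e))
    {t : ℕ} (ht : t ≤ T) (w : ∀ i, W i) (r : Fin n → Fin T → unitInterval)
    (y : Fin t → ∀ e, Y e) : ℝ :=
  ∏ e, alg.edgeWt K e ht w (r e.src) y

/-- The conditional probability of the symbols `y` before time `t` and of the outputs `v` if the
symbols sent at time `t` pass through the channels with transition matrices `k`. -/
noncomputable def stepWt (alg : ChainAlgorithm T W X Y U Z) (K : ∀ e, Kernel (X e) (Y e))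
    {V : ChainEdge n → Type*} (k : ∀ e, X e → V e → ℝ)
    {t : ℕ} (ht : t < T) (w : ∀ i, W i) (r : Fin n → Fin T → unitInterval)
    (o : (Fin t → ∀ e, Y e) × (∀ e, V e)) : ℝ :=
  ∏ e, alg.edgeWt K e ht.le w (r e.src) o.1 * k e (alg.lastInput e ht w (r e.src) o.1) (o.2 e)

/-- The law of the private randomness. -/
noncomputable abbrev randLaw (n T : ℕ) : Measure (Fin n → Fin T → unitInterval) :=
  Measure.pi fun _ => Measure.pi fun _ => volume

/-- The conditional probability, given the observations, of the symbols `y` before time `t`. -/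
noncomputable def pathLaw (alg : ChainAlgorithm T W X Y U Z) (K : ∀ e, Kernel (X e) (Y e))
    {t : ℕ} (ht : t ≤ T) (w : ∀ i, W i) (y : Fin t → ∀ e, Y e) : ℝ :=
  ∫ r, alg.pathWt K ht w r y ∂randLaw n T

/-- The conditional probability, given the observations, of the symbols `y` before time `t` and of
the outputs `v` of the channels `k` at time `t`. -/
noncomputable def stepLaw (alg : ChainAlgorithm T W X Y U Z) (K : ∀ e, Kernel (X e) (Y e))
    {V : ChainEdge n → Type*} (k : ∀ e, X e → V e → ℝ)
    {t : ℕ} (ht : t < T) (w : ∀ i, W i) (o : (Fin t → ∀ e, Y e) × (∀ e, V e)) : ℝ :=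
  ∫ r, alg.stepWt K k ht w r o ∂randLaw n T

lemma pathPast_snoc {i : Fin n} {t : ℕ} (y : Fin t → ∀ e, Y e) (v : ∀ e, Y e) (s : Fin T)
    (h : (s : ℕ) ≤ t) (h' : (s : ℕ) ≤ t + 1) :
    pathPast (i := i) (Fin.snoc (α := fun _ => ∀ e, Y e) y v : Fin (t + 1) → ∀ e, Y e) s h' =
      pathPast y s h := by
  funext u j
  have hu : (u.1 : ℕ) < t := lt_of_lt_of_le (Fin.lt_def.1 u.2) h
  simp [pathPast, Fin.snoc, hu]

lemma pathWt_snoc (alg : ChainAlgorithm T W X Y U Z) (K : ∀ e, Kernel (X e) (Y e))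
    {t : ℕ} (ht : t < T) (w : ∀ i, W i) (r : Fin n → Fin T → unitInterval)
    (y : Fin t → ∀ e, Y e) (v : ∀ e, Y e) :
    alg.pathWt K (t := t + 1) ht w r (Fin.snoc (α := fun _ => ∀ e, Y e) y v) =
      alg.stepWt K (fun e => kernelMatrix (K e)) ht w r (y, v) := by
  refine Finset.prod_congr rfl fun e _ => ?_
  rw [edgeWt, Fin.prod_univ_castSucc]
  congr 1
  · refine Finset.prod_congr rfl fun s _ => ?_
    rw [Fin.snoc_castSucc]
    congr 2
    exact pathPast_snoc y v (Fin.castLE ht.le s) s.2.le _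
  · rw [Fin.snoc_last]
    congr 2
    exact pathPast_snoc y v ⟨t, ht⟩ le_rfl _

lemma pathLaw_snoc (alg : ChainAlgorithm T W X Y U Z) (K : ∀ e, Kernel (X e) (Y e))
    {t : ℕ} (ht : t < T) (w : ∀ i, W i) (y : Fin t → ∀ e, Y e) (v : ∀ e, Y e) :
    alg.pathLaw K (t := t + 1) ht w (Fin.snoc (α := fun _ => ∀ e, Y e) y v) =
      alg.stepLaw K (fun e => kernelMatrix (K e)) ht w (y, v) := by
  simp only [pathLaw, stepLaw, pathWt_snoc]

end ChainAlgorithm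

namespace ChainAlgorithm

variable {n T : ℕ} {W : Fin n → Type*} {X Y : ChainEdge n → Type*}
  {U : Fin n → Fin T → Type*} {Z : Type*}
  [∀ i, MeasurableSpace (W i)] [∀ e, MeasurableSpace (X e)] [∀ e, MeasurableSpace (Y e)]
  [∀ i t, MeasurableSpace (U i t)] [MeasurableSpace Z]

/-! ### Normalization and measurability -/

lemma stepWt_eq (alg : ChainAlgorithm T W X Y U Z) (K : ∀ e, Kernel (X e) (Y e))
    {V : ChainEdge n → Type*} (k : ∀ e, X e → V e → ℝ)
    {t : ℕ} (ht : t < T) (w : ∀ i, W i) (r : Fin n → Fin T → unitInterval)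
    (y : Fin t → ∀ e, Y e) (v : ∀ e, V e) :
    alg.stepWt K k ht w r (y, v) =
      alg.pathWt K ht.le w r y * ∏ e, k e (alg.lastInput e ht w (r e.src) y) (v e) :=
  Finset.prod_mul_distrib

lemma pathWt_nonneg (alg : ChainAlgorithm T W X Y U Z) (K : ∀ e, Kernel (X e) (Y e))
    {t : ℕ} (ht : t ≤ T) (w : ∀ i, W i) (r : Fin n → Fin T → unitInterval)
    (y : Fin t → ∀ e, Y e) : 0 ≤ alg.pathWt K ht w r y :=
  Finset.prod_nonneg fun _ _ => Finset.prod_nonneg fun _ _ => kernelMatrix_nonneg _ _ _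

lemma sum_stepWt (alg : ChainAlgorithm T W X Y U Z) (K : ∀ e, Kernel (X e) (Y e))
    {V : ChainEdge n → Type*} [∀ e, Fintype (V e)] {k : ∀ e, X e → V e → ℝ}
    (hk1 : ∀ e x, ∑ v, k e x v = 1)
    {t : ℕ} (ht : t < T) (w : ∀ i, W i) (r : Fin n → Fin T → unitInterval)
    (y : Fin t → ∀ e, Y e) : ∑ v, alg.stepWt K k ht w r (y, v) = alg.pathWt K ht.le w r y := by
  simp only [stepWt_eq]
  rw [← Finset.mul_sum, ← Fintype.prod_sum]
  simp [hk1]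

lemma sum_pathWt [∀ e, Fintype (Y e)] [∀ e, MeasurableSingletonClass (Y e)]
    (alg : ChainAlgorithm T W X Y U Z) (K : ∀ e, Kernel (X e) (Y e))
    [∀ e, IsMarkovKernel (K e)] {t : ℕ} (ht : t ≤ T) (w : ∀ i, W i)
    (r : Fin n → Fin T → unitInterval) : ∑ y, alg.pathWt K ht w r y = 1 := by
  induction t with
  | zero => simp [pathWt, edgeWt]
  | succ t ih =>
    rw [← (Fin.snocEquiv fun _ : Fin (t + 1) => ∀ e, Y e).sum_comp, Fintype.sum_prod_type,
      Finset.sum_comm]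
    rw [← ih (Nat.le_of_succ_le ht)]
    refine Finset.sum_congr rfl fun y _ => ?_
    rw [← alg.sum_stepWt K (k := fun e => kernelMatrix (K e))
      (fun e x => sum_kernelMatrix (K e) x) ht w r y]
    exact Finset.sum_congr rfl fun v _ => alg.pathWt_snoc K ht w r y v

section Measurability

variable [∀ e, DiscreteMeasurableSpace (X e)]

lemma measurable_edgeWt (alg : ChainAlgorithm T W X Y U Z) (K : ∀ e, Kernel (X e) (Y e))
    (e : ChainEdge n) {t : ℕ} (ht : t ≤ T) (y : Fin t → ∀ e, Y e) :
    Measurable fun p : (∀ i, W i) × (Fin T → unitInterval) => alg.edgeWt K e ht p.1 p.2 y := by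
  refine Finset.measurable_prod _ fun s _ => ?_
  exact (Measurable.of_discrete (f := fun x => kernelMatrix (K e) x (y s e))).comp
    ((alg.measurable_input e (Fin.castLE ht s) (pathPast y _ s.2.le)).comp
      ((measurable_fst.eval (a := e.src)).prodMk measurable_snd))

lemma measurable_lastInput (alg : ChainAlgorithm T W X Y U Z)
    (e : ChainEdge n) {t : ℕ} (ht : t < T) (y : Fin t → ∀ e, Y e) :
    Measurable fun p : (∀ i, W i) × (Fin T → unitInterval) => alg.lastInput e ht p.1 p.2 y :=
  (alg.measurable_input e ⟨t, ht⟩ (pathPast y _ le_rfl)).comp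
    ((measurable_fst.eval (a := e.src)).prodMk measurable_snd)

lemma measurable_pathWt (alg : ChainAlgorithm T W X Y U Z) (K : ∀ e, Kernel (X e) (Y e))
    {t : ℕ} (ht : t ≤ T) (y : Fin t → ∀ e, Y e) :
    Measurable fun p : (∀ i, W i) × (Fin n → Fin T → unitInterval) =>
      alg.pathWt K ht p.1 p.2 y := by
  have h : ∀ e : ChainEdge n, Measurable fun p : (∀ i, W i) × (Fin n → Fin T → unitInterval) =>
      alg.edgeWt K e ht p.1 (p.2 e.src) y := fun e =>
    (alg.measurable_edgeWt K e ht y).comp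
      (g := fun p : (∀ i, W i) × (Fin T → unitInterval) => alg.edgeWt K e ht p.1 p.2 y)
      (f := fun p : (∀ i, W i) × (Fin n → Fin T → unitInterval) => (p.1, p.2 e.src))
      (measurable_fst.prodMk (measurable_snd.eval (a := e.src)))
  simp only [pathWt]
  exact Finset.measurable_prod _ fun e _ => h e

lemma measurable_stepWt (alg : ChainAlgorithm T W X Y U Z) (K : ∀ e, Kernel (X e) (Y e))
    {V : ChainEdge n → Type*} (k : ∀ e, X e → V e → ℝ)
    {t : ℕ} (ht : t < T) (o : (Fin t → ∀ e, Y e) × (∀ e, V e)) :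
    Measurable fun p : (∀ i, W i) × (Fin n → Fin T → unitInterval) =>
      alg.stepWt K k ht p.1 p.2 o := by
  refine Finset.measurable_prod _ fun e _ => ?_
  have hm : Measurable fun p : (∀ i, W i) × (Fin n → Fin T → unitInterval) => (p.1, p.2 e.src) :=
    measurable_fst.prodMk (measurable_snd.eval (a := e.src))
  exact ((alg.measurable_edgeWt K e ht.le o.1).comp hm).mul
    ((Measurable.of_discrete (f := fun x => k e x (o.2 e))).comp
      ((alg.measurable_lastInput e ht o.1).comp hm))

variable [∀ e, Fintype (Y e)] [∀ e, MeasurableSingletonClass (Y e)]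
  {α : Type*} [MeasurableSpace α]

lemma isFinKernel_pathWt (alg : ChainAlgorithm T W X Y U Z) (K : ∀ e, Kernel (X e) (Y e))
    [∀ e, IsMarkovKernel (K e)] {t : ℕ} (ht : t ≤ T) {w : α → ∀ i, W i} (hw : Measurable w) :
    IsFinKernel fun p : α × (Fin n → Fin T → unitInterval) => alg.pathWt K ht (w p.1) p.2 where
  nonneg _ _ := alg.pathWt_nonneg K ht _ _ _
  sum_eq_one _ := alg.sum_pathWt K ht _ _
  measurable y := (alg.measurable_pathWt K ht y).comp
    (g := fun p : (∀ i, W i) × (Fin n → Fin T → unitInterval) => alg.pathWt K ht p.1 p.2 y)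
    (f := fun p : α × (Fin n → Fin T → unitInterval) => (w p.1, p.2))
    ((hw.comp measurable_fst).prodMk measurable_snd)

lemma isFinKernel_stepWt (alg : ChainAlgorithm T W X Y U Z) (K : ∀ e, Kernel (X e) (Y e))
    [∀ e, IsMarkovKernel (K e)] {V : ChainEdge n → Type*} [∀ e, Fintype (V e)]
    {k : ∀ e, X e → V e → ℝ} (hk0 : ∀ e x v, 0 ≤ k e x v) (hk1 : ∀ e x, ∑ v, k e x v = 1)
    {t : ℕ} (ht : t < T) {w : α → ∀ i, W i} (hw : Measurable w) :
    IsFinKernel fun p : α × (Fin n → Fin T → unitInterval) =>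
      alg.stepWt K k ht (w p.1) p.2 where
  nonneg _ _ := by
    rw [stepWt_eq]
    exact mul_nonneg (alg.pathWt_nonneg K _ _ _ _) (Finset.prod_nonneg fun _ _ => hk0 _ _ _)
  sum_eq_one _ := by
    rw [Fintype.sum_prod_type]
    simp only [alg.sum_stepWt K hk1]
    exact alg.sum_pathWt K ht.le _ _
  measurable o := (alg.measurable_stepWt K k ht o).comp
    (g := fun p : (∀ i, W i) × (Fin n → Fin T → unitInterval) => alg.stepWt K k ht p.1 p.2 o)
    (f := fun p : α × (Fin n → Fin T → unitInterval) => (w p.1, p.2))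
    ((hw.comp measurable_fst).prodMk measurable_snd)

lemma isFinKernel_pathLaw (alg : ChainAlgorithm T W X Y U Z) (K : ∀ e, Kernel (X e) (Y e))
    [∀ e, IsMarkovKernel (K e)] {t : ℕ} (ht : t ≤ T) {w : α → ∀ i, W i} (hw : Measurable w) :
    IsFinKernel fun a => alg.pathLaw K ht (w a) :=
  (alg.isFinKernel_pathWt K ht hw).average (Kernel.const α (randLaw n T))

lemma isFinKernel_stepLaw (alg : ChainAlgorithm T W X Y U Z) (K : ∀ e, Kernel (X e) (Y e))
    [∀ e, IsMarkovKernel (K e)] {V : ChainEdge n → Type*} [∀ e, Fintype (V e)]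
    {k : ∀ e, X e → V e → ℝ} (hk0 : ∀ e x v, 0 ≤ k e x v) (hk1 : ∀ e x, ∑ v, k e x v = 1)
    {t : ℕ} (ht : t < T) {w : α → ∀ i, W i} (hw : Measurable w) :
    IsFinKernel fun a => alg.stepLaw K k ht (w a) :=
  (alg.isFinKernel_stepWt K hk0 hk1 ht hw).average (Kernel.const α (randLaw n T))

/-! ### Marginals -/

lemma finPush_pathLaw (alg : ChainAlgorithm T W X Y U Z) (K : ∀ e, Kernel (X e) (Y e))
    [∀ e, IsMarkovKernel (K e)] {t : ℕ} (ht : t ≤ T) {w : α → ∀ i, W i} (hw : Measurable w)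
    {ζ : Type*} (f : (Fin t → ∀ e, Y e) → ζ) (a : α) (z : ζ) :
    finPush f (fun a => alg.pathLaw K ht (w a)) a z =
      ∫ r, finPush f (fun r => alg.pathWt K ht (w a) r) r z ∂randLaw n T := by
  simp only [finPush, pathLaw]
  rw [integral_finsetSum]
  exact fun y _ => ((alg.isFinKernel_pathWt K ht hw).prodMk a).integrable _ y

/-- Edges outside the range of `ε` are summed out, while the private randomness, which couples the
edges leaving a node, stays under one integral. -/
lemma finPush_stepLaw (alg : ChainAlgorithm T W X Y U Z) (K : ∀ e, Kernel (X e) (Y e))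
    [∀ e, IsMarkovKernel (K e)] {V : ChainEdge n → Type*} [∀ e, Fintype (V e)]
    {k : ∀ e, X e → V e → ℝ} (hk0 : ∀ e x v, 0 ≤ k e x v) (hk1 : ∀ e x, ∑ v, k e x v = 1)
    {t : ℕ} (ht : t < T) {w : α → ∀ i, W i} (hw : Measurable w)
    {ζ ι : Type*} [Fintype ι] (f : (Fin t → ∀ e, Y e) → ζ) {ε : ι → ChainEdge n}
    (hε : Function.Injective ε) (a : α) (z : ζ) (u : ∀ j, V (ε j)) :
    finPush (fun o => (f o.1, fun j => o.2 (ε j))) (fun a => alg.stepLaw K k ht (w a)) a (z, u) =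
      ∫ r, finPush f (fun r y => alg.pathWt K ht.le (w a) r y *
        ∏ j, k (ε j) (alg.lastInput (ε j) ht (w a) (r (ε j).src) y) (u j)) r z ∂randLaw n T := by
  classical
  simp only [finPush, stepLaw]
  rw [← integral_finsetSum]
  · refine integral_congr_ae (ae_of_all _ fun r => ?_)
    dsimp only
    have h1 : (Finset.univ.filter fun o : (Fin t → ∀ e, Y e) × (∀ e, V e) =>
        (f o.1, fun j => o.2 (ε j)) = (z, u)) =
        (Finset.univ.filter fun y => f y = z) ×ˢ
          (Finset.univ.filter fun v : ∀ e, V e => (fun j : ι => v (ε j)) = u) := by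
      ext o
      simp [Prod.ext_iff]
    rw [show (∑ o with (f o.1, fun j => o.2 (ε j)) = (z, u), alg.stepWt K k ht (w a) r o) =
      ∑ o ∈ (Finset.univ.filter fun y => f y = z) ×ˢ
          (Finset.univ.filter fun v : ∀ e, V e => (fun j : ι => v (ε j)) = u),
        alg.stepWt K k ht (w a) r o from Finset.sum_congr (by convert h1) fun _ _ => rfl,
      Finset.sum_product]
    refine Finset.sum_congr (by congr) fun y _ => ?_
    simp only [stepWt_eq]
    rw [← Finset.mul_sum]
    congr 1
    rw [← sum_prod_marginal (g := fun e => k e (alg.lastInput e ht (w a) (r e.src) y))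
      (fun e => hk1 e _) hε u]
  · exact fun o _ => ((alg.isFinKernel_stepWt K hk0 hk1 ht hw).prodMk a).integrable _ o

end Measurability

end ChainAlgorithm

/-! ### Edges join nodes at distance at most one. -/

lemma ChainEdge.dst_le {n : ℕ} (e : ChainEdge n) : (e.dst : ℕ) ≤ e.src + 1 := by
  rcases e.2 with h | h | h
  · exact h.le
  · change (e.1.2 : ℕ) ≤ e.1.1 + 1
    omega
  · change (e.1.2 : ℕ) ≤ e.1.1 + 1
    rw [h]; omega

lemma ChainEdge.src_le {n : ℕ} (e : ChainEdge n) : (e.src : ℕ) ≤ e.dst + 1 := by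
  rcases e.2 with h | h | h
  · change (e.1.1 : ℕ) ≤ e.1.2 + 1
    omega
  · exact h.le
  · change (e.1.1 : ℕ) ≤ e.1.2 + 1
    rw [h]; omega

namespace ChainAlgorithm

section Cut

variable {n : ℕ} {Y : ChainEdge n → Type*}

/-! ### Cutting the chain at a node -/

/-- The symbols to the left of the cut at node `j` from `o`, those to the right of it from `o'`. -/
def mix {V : ChainEdge n → Type*} {t : ℕ} (j : Fin n)
    (o o' : (Fin t → ∀ e, Y e) × (∀ e, V e)) : (Fin t → ∀ e, Y e) × (∀ e, V e) :=
  (fun s e => if e.dst < j then o.1 s e else o'.1 s e,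
    -- At the current step the outputs at node `j` need not agree, so the edge into `j` from its
    -- left neighbor must be assigned explicitly; it goes to the left side, as does the edge from
    -- `j` to the left.
    fun e => if e.src < j ∨ e.dst < j then o.2 e else o'.2 e)

section Mix

variable {V : ChainEdge n → Type*} {t : ℕ} {j : Fin n}

lemma mix_mix (o o' : (Fin t → ∀ e, Y e) × (∀ e, V e)) : mix j (mix j o o') (mix j o' o) = o := by
  refine Prod.ext ?_ ?_
  · funext s e
    simp only [mix]
    split_ifs <;> rfl
  · funext e
    simp only [mix]
    split_ifs <;> rfl

lemma mix_fst_of_le {o o' : (Fin t → ∀ e, Y e) × (∀ e, V e)}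
    (h : ∀ s, ∀ e : ChainEdge n, e.dst = j → o.1 s e = o'.1 s e) (s : Fin t) {e : ChainEdge n}
    (he : e.dst ≤ j) : (mix j o o').1 s e = o.1 s e := by
  simp only [mix]
  split_ifs with h1
  · rfl
  · exact (h s e (le_antisymm he (not_lt.1 h1))).symm

lemma mix_fst_of_ge (o o' : (Fin t → ∀ e, Y e) × (∀ e, V e)) (s : Fin t) {e : ChainEdge n}
    (he : j ≤ e.dst) : (mix j o o').1 s e = o'.1 s e :=
  if_neg (not_lt.2 he)

lemma mix_snd_of_lt (o o' : (Fin t → ∀ e, Y e) × (∀ e, V e)) {e : ChainEdge n}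
    (he : e.src < j ∨ e.dst < j) : (mix j o o').2 e = o.2 e :=
  if_pos he

lemma mix_snd_of_ge (o o' : (Fin t → ∀ e, Y e) × (∀ e, V e)) {e : ChainEdge n}
    (he : j ≤ e.src) (he' : j ≤ e.dst) : (mix j o o').2 e = o'.2 e :=
  if_neg (by rw [not_or, not_lt, not_lt]; exact ⟨he, he'⟩)

end Mix

end Cut

section IdMatrix

variable {n : ℕ} {X : ChainEdge n → Type*}

open Classical in
/-- The transition matrices of the noiseless channels. -/
noncomputable def idMatrix (X : ChainEdge n → Type*) (e : ChainEdge n) (x x' : X e) : ℝ :=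
  if x = x' then 1 else 0

lemma idMatrix_nonneg (e : ChainEdge n) (x x' : X e) : 0 ≤ idMatrix X e x x' := by
  unfold idMatrix
  split_ifs <;> norm_num

lemma sum_idMatrix_mul [∀ e, Fintype (X e)] (e : ChainEdge n) (x : X e) (g : X e → ℝ) :
    ∑ x', idMatrix X e x x' * g x' = g x := by
  classical
  simp [idMatrix]

lemma sum_idMatrix [∀ e, Fintype (X e)] (e : ChainEdge n) (x : X e) :
    ∑ x', idMatrix X e x x' = 1 := by
  classical
  simp [idMatrix]

end IdMatrix

variable {n T : ℕ} {W : Fin n → Type*} {X Y : ChainEdge n → Type*}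
  {U : Fin n → Fin T → Type*} {Z : Type*}
  [∀ i, MeasurableSpace (W i)] [∀ e, MeasurableSpace (X e)] [∀ e, MeasurableSpace (Y e)]
  [∀ i t, MeasurableSpace (U i t)] [MeasurableSpace Z]

section Transition

variable [∀ e, DiscreteMeasurableSpace (X e)] [∀ e, Fintype (X e)]
  [∀ e, Fintype (Y e)] [∀ e, MeasurableSingletonClass (Y e)]
  {α : Type*} [MeasurableSpace α]

lemma integrable_finPush_pathWt_mul (alg : ChainAlgorithm T W X Y U Z)
    (K : ∀ e, Kernel (X e) (Y e)) [∀ e, IsMarkovKernel (K e)]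
    {V : ChainEdge n → Type*} [∀ e, Fintype (V e)]
    {k : ∀ e, X e → V e → ℝ} (hk0 : ∀ e x v, 0 ≤ k e x v) (hk1 : ∀ e x, ∑ v, k e x v = 1)
    {t : ℕ} (ht : t < T) (w : ∀ i, W i)
    {ζ ι : Type*} [Fintype ι] (f : (Fin t → ∀ e, Y e) → ζ) (ε : ι → ChainEdge n)
    (z : ζ) (u : ∀ j, V (ε j)) :
    Integrable (fun r => finPush f (fun r y => alg.pathWt K ht.le w r y *
      ∏ j, k (ε j) (alg.lastInput (ε j) ht w (r (ε j).src) y) (u j)) r z) (randLaw n T) := by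
  refine integrable_finsetSum _ fun y _ => ?_
  have hp := (alg.isFinKernel_pathWt K ht.le
    (measurable_const : Measurable fun _ : Unit => w)).prodMk ()
  refine (hp.integrable (randLaw n T) y).mul_bdd (c := 1) ?_ (ae_of_all _ fun r => ?_)
  · refine (Finset.measurable_prod _ fun j _ => ?_).aestronglyMeasurable
    exact (Measurable.of_discrete (f := fun x => k (ε j) x (u j))).comp
      ((alg.measurable_lastInput (ε j) ht y).comp
        (f := fun r : Fin n → Fin T → unitInterval => (w, r (ε j).src))
        (measurable_const.prodMk (measurable_pi_apply _)))
  · rw [Real.norm_of_nonneg (Finset.prod_nonneg fun j _ => hk0 _ _ _)]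
    refine Finset.prod_le_one (fun j _ => hk0 _ _ _) fun j _ => ?_
    rw [← hk1 (ε j) (alg.lastInput (ε j) ht w (r (ε j).src) y)]
    exact Finset.single_le_sum (fun v _ => hk0 _ _ v) (Finset.mem_univ _)

/-- With `idMatrix` the "outputs" are the sent symbols themselves; passing them through the product
of the true channels yields the received ones. This is the transition hypothesis of `finMI_sdpi` and
`finMI_capacity`. -/
lemma finPush_stepLaw_kernelMatrix (alg : ChainAlgorithm T W X Y U Z)
    (K : ∀ e, Kernel (X e) (Y e)) [∀ e, IsMarkovKernel (K e)] {t : ℕ} (ht : t < T)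
    {w : α → ∀ i, W i} (hw : Measurable w)
    {ζ ι : Type*} [Fintype ι] [DecidableEq ι] (f : (Fin t → ∀ e, Y e) → ζ) {ε : ι → ChainEdge n}
    (hε : Function.Injective ε) (a : α) (z : ζ) (u : ∀ j, Y (ε j)) :
    finPush (fun o => (f o.1, fun j => o.2 (ε j)))
      (fun a => alg.stepLaw K (fun e => kernelMatrix (K e)) ht (w a)) a (z, u) =
    ∑ x : (∀ j, X (ε j)), finPush (fun o => (f o.1, fun j => o.2 (ε j)))
      (fun a => alg.stepLaw K (idMatrix X) ht (w a)) a (z, x) *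
        ∏ j, kernelMatrix (K (ε j)) (x j) (u j) := by
  rw [finPush_stepLaw alg K (fun e => kernelMatrix_nonneg (K e))
    (fun e => sum_kernelMatrix (K e)) ht hw f hε]
  simp only [finPush_stepLaw alg K (k := idMatrix X) idMatrix_nonneg sum_idMatrix ht hw f hε]
  simp only [← integral_mul_const]
  rw [← integral_finsetSum]
  · refine integral_congr_ae (ae_of_all _ fun r => ?_)
    simp only [finPush, Finset.sum_mul]
    rw [Finset.sum_comm]
    refine Finset.sum_congr rfl fun y _ => ?_
    simp only [mul_assoc, ← Finset.prod_mul_distrib]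
    rw [← Finset.mul_sum, ← Fintype.prod_sum fun j x => idMatrix X (ε j)
      (alg.lastInput (ε j) ht (w a) (r (ε j).src) y) x * kernelMatrix (K (ε j)) x (u j)]
    simp only [sum_idMatrix_mul (X := X)]
  · exact fun x _ => (alg.integrable_finPush_pathWt_mul K idMatrix_nonneg sum_idMatrix ht (w a) f
      ε z x).mul_const _

lemma sum_finPush_stepLaw (alg : ChainAlgorithm T W X Y U Z)
    (K : ∀ e, Kernel (X e) (Y e)) [∀ e, IsMarkovKernel (K e)] {t : ℕ} (ht : t < T)
    {w : α → ∀ i, W i} (hw : Measurable w)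
    {ζ ι : Type*} [Fintype ι] [DecidableEq ι] (f : (Fin t → ∀ e, Y e) → ζ) {ε : ι → ChainEdge n}
    (hε : Function.Injective ε) (a : α) (z : ζ) :
    ∑ x : (∀ j, X (ε j)), finPush (fun o => (f o.1, fun j => o.2 (ε j)))
      (fun a => alg.stepLaw K (idMatrix X) ht (w a)) a (z, x) =
    finPush f (fun a => alg.pathLaw K ht.le (w a)) a z := by
  rw [finPush_pathLaw alg K ht.le hw]
  simp only [finPush_stepLaw alg K (k := idMatrix X) idMatrix_nonneg sum_idMatrix ht hw f hε]
  rw [← integral_finsetSum]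
  · refine integral_congr_ae (ae_of_all _ fun r => ?_)
    simp only [finPush]
    rw [Finset.sum_comm]
    refine Finset.sum_congr rfl fun y _ => ?_
    rw [← Finset.mul_sum, ← Fintype.prod_sum fun j x => idMatrix X (ε j)
      (alg.lastInput (ε j) ht (w a) (r (ε j).src) y) x]
    simp only [sum_idMatrix, Finset.prod_const_one, mul_one]
  · exact fun x _ => alg.integrable_finPush_pathWt_mul K idMatrix_nonneg sum_idMatrix ht (w a) f
      ε z x

end Transition

/-! ### Factorization along the chain -/

/-- The factor of the edge `e` in `stepWt`. -/
noncomputable def edgeFactor (alg : ChainAlgorithm T W X Y U Z) (K : ∀ e, Kernel (X e) (Y e))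
    {V : ChainEdge n → Type*} (k : ∀ e, X e → V e → ℝ)
    {t : ℕ} (ht : t < T) (e : ChainEdge n) (w : ∀ i, W i) (r : Fin T → unitInterval)
    (o : (Fin t → ∀ e, Y e) × (∀ e, V e)) : ℝ :=
  alg.edgeWt K e ht.le w r o.1 * k e (alg.lastInput e ht w r o.1) (o.2 e)

/-- The factor in `stepLaw` of the edges to the left from node `i`. -/
noncomputable def leftFactor (alg : ChainAlgorithm T W X Y U Z) (K : ∀ e, Kernel (X e) (Y e))
    {V : ChainEdge n → Type*} (k : ∀ e, X e → V e → ℝ)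
    {t : ℕ} (ht : t < T) (i : Fin n) (w : ∀ i, W i)
    (o : (Fin t → ∀ e, Y e) × (∀ e, V e)) : ℝ :=
  ∏ e with e.src = i ∧ e.dst < e.src, alg.edgeFactor K k ht e w 0 o

/-- The factor in `stepLaw` of the self-loop at node `i` and of the edges to the right from it. -/
noncomputable def rightFactor (alg : ChainAlgorithm T W X Y U Z) (K : ∀ e, Kernel (X e) (Y e))
    {V : ChainEdge n → Type*} (k : ∀ e, X e → V e → ℝ)
    {t : ℕ} (ht : t < T) (i : Fin n) (w : ∀ i, W i)
    (o : (Fin t → ∀ e, Y e) × (∀ e, V e)) : ℝ :=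
  ∫ r, ∏ e with e.src = i ∧ ¬ e.dst < e.src, alg.edgeFactor K k ht e w r o
    ∂Measure.pi fun _ => volume

lemma edgeFactor_eq_of_left (alg : ChainAlgorithm T W X Y U Z) (K : ∀ e, Kernel (X e) (Y e))
    {V : ChainEdge n → Type*} (k : ∀ e, X e → V e → ℝ) {t : ℕ} (ht : t < T) {e : ChainEdge n}
    (he : e.dst < e.src) (w : ∀ i, W i) (r r' : Fin T → unitInterval)
    (o : (Fin t → ∀ e, Y e) × (∀ e, V e)) :
    alg.edgeFactor K k ht e w r o = alg.edgeFactor K k ht e w r' o := by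
  simp only [edgeFactor, edgeWt, lastInput, alg.input_eq_of_left he _ _ r r']

/-- The weights group by source node and the randomness of different nodes is independent, so the
integral factors. Left messages do not depend on the randomness and leave the integral, evaluated at
the arbitrary point `0`. -/
lemma stepLaw_eq_prod (alg : ChainAlgorithm T W X Y U Z) (K : ∀ e, Kernel (X e) (Y e))
    {V : ChainEdge n → Type*} (k : ∀ e, X e → V e → ℝ) {t : ℕ} (ht : t < T)
    (w : ∀ i, W i) (o : (Fin t → ∀ e, Y e) × (∀ e, V e)) :
    alg.stepLaw K k ht w o =
      ∏ i, alg.leftFactor K k ht i w o * alg.rightFactor K k ht i w o := by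
  have h1 : ∀ r, alg.stepWt K k ht w r o = ∏ i, (alg.leftFactor K k ht i w o *
      ∏ e with e.src = i ∧ ¬ e.dst < e.src, alg.edgeFactor K k ht e w (r i) o) := by
    intro r
    have h2 : alg.stepWt K k ht w r o = ∏ e, alg.edgeFactor K k ht e w (r e.src) o := rfl
    rw [h2, ← Finset.prod_fiberwise _ fun e : ChainEdge n => e.src]
    refine Finset.prod_congr rfl fun i _ => ?_
    rw [← Finset.prod_filter_mul_prod_filter_not _ fun e : ChainEdge n => e.dst < e.src,
      Finset.filter_filter, Finset.filter_filter]
    congr 1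
    · refine Finset.prod_congr rfl fun e he => ?_
      exact alg.edgeFactor_eq_of_left K k ht (Finset.mem_filter.1 he).2.2 w _ _ o
    · refine Finset.prod_congr rfl fun e he => ?_
      rw [(Finset.mem_filter.1 he).2.1]
  simp only [stepLaw, h1]
  rw [integral_fintype_prod_eq_prod fun (i : Fin n) r => alg.leftFactor K k ht i w o *
      ∏ e with e.src = i ∧ ¬ e.dst < e.src, alg.edgeFactor K k ht e w r o]
  simp only [integral_const_mul, rightFactor]

lemma edgeFactor_congr (alg : ChainAlgorithm T W X Y U Z) (K : ∀ e, Kernel (X e) (Y e))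
    {V : ChainEdge n → Type*} (k : ∀ e, X e → V e → ℝ) {t : ℕ} (ht : t < T) (e : ChainEdge n)
    {w w' : ∀ i, W i} (hw : w e.src = w' e.src) (r : Fin T → unitInterval)
    {o o' : (Fin t → ∀ e, Y e) × (∀ e, V e)}
    (h1 : ∀ s, ∀ e' : ChainEdge n, e'.dst = e.src → o.1 s e' = o'.1 s e')
    (h2 : ∀ s, o.1 s e = o'.1 s e) (h3 : o.2 e = o'.2 e) :
    alg.edgeFactor K k ht e w r o = alg.edgeFactor K k ht e w' r o' := by
  have hp : ∀ s h, pathPast (i := e.src) (T := T) o.1 s h = pathPast o'.1 s h := fun s h => by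
    funext u j
    exact h1 _ _ rfl
  simp only [edgeFactor, edgeWt, lastInput, hw, hp, h2, h3]

section Mix

variable {V : ChainEdge n → Type*} {t : ℕ} {j : Fin n}

/-- These edges involve only symbols received at nodes up to `j`, where the mixture agrees with `o`;
at `j` itself this is the hypothesis that the two histories coincide. -/
lemma leftFactor_mix (alg : ChainAlgorithm T W X Y U Z) (K : ∀ e, Kernel (X e) (Y e))
    (k : ∀ e, X e → V e → ℝ) (ht : t < T) {i : Fin n} (hi : i ≤ j) (w : ∀ i, W i)
    {o o' : (Fin t → ∀ e, Y e) × (∀ e, V e)}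
    (h : ∀ s, ∀ e : ChainEdge n, e.dst = j → o.1 s e = o'.1 s e) :
    alg.leftFactor K k ht i w (mix j o o') = alg.leftFactor K k ht i w o := by
  refine Finset.prod_congr rfl fun e he => ?_
  obtain ⟨rfl, hl⟩ := (Finset.mem_filter.1 he).2
  exact alg.edgeFactor_congr K k ht e rfl 0 (fun s e' he' => mix_fst_of_le h s (he' ▸ hi))
    (fun s => mix_fst_of_le h s (hl.le.trans hi)) (mix_snd_of_lt _ _ (Or.inr (hl.trans_le hi)))

lemma rightFactor_mix (alg : ChainAlgorithm T W X Y U Z) (K : ∀ e, Kernel (X e) (Y e))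
    (k : ∀ e, X e → V e → ℝ) (ht : t < T) {i : Fin n} (hi : i < j) (w : ∀ i, W i)
    {o o' : (Fin t → ∀ e, Y e) × (∀ e, V e)}
    (h : ∀ s, ∀ e : ChainEdge n, e.dst = j → o.1 s e = o'.1 s e) :
    alg.rightFactor K k ht i w (mix j o o') = alg.rightFactor K k ht i w o := by
  refine integral_congr_ae (ae_of_all _ fun r => Finset.prod_congr rfl fun e he => ?_)
  obtain ⟨rfl, -⟩ := (Finset.mem_filter.1 he).2
  have hd := e.dst_le
  exact alg.edgeFactor_congr K k ht e rfl r (fun s e' he' => mix_fst_of_le h s (he' ▸ hi.le))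
    (fun s => mix_fst_of_le h s (Fin.le_def.2 (by have := Fin.lt_def.1 hi; omega)))
    (mix_snd_of_lt _ _ (Or.inl hi))

/-- These edges involve only symbols received at nodes from `j` on, where the mixture agrees with
`o'`, and an observation that `w` and `w'` share. -/
lemma leftFactor_mix' (alg : ChainAlgorithm T W X Y U Z) (K : ∀ e, Kernel (X e) (Y e))
    (k : ∀ e, X e → V e → ℝ) (ht : t < T) {i : Fin n} (hi : j < i) {w w' : ∀ i, W i}
    (hw : w i = w' i) (o o' : (Fin t → ∀ e, Y e) × (∀ e, V e)) :
    alg.leftFactor K k ht i w (mix j o o') = alg.leftFactor K k ht i w' o' := by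
  refine Finset.prod_congr rfl fun e he => ?_
  obtain ⟨rfl, -⟩ := (Finset.mem_filter.1 he).2
  have hd : j ≤ e.dst := Fin.le_def.2 (by have := e.src_le; have := Fin.lt_def.1 hi; omega)
  exact alg.edgeFactor_congr K k ht e hw 0 (fun s e' he' => mix_fst_of_ge _ _ s (he' ▸ hi.le))
    (fun s => mix_fst_of_ge _ _ s hd) (mix_snd_of_ge _ _ hi.le hd)

lemma rightFactor_mix' (alg : ChainAlgorithm T W X Y U Z) (K : ∀ e, Kernel (X e) (Y e))
    (k : ∀ e, X e → V e → ℝ) (ht : t < T) {i : Fin n} (hi : j ≤ i) {w w' : ∀ i, W i}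
    (hw : w i = w' i) (o o' : (Fin t → ∀ e, Y e) × (∀ e, V e)) :
    alg.rightFactor K k ht i w (mix j o o') = alg.rightFactor K k ht i w' o' := by
  refine integral_congr_ae (ae_of_all _ fun r => Finset.prod_congr rfl fun e he => ?_)
  obtain ⟨rfl, hl⟩ := (Finset.mem_filter.1 he).2
  have hd : j ≤ e.dst := hi.trans (not_lt.1 hl)
  exact alg.edgeFactor_congr K k ht e hw r (fun s e' he' => mix_fst_of_ge _ _ s (he' ▸ hi))
    (fun s => mix_fst_of_ge _ _ s hd) (mix_snd_of_ge _ _ hi hd)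

/-- Conditional independence of the two sides of the cut at node `j`, given the observations to
the right of the cut and what node `j` received. -/
lemma stepLaw_mul_stepLaw_mix (alg : ChainAlgorithm T W X Y U Z) (K : ∀ e, Kernel (X e) (Y e))
    (k : ∀ e, X e → V e → ℝ) (ht : t < T) {w w' : ∀ i, W i} (hw : ∀ i, j ≤ i → w i = w' i)
    {o o' : (Fin t → ∀ e, Y e) × (∀ e, V e)}
    (h : ∀ s, ∀ e : ChainEdge n, e.dst = j → o.1 s e = o'.1 s e) :
    alg.stepLaw K k ht w o * alg.stepLaw K k ht w' o' =
      alg.stepLaw K k ht w (mix j o o') * alg.stepLaw K k ht w' (mix j o' o) := by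
  have h' : ∀ s, ∀ e : ChainEdge n, e.dst = j → o'.1 s e = o.1 s e := fun s e he => (h s e he).symm
  simp only [stepLaw_eq_prod, ← Finset.prod_mul_distrib]
  refine Finset.prod_congr rfl fun i _ => ?_
  rcases lt_trichotomy i j with hi | rfl | hi
  · rw [alg.leftFactor_mix K k ht hi.le w h, alg.leftFactor_mix K k ht hi.le w' h',
      alg.rightFactor_mix K k ht hi w h, alg.rightFactor_mix K k ht hi w' h']
  -- At the cut node the left factor follows `o` and the right factor follows `o'`; they can part
  -- because they share no private randomness.
  · rw [alg.leftFactor_mix K k ht le_rfl w h, alg.leftFactor_mix K k ht le_rfl w' h',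
      alg.rightFactor_mix' K k ht le_rfl (hw i le_rfl),
      alg.rightFactor_mix' K k ht le_rfl (hw i le_rfl).symm]
    ring
  · rw [alg.leftFactor_mix' K k ht hi (hw i hi.le), alg.leftFactor_mix' K k ht hi (hw i hi.le).symm,
      alg.rightFactor_mix' K k ht hi.le (hw i hi.le),
      alg.rightFactor_mix' K k ht hi.le (hw i hi.le).symm]
    ring

end Mix

end ChainAlgorithm

/-! ### Further rules for push-forwards. -/

lemma finPush_equiv {α O O' β : Type*} [Fintype O] [Fintype O'] (e : O ≃ O') (f : O' → β)
    (p : α → O' → ℝ) (a : α) (b : β) :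
    finPush f p a b = finPush (fun o => f (e o)) (fun a o => p a (e o)) a b := by
  classical
  simp only [finPush, Finset.sum_filter]
  exact (Fintype.sum_equiv e _ _ fun o => by congr).symm

lemma finPush_congr {α O β β' : Type*} [Fintype O] {f : O → β} {f' : O → β'} {q : α → O → ℝ}
    {b : β} {b' : β'} (h : ∀ o, f o = b ↔ f' o = b') (a : α) :
    finPush f q a b = finPush f' q a b' := by
  classical
  exact Finset.sum_congr (by ext o; simp [h o]) fun _ _ => rfl

lemma finPush_fst {α ζ χ : Type*} [Fintype ζ] [Fintype χ] (p : α → ζ × χ → ℝ) (a : α) (z : ζ) :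
    finPush Prod.fst p a z = ∑ x, p a (z, x) := by
  classical
  simp only [finPush, Finset.sum_filter, Fintype.sum_prod_type]
  rw [Finset.sum_eq_single z]
  · simp
  · intro z' _ hz
    simp [hz]
  · simp

lemma finMI_push_comp_le {α O : Type*} [MeasurableSpace α] [Fintype O] {q : α → O → ℝ}
    {κ : Measure α} [IsProbabilityMeasure κ] (hq : IsFinKernel q) {β γ : Type*} [Fintype β]
    [Fintype γ] (f : O → β) (g : β → γ) :
    finMI κ (finPush (fun o => g (f o)) q) ≤ finMI κ (finPush f q) := by
  classical
  refine finMI_le_of_channel (hq.push f) (hq.push _) (fun b c => if g b = c then 1 else 0)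
    (fun b c => by split_ifs <;> norm_num) (fun b _ => by simp) fun a c => ?_
  rw [finPush_comp f g]
  simp only [mul_ite, mul_one, mul_zero]
  rw [finPush, Finset.sum_filter]

/-! ### Information at a node and its growth in one step. -/

namespace ChainAlgorithm

/-- The symbols received by node `i`. -/
def received {n : ℕ} {Y : ChainEdge n → Type*} {t : ℕ} (i : Fin n) (y : Fin t → ∀ e, Y e) :
    Fin t → InMsg Y i := fun s j => y s (inEdge j)

lemma received_eq_iff {n : ℕ} {Y : ChainEdge n → Type*} {t : ℕ} {i : Fin n}
    {y y' : Fin t → ∀ e, Y e} :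
    received i y = received i y' ↔ ∀ s, ∀ e : ChainEdge n, e.dst = i → y s e = y' s e := by
  refine ⟨fun h s e he => ?_, fun h => funext fun s => funext fun j => h s _ rfl⟩
  obtain ⟨⟨a, b⟩, hab⟩ := e
  subst he
  exact congrFun (congrFun h s) ⟨a, hab⟩

lemma inEdge_injective {n : ℕ} (i : Fin n) :
    Function.Injective (inEdge : InNbr i → ChainEdge n) := fun _ _ h =>
  Subtype.ext (congrArg (fun e : ChainEdge n => e.1.1) h)

section

variable {n : ℕ} {X Y : ChainEdge n → Type*}
    [∀ e, MeasurableSpace (X e)] [∀ e, Finite (X e)] [∀ e, DiscreteMeasurableSpace (X e)]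
    [∀ e, MeasurableSpace (Y e)]

lemma kernelMatrix_inChannel (K : ∀ e, Kernel (X e) (Y e)) [∀ e, IsMarkovKernel (K e)] (i : Fin n)
    (x : InMsg X i) (y : InMsg Y i) :
    kernelMatrix (inChannel K i) x y = ∏ j, kernelMatrix (K (inEdge j)) (x j) (y j) := by
  change (Measure.pi fun j => K (inEdge j) (x j)).real {y} = _
  rw [Measure.real, Measure.pi_singleton, ENNReal.toReal_prod]
  rfl

instance (K : ∀ e, Kernel (X e) (Y e)) [∀ e, IsMarkovKernel (K e)] (i : Fin n) :
    IsMarkovKernel (inChannel K i) :=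
  ⟨fun x => inferInstanceAs (IsProbabilityMeasure (Measure.pi fun j => K (inEdge j) (x j)))⟩

end

variable {n T : ℕ} {W : Fin n → Type*} {X Y : ChainEdge n → Type*}
  {U : Fin n → Fin T → Type*} {Z : Type*}
  [∀ i, MeasurableSpace (W i)] [∀ e, MeasurableSpace (X e)] [∀ e, MeasurableSpace (Y e)]
  [∀ i t, MeasurableSpace (U i t)] [MeasurableSpace Z]
  [∀ e, DiscreteMeasurableSpace (X e)] [∀ e, Fintype (X e)]
  [∀ e, Fintype (Y e)]
  {α : Type*} [MeasurableSpace α]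

/-- The information about `a` in what node `i` received before time `t`, if the observations are
`w a` with `a` of law `κ`. -/
noncomputable def nodeInfo (alg : ChainAlgorithm T W X Y U Z) (K : ∀ e, Kernel (X e) (Y e))
    (κ : Measure α) (w : α → ∀ i, W i) {t : ℕ} (ht : t ≤ T) (i : Fin n) : ℝ :=
  finMI κ (finPush (received i) fun a => alg.pathLaw K ht (w a))

/-- The information about `a` in what node `i` received before time `t` and in the symbols sent to
node `i` at time `t`. -/
noncomputable def inputInfo (alg : ChainAlgorithm T W X Y U Z) (K : ∀ e, Kernel (X e) (Y e))
    (κ : Measure α) (w : α → ∀ i, W i) {t : ℕ} (ht : t < T) (i : Fin n) : ℝ :=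
  finMI κ (finPush (fun o => (received i o.1, fun j : InNbr i => o.2 (inEdge j)))
    fun a => alg.stepLaw K (idMatrix X) ht (w a))

variable {κ : Measure α} [IsProbabilityMeasure κ] [∀ e, MeasurableSingletonClass (Y e)]

/-- What a node has received after the step is a function of what it had before and of the new
symbols, via `Fin.snoc`. -/
lemma nodeInfo_succ_le_finMI (alg : ChainAlgorithm T W X Y U Z) (K : ∀ e, Kernel (X e) (Y e))
    [∀ e, IsMarkovKernel (K e)] {w : α → ∀ i, W i} (hw : Measurable w) {t : ℕ} (ht : t < T)
    (i : Fin n) :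
    alg.nodeInfo K κ w (t := t + 1) ht i ≤
      finMI κ (finPush (fun o => (received i o.1, fun j : InNbr i => o.2 (inEdge j)))
        fun a => alg.stepLaw K (fun e => kernelMatrix (K e)) ht (w a)) := by
  have hq := alg.isFinKernel_stepLaw K (fun e => kernelMatrix_nonneg (K e))
    (fun e => sum_kernelMatrix (K e)) ht hw
  refine le_trans (le_of_eq ?_) (finMI_push_comp_le hq _
    fun p : (Fin t → InMsg Y i) × InMsg Y i => (Fin.snoc (α := fun _ => InMsg Y i) p.1 p.2 :
      Fin (t + 1) → InMsg Y i))
  rw [nodeInfo]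
  congr 1
  funext a b
  rw [finPush_equiv ((Equiv.prodComm _ _).trans (Fin.snocEquiv fun _ => ∀ e, Y e))]
  have h1 : ∀ (a : α) (o : (Fin t → ∀ e, Y e) × (∀ e, Y e)),
      alg.pathLaw K (t := t + 1) ht (w a)
        (((Equiv.prodComm _ _).trans (Fin.snocEquiv fun _ => ∀ e, Y e)) o) =
      alg.stepLaw K (fun e => kernelMatrix (K e)) ht (w a) o :=
    fun a o => alg.pathLaw_snoc K ht (w a) o.1 o.2
  simp only [h1]
  refine finPush_congr (fun o => ?_) a
  refine Eq.congr_left ?_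
  funext s j
  refine Fin.lastCases ?_ (fun s => ?_) s
  · simp [received, Fin.snocEquiv]
  · simp [received, Fin.snocEquiv]

/-- One step of a channel contracts the information that it adds. -/
lemma nodeInfo_succ_le (alg : ChainAlgorithm T W X Y U Z) (K : ∀ e, Kernel (X e) (Y e))
    [∀ e, IsMarkovKernel (K e)] {w : α → ∀ i, W i} (hw : Measurable w) {t : ℕ} (ht : t < T)
    {i : Fin n} {c : ℝ} (hc : sdpiConst (inChannel K i) ≤ c) :
    alg.nodeInfo K κ w (t := t + 1) ht i ≤
      (1 - c) * alg.nodeInfo K κ w ht.le i + c * alg.inputInfo K κ w ht i := by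
  refine (alg.nodeInfo_succ_le_finMI K hw ht i).trans ?_
  refine finMI_sdpi (finSDPI_of_sdpiConst_le (inChannel K i) hc)
    (kernelMatrix_nonneg _) (sum_kernelMatrix _) ?_ ?_ ?_ (fun a z y => ?_) fun a z => ?_
  · exact (alg.isFinKernel_stepLaw K idMatrix_nonneg sum_idMatrix ht hw).push _
  · exact (alg.isFinKernel_stepLaw K (fun e => kernelMatrix_nonneg (K e))
      (fun e => sum_kernelMatrix (K e)) ht hw).push _
  · exact (alg.isFinKernel_pathLaw K ht.le hw).push _
  · rw [alg.finPush_stepLaw_kernelMatrix K ht hw (received i) (inEdge_injective i)]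
    simp only [kernelMatrix_inChannel]
  · exact (alg.sum_finPush_stepLaw K ht hw (received i) (inEdge_injective i) a z).symm

lemma finPush_received_stepLaw (alg : ChainAlgorithm T W X Y U Z) (K : ∀ e, Kernel (X e) (Y e))
    [∀ e, IsMarkovKernel (K e)] {w : α → ∀ i, W i} (hw : Measurable w) {t : ℕ} (ht : t < T)
    (i : Fin n) :
    finPush (fun o => received i o.1) (fun a => alg.stepLaw K (idMatrix X) ht (w a)) =
      finPush (received i) fun a => alg.pathLaw K ht.le (w a) := by
  funext a z
  rw [← alg.sum_finPush_stepLaw K ht hw (received i) (inEdge_injective i) a z,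
    ← finPush_fst, ← finPush_comp]

/-- The information in the symbols sent to a node passes through the node to its left. -/
lemma inputInfo_le (alg : ChainAlgorithm T W X Y U Z) (K : ∀ e, Kernel (X e) (Y e))
    [∀ e, IsMarkovKernel (K e)] {w : α → ∀ i, W i} (hw : Measurable w) {t : ℕ} (ht : t < T)
    {i j : Fin n} (hij : (i : ℕ) = j + 1) (hj : ∀ a a' i, j ≤ i → w a i = w a' i) :
    alg.inputInfo K κ w ht i ≤ alg.nodeInfo K κ w ht.le j := by
  rw [nodeInfo, ← alg.finPush_received_stepLaw K hw ht j]
  have hji : j ≤ i := Fin.le_def.2 (by omega)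
  refine finMI_push_le (alg.isFinKernel_stepLaw K idMatrix_nonneg sum_idMatrix ht hw)
    (fun o => received j o.1) _ (mix j) (fun o o' _ => mix_mix o o') (fun o o' h => ?_)
    (fun o o' h => ?_) fun a a' o o' h => ?_
  · rw [received_eq_iff] at h ⊢
    exact fun s e he => mix_fst_of_le h s he.le
  · refine congrArg₂ Prod.mk ?_ (funext fun l => ?_)
    · refine received_eq_iff.2 fun s e he => mix_fst_of_ge o o' s ?_
      rw [he]
      exact hji
    · refine mix_snd_of_ge o o' ?_ hji
      have := (inEdge l).dst_le
      exact Fin.le_def.2 (by change (i : ℕ) ≤ _ at this; omega)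
  · exact alg.stepLaw_mul_stepLaw_mix K _ ht (hj a a') (received_eq_iff.1 h)

lemma finPush_received_single {V : ChainEdge n → Type*} [∀ e, Fintype (V e)] {t : ℕ}
    (q : α → (Fin t → ∀ e, Y e) × (∀ e, V e) → ℝ) (a : α) (i : Fin n) (e : ChainEdge n)
    (z : Fin t → InMsg Y i) (x : V e) :
    finPush (fun o => (received i o.1, o.2 e)) q a (z, x) =
      finPush (fun o => (received i o.1, fun _ : Unit => o.2 e)) q a (z, fun _ => x) :=
  finPush_congr (fun o => by simp [Prod.ext_iff, funext_iff]) a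

/-- In one step the second node gains at most the capacity of the edge from the first node. -/
lemma nodeInfo_second_succ_le (alg : ChainAlgorithm T W X Y U Z) (K : ∀ e, Kernel (X e) (Y e))
    [∀ e, IsMarkovKernel (K e)] {w : α → ∀ i, W i} (hw : Measurable w) {t : ℕ} (ht : t < T)
    (hn : 2 ≤ n) (hj : ∀ a a' i, i ≠ firstNode hn → w a i = w a' i) {C : ℝ}
    (hC : FinCapLE (kernelMatrix (K (firstEdge hn))) C) :
    alg.nodeInfo K κ w (t := t + 1) ht (secondNode hn) ≤
      alg.nodeInfo K κ w ht.le (secondNode hn) + C := by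
  have hq := alg.isFinKernel_stepLaw K (fun e => kernelMatrix_nonneg (K e))
    (fun e => sum_kernelMatrix (K e)) ht hw
  have hqi := alg.isFinKernel_stepLaw K idMatrix_nonneg sum_idMatrix ht hw
  refine (alg.nodeInfo_succ_le_finMI K hw ht _).trans ?_
  have hlt : firstNode hn < secondNode hn := Fin.lt_def.2 Nat.zero_lt_one
  -- Cut at the second node: given its past, only the symbol arriving from the first node can depend
  -- on `a`. The self-loop and the edge from the right lie on the other side of the cut, so they may
  -- be dropped.
  have h1 : finMI κ (finPush (fun o => (received (secondNode hn) o.1,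
        fun j : InNbr (secondNode hn) => o.2 (inEdge j)))
        fun a => alg.stepLaw K (fun e => kernelMatrix (K e)) ht (w a)) ≤
      finMI κ (finPush (fun o => (received (secondNode hn) o.1, o.2 (firstEdge hn)))
        fun a => alg.stepLaw K (fun e => kernelMatrix (K e)) ht (w a)) := by
    have hZ : ∀ o o' : (Fin t → ∀ e, Y e) × (∀ e, Y e),
        (received (secondNode hn) o.1, o.2 (firstEdge hn)) =
          (received (secondNode hn) o'.1, o'.2 (firstEdge hn)) →
        (∀ s, ∀ e : ChainEdge n, e.dst = secondNode hn → o.1 s e = o'.1 s e) ∧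
          o.2 (firstEdge hn) = o'.2 (firstEdge hn) :=
      fun o o' h => ⟨received_eq_iff.1 (Prod.ext_iff.1 h).1, (Prod.ext_iff.1 h).2⟩
    refine finMI_push_le hq _ _ (mix (secondNode hn)) (fun o o' _ => mix_mix o o')
      (fun o o' h => ?_) (fun o o' h => ?_) fun a a' o o' h => ?_
    · refine congrArg₂ Prod.mk ?_ (mix_snd_of_lt o o' (Or.inl hlt))
      exact received_eq_iff.2 fun s e he => mix_fst_of_le (hZ o o' h).1 s he.le
    · refine congrArg₂ Prod.mk ?_ (funext fun l => ?_)
      · exact received_eq_iff.2 fun s e he => mix_fst_of_ge o o' s he.ge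
      by_cases hl : l.1 = firstNode hn
      · obtain ⟨l, hl'⟩ := l
        subst hl
        exact (mix_snd_of_lt o o' (Or.inl hlt)).trans (hZ o o' h).2
      · refine mix_snd_of_ge o o' (Fin.le_def.2 ?_) le_rfl
        have : (l.1 : ℕ) ≠ 0 := fun h0 => hl (Fin.ext h0)
        change 1 ≤ (l.1 : ℕ)
        omega
    · refine alg.stepLaw_mul_stepLaw_mix K _ ht (fun i hi => hj a a' i ?_) (hZ o o' h).1
      rintro rfl
      exact absurd (Fin.le_def.1 hi) (by simp)
  refine h1.trans ?_
  -- The transition lemmas concern families of edges; a single edge is a family indexed by `Unit`.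
  have hε : Function.Injective fun _ : Unit => firstEdge hn := fun _ _ _ => rfl
  refine finMI_capacity hC (kernelMatrix_nonneg _) (sum_kernelMatrix _)
    (hqi.push fun o => (received (secondNode hn) o.1, o.2 (firstEdge hn))) (hq.push _)
    ((alg.isFinKernel_pathLaw K ht.le hw).push _) (fun a z y => ?_) fun a z => ?_
  · rw [finPush_received_single,
      alg.finPush_stepLaw_kernelMatrix K ht hw (received (secondNode hn)) hε]
    refine Fintype.sum_equiv (Equiv.funUnique Unit (X (firstEdge hn))) _ _ fun x => ?_
    rw [finPush_received_single]
    simp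
  · rw [← alg.sum_finPush_stepLaw K ht hw (received (secondNode hn)) hε]
    refine Fintype.sum_equiv (Equiv.funUnique Unit (X (firstEdge hn))) _ _ fun x => ?_
    rw [finPush_received_single]
    rfl

lemma nodeInfo_zero (alg : ChainAlgorithm T W X Y U Z) (K : ∀ e, Kernel (X e) (Y e))
    [∀ e, IsMarkovKernel (K e)] {w : α → ∀ i, W i} (hw : Measurable w) (i : Fin n) :
    alg.nodeInfo K κ w (Nat.zero_le T) i = 0 :=
  finMI_eq_zero_of_subsingleton ((alg.isFinKernel_pathLaw K _ hw).push _)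

end ChainAlgorithm

/-! ### The recursion with the two possible bounds at the second node. -/

section Recursion

variable {a : ℕ → ℕ → ℝ} {N T : ℕ}

lemma le_mul_one_sub_pow {b : ℕ → ℝ} {c M : ℝ} (hc1 : c ≤ 1) (h0 : b 0 ≤ 0)
    (hb : ∀ t < T, b (t + 1) ≤ (1 - c) * b t + c * M) :
    ∀ t ≤ T, b t ≤ M * (1 - (1 - c) ^ t) := by
  intro t
  induction t with
  | zero => simpa using h0
  | succ t ih =>
    intro ht
    refine (hb t ht).trans ?_
    have := mul_le_mul_of_nonneg_left (ih (by omega)) (sub_nonneg.2 hc1)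
    rw [pow_succ]
    linarith

/-- The input bound `M` at the first position contributes $M(1-(1-c_0)^t)$, which supplies the extra
factor of the product. -/
lemma le_mul_prod_of_recursion {c : ℕ → ℝ} {M : ℝ} (hc0 : ∀ j, 0 ≤ c j) (hc1 : ∀ j, c j ≤ 1)
    (ha : ∀ j < N, ∀ t < T, a (j + 1) (t + 1) ≤ (1 - c (j + 1)) * a (j + 1) t + c (j + 1) * a j t)
    (h0 : ∀ j ≤ N, a j 0 ≤ 0) (hM : 0 ≤ M)
    (hfirst : ∀ t < T, a 0 (t + 1) ≤ (1 - c 0) * a 0 t + c 0 * M) :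
    a N T ≤ M * ∏ i ∈ Finset.range (N + 1), (1 - (1 - c i) ^ (T - N)) := by
  have h := le_prod_of_recursion (M := fun k => M * (1 - (1 - c 0) ^ k)) hc0 hc1 ha h0
    (le_mul_one_sub_pow (hc1 0) (h0 0 (Nat.zero_le N)) hfirst)
    (fun k l hkl => mul_le_mul_of_nonneg_left (one_sub_pow_mono (hc0 0) (hc1 0) hkl) hM)
    (by simp)
  rw [Finset.prod_range_succ', mul_comm (∏ _ ∈ _, _), ← mul_assoc]
  exact h

lemma le_add_mul_of_step {b : ℕ → ℝ} {C : ℝ} (h0 : b 0 ≤ 0)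
    (hb : ∀ t < T, b (t + 1) ≤ b t + C) : ∀ t ≤ T, b t ≤ C * t := by
  intro t
  induction t with
  | zero => simpa using h0
  | succ t ih =>
    intro ht
    refine (hb t ht).trans ?_
    have := ih (by omega)
    push_cast
    linarith

lemma le_capacity_prod_of_recursion {c : ℕ → ℝ} {C : ℝ} (hc0 : ∀ j, 0 ≤ c j) (hc1 : ∀ j, c j ≤ 1)
    (ha : ∀ j < N, ∀ t < T, a (j + 1) (t + 1) ≤ (1 - c (j + 1)) * a (j + 1) t + c (j + 1) * a j t)
    (h0 : ∀ j ≤ N, a j 0 ≤ 0) (hC : 0 ≤ C) (hfirst : ∀ t < T, a 0 (t + 1) ≤ a 0 t + C) :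
    a N T ≤ C * (T - N : ℕ) * ∏ i ∈ Finset.range N, (1 - (1 - c (i + 1)) ^ (T - N)) :=
  le_prod_of_recursion (M := fun k => C * k) hc0 hc1 ha h0
    (le_add_mul_of_step (h0 0 (Nat.zero_le N)) hfirst)
    (fun _ _ hkl => mul_le_mul_of_nonneg_left (Nat.cast_le.2 hkl) hC) (by simp)

lemma le_mul_binTail_of_recursion {p M : ℝ} (hp0 : 0 ≤ p) (hp1 : p ≤ 1)
    (ha : ∀ j < N, ∀ t < T, a (j + 1) (t + 1) ≤ (1 - p) * a (j + 1) t + p * a j t)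
    (h0 : ∀ j ≤ N, a j 0 ≤ 0)
    (hfirst : ∀ t < T, a 0 (t + 1) ≤ (1 - p) * a 0 t + p * M) :
    a N T ≤ M * binTail p (N + 1) T := by
  refine le_of_recursion (b := fun j t => M * binTail p (j + 1) t) (c := fun _ => p)
    (fun _ => hp0) (fun _ => hp1) ha (fun j _ t _ => ?_) (fun j hj => ?_) (fun t ht => ?_)
    N le_rfl T le_rfl
  · rw [binTail_succ p (j + 1) t]
    exact le_of_eq (by ring)
  · simpa [binTail_zero_right] using h0 j hj
  · rw [binTail_one]
    exact le_mul_one_sub_pow hp1 (h0 0 (Nat.zero_le N)) hfirst t ht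

lemma le_mul_binTailSum_of_recursion {p C : ℝ} (hp0 : 0 ≤ p) (hp1 : p ≤ 1)
    (ha : ∀ j < N, ∀ t < T, a (j + 1) (t + 1) ≤ (1 - p) * a (j + 1) t + p * a j t)
    (h0 : ∀ j ≤ N, a j 0 ≤ 0) (hfirst : ∀ t < T, a 0 (t + 1) ≤ a 0 t + C) :
    a N T ≤ C * binTailSum p N T := by
  refine le_of_recursion (b := fun j t => C * binTailSum p j t) (c := fun _ => p)
    (fun _ => hp0) (fun _ => hp1) ha (fun j _ t _ => ?_) (fun j hj => ?_) (fun t ht => ?_)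
    N le_rfl T le_rfl
  · rw [binTailSum_succ p j t]
    exact le_of_eq (by ring)
  · simpa [binTailSum_zero_right] using h0 j hj
  · rw [binTailSum_zero_left]
    exact le_add_mul_of_step (h0 0 (Nat.zero_le N)) hfirst t ht

end Recursion

/-- From nats to bits. The real `M` stands in for `H`, which may be infinite; thus `B = 0` correctly
forces the bound zero. -/
lemma ofReal_div_log_two_le {x M B : ℝ} {H : ℝ≥0∞} (hM : 0 ≤ M)
    (hH : ENNReal.ofReal (M / Real.log 2) ≤ H) (hx : x ≤ M * B) :
    ENNReal.ofReal (x / Real.log 2) ≤ H * ENNReal.ofReal B := by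
  have hl2 : 0 < Real.log 2 := Real.log_pos one_lt_two
  calc ENNReal.ofReal (x / Real.log 2) ≤ ENNReal.ofReal (M / Real.log 2 * B) := by
        refine ENNReal.ofReal_le_ofReal ?_
        rw [div_mul_eq_mul_div]
        exact div_le_div_of_nonneg_right hx hl2.le
    _ = ENNReal.ofReal (M / Real.log 2) * ENNReal.ofReal B :=
        ENNReal.ofReal_mul (div_nonneg hM hl2.le)
    _ ≤ H * ENNReal.ofReal B := by gcongr

/-! ### Bounds at the last node for a fixed value of the other observations. -/

namespace ChainAlgorithm

variable {n T : ℕ} {W : Fin n → Type*} {X Y : ChainEdge n → Type*}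
  {U : Fin n → Fin T → Type*} {Z : Type*}
  [∀ i, MeasurableSpace (W i)] [∀ e, MeasurableSpace (X e)] [∀ e, MeasurableSpace (Y e)]
  [∀ i t, MeasurableSpace (U i t)] [MeasurableSpace Z]
  [∀ e, DiscreteMeasurableSpace (X e)] [∀ e, Fintype (X e)]
  [∀ e, Fintype (Y e)] [∀ e, MeasurableSingletonClass (Y e)]
  {α : Type*} [MeasurableSpace α] {κ : Measure α} [IsProbabilityMeasure κ]

/-- The information at the nodes other than the first, as a double sequence. -/
noncomputable def infoSeq (alg : ChainAlgorithm T W X Y U Z) (K : ∀ e, Kernel (X e) (Y e))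
    (κ : Measure α) (w : α → ∀ i, W i) (j t : ℕ) : ℝ :=
  -- Position `j` is the node of index `j + 1`, so position `0` is the second node and position `n -
  -- 2` the last one. The value outside the range is never used in the recursion.
  if h : j + 1 < n ∧ t ≤ T then alg.nodeInfo K κ w h.2 ⟨j + 1, h.1⟩ else 0

section

variable (alg : ChainAlgorithm T W X Y U Z) (K : ∀ e, Kernel (X e) (Y e))
  [∀ e, IsMarkovKernel (K e)]

lemma infoSeq_eq (κ : Measure α) (w : α → ∀ i, W i) {j t : ℕ} (hj : j + 1 < n) (ht : t ≤ T) :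
    alg.infoSeq K κ w j t = alg.nodeInfo K κ w ht ⟨j + 1, hj⟩ := dif_pos ⟨hj, ht⟩

lemma infoSeq_zero_le {w : α → ∀ i, W i} (hw : Measurable w) (j : ℕ) :
    alg.infoSeq K κ w j 0 ≤ 0 := by
  rw [infoSeq]
  split_ifs with h
  · exact (alg.nodeInfo_zero K hw _).le
  · exact le_rfl

lemma infoSeq_succ_succ_le {w : α → ∀ i, W i} (hw : Measurable w) (hn : 2 ≤ n)
    (hwc : ∀ a a' i, i ≠ firstNode hn → w a i = w a' i) {c : ℕ → ℝ} (hc0 : ∀ j, 0 ≤ c j)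
    (hc : ∀ i : Fin n, ∀ j, (i : ℕ) = j + 1 → sdpiConst (inChannel K i) ≤ c j) :
    ∀ j < n - 2, ∀ t < T, alg.infoSeq K κ w (j + 1) (t + 1) ≤
      (1 - c (j + 1)) * alg.infoSeq K κ w (j + 1) t + c (j + 1) * alg.infoSeq K κ w j t := by
  intro j hj t ht
  rw [alg.infoSeq_eq K κ w (by omega) ht, alg.infoSeq_eq K κ w (by omega) ht.le,
    alg.infoSeq_eq K κ w (by omega) ht.le]
  refine (alg.nodeInfo_succ_le K hw ht (hc _ (j + 1) rfl)).trans ?_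
  refine add_le_add_right (mul_le_mul_of_nonneg_left ?_ (hc0 _)) _
  refine alg.inputInfo_le K hw ht rfl fun a a' i hi => hwc a a' i ?_
  rintro rfl
  exact absurd (Fin.le_def.1 hi) (by simp)

lemma infoSeq_first_succ_le {w : α → ∀ i, W i} (hw : Measurable w) (hn : 2 ≤ n)
    {c M : ℝ} (hc0 : 0 ≤ c) (hc : sdpiConst (inChannel K (secondNode hn)) ≤ c)
    (hM : ∀ t (ht : t < T), alg.inputInfo K κ w ht (secondNode hn) ≤ M) :
    ∀ t < T, alg.infoSeq K κ w 0 (t + 1) ≤ (1 - c) * alg.infoSeq K κ w 0 t + c * M := by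
  intro t ht
  rw [alg.infoSeq_eq K κ w (by omega) ht, alg.infoSeq_eq K κ w (by omega) ht.le]
  exact (alg.nodeInfo_succ_le K hw ht hc).trans
    (add_le_add_right (mul_le_mul_of_nonneg_left (hM t ht) hc0) _)

lemma infoSeq_first_succ_le_add {w : α → ∀ i, W i} (hw : Measurable w) (hn : 2 ≤ n)
    (hwc : ∀ a a' i, i ≠ firstNode hn → w a i = w a' i) {C : ℝ}
    (hC : FinCapLE (kernelMatrix (K (firstEdge hn))) C) :
    ∀ t < T, alg.infoSeq K κ w 0 (t + 1) ≤ alg.infoSeq K κ w 0 t + C := by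
  intro t ht
  rw [alg.infoSeq_eq K κ w (by omega) ht, alg.infoSeq_eq K κ w (by omega) ht.le]
  exact alg.nodeInfo_second_succ_le K hw ht hn hwc hC

/-- A real constant dominated by the entropy. If the entropy is infinite, the sum of the finitely
many absolute values serves. -/
lemma exists_inputInfo_le [MeasurableSingletonClass α] {w : α → ∀ i, W i} (hw : Measurable w)
    (i : Fin n) : ∃ M, 0 ≤ M ∧ ENNReal.ofReal (M / Real.log 2) ≤ measureEntropy κ ∧
      ∀ t (ht : t < T), alg.inputInfo K κ w ht i ≤ M := by
  have hl2 : 0 < Real.log 2 := Real.log_pos one_lt_two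
  by_cases hH : measureEntropy κ = ∞
  · set g : Fin T → ℝ := fun t => |alg.inputInfo K κ w t.2 i| with hg
    have hg0 : ∀ t, 0 ≤ g t := fun t => abs_nonneg _
    refine ⟨∑ t, g t, Finset.sum_nonneg fun t _ => hg0 t, by rw [hH]; exact le_top, fun t ht => ?_⟩
    have h1 : alg.inputInfo K κ w ht i ≤ g ⟨t, ht⟩ := le_abs_self _
    exact h1.trans (Finset.single_le_sum (fun t _ => hg0 t) (Finset.mem_univ (⟨t, ht⟩ : Fin T)))
  · refine ⟨(measureEntropy κ).toReal * Real.log 2, by positivity, ?_, fun t ht => ?_⟩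
    · rw [mul_div_cancel_right₀ _ hl2.ne', ENNReal.ofReal_toReal hH]
    · rw [← div_le_iff₀ hl2, ← ENNReal.ofReal_le_iff_le_toReal hH]
      exact finMI_le_measureEntropy
        ((alg.isFinKernel_stepLaw K idMatrix_nonneg sum_idMatrix ht hw).push _)

end

section Bounds

variable (alg : ChainAlgorithm T W X Y U Z) (K : ∀ e, Kernel (X e) (Y e))
    [∀ e, IsMarkovKernel (K e)] {w : α → ∀ i, W i}

lemma nodeInfo_last_eq (hn : 2 ≤ n) :
    alg.nodeInfo K κ w le_rfl (lastNode hn) = alg.infoSeq K κ w (n - 2) T := by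
  rw [alg.infoSeq_eq K κ w (by omega) le_rfl]
  congr 1
  exact Fin.ext (by change n - 1 = n - 2 + 1; omega)

lemma nodeInfo_last_le_entropy_prod [MeasurableSingletonClass α] (hw : Measurable w) (hn : 2 ≤ n)
    (hwc : ∀ a a' i, i ≠ firstNode hn → w a i = w a' i) {c : ℕ → ℝ} (hc0 : ∀ j, 0 ≤ c j)
    (hc1 : ∀ j, c j ≤ 1)
    (hc : ∀ i : Fin n, ∀ j, (i : ℕ) = j + 1 → sdpiConst (inChannel K i) ≤ c j) :
    ENNReal.ofReal (alg.nodeInfo K κ w le_rfl (lastNode hn) / Real.log 2) ≤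
      measureEntropy κ * ENNReal.ofReal
        (∏ i ∈ Finset.range (n - 1), (1 - (1 - c i) ^ (T + 2 - n))) := by
  obtain ⟨M, hM0, hMH, hM⟩ := alg.exists_inputInfo_le K (κ := κ) hw (secondNode hn)
  refine ofReal_div_log_two_le hM0 hMH ?_
  have h := le_mul_prod_of_recursion hc0 hc1
    (alg.infoSeq_succ_succ_le K (κ := κ) hw hn hwc hc0 hc)
    (fun j _ => alg.infoSeq_zero_le K hw j) hM0
    (alg.infoSeq_first_succ_le K hw hn (hc0 0) (hc _ 0 rfl) hM)
  rwa [← alg.nodeInfo_last_eq K hn, show n - 2 + 1 = n - 1 by omega,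
    show T - (n - 2) = T + 2 - n by omega] at h

lemma nodeInfo_last_le_capacity_prod (hw : Measurable w) (hn : 2 ≤ n)
    (hwc : ∀ a a' i, i ≠ firstNode hn → w a i = w a' i) {c : ℕ → ℝ} (hc0 : ∀ j, 0 ≤ c j)
    (hc1 : ∀ j, c j ≤ 1)
    (hc : ∀ i : Fin n, ∀ j, (i : ℕ) = j + 1 → sdpiConst (inChannel K i) ≤ c j) :
    ENNReal.ofReal (alg.nodeInfo K κ w le_rfl (lastNode hn) / Real.log 2) ≤
      capacity (K (firstEdge hn)) * ((T + 2 - n : ℕ) : ℝ≥0∞) * ENNReal.ofReal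
        (∏ i ∈ Finset.range (n - 2), (1 - (1 - c (i + 1)) ^ (T + 2 - n))) := by
  obtain ⟨C, hC0, hC, hCK⟩ := exists_finCapLE (K (firstEdge hn))
  have h := le_capacity_prod_of_recursion hc0 hc1
    (alg.infoSeq_succ_succ_le K (κ := κ) hw hn hwc hc0 hc)
    (fun j _ => alg.infoSeq_zero_le K hw j) hC0
    (alg.infoSeq_first_succ_le_add K hw hn hwc hC)
  rw [← alg.nodeInfo_last_eq K hn, show T - (n - 2) = T + 2 - n by omega, mul_assoc] at h
  refine (ofReal_div_log_two_le hC0 hCK h).trans_eq ?_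
  rw [ENNReal.ofReal_mul (Nat.cast_nonneg _), ENNReal.ofReal_natCast, mul_assoc]

lemma nodeInfo_last_le_entropy_binTail [MeasurableSingletonClass α] (hw : Measurable w)
    (hn : 2 ≤ n) (hwc : ∀ a a' i, i ≠ firstNode hn → w a i = w a' i) {p : ℝ} (hp0 : 0 ≤ p)
    (hp1 : p ≤ 1) (hp : ∀ i, sdpiConst (inChannel K i) ≤ p) :
    ENNReal.ofReal (alg.nodeInfo K κ w le_rfl (lastNode hn) / Real.log 2) ≤
      measureEntropy κ * ENNReal.ofReal (binTail p (n - 1) T) := by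
  obtain ⟨M, hM0, hMH, hM⟩ := alg.exists_inputInfo_le K (κ := κ) hw (secondNode hn)
  refine ofReal_div_log_two_le hM0 hMH ?_
  have h := le_mul_binTail_of_recursion hp0 hp1
    (alg.infoSeq_succ_succ_le K (κ := κ) (c := fun _ => p) hw hn hwc (fun _ => hp0)
      fun i _ _ => hp i)
    (fun j _ => alg.infoSeq_zero_le K hw j)
    (alg.infoSeq_first_succ_le K hw hn hp0 (hp _) hM)
  rwa [← alg.nodeInfo_last_eq K hn, show n - 2 + 1 = n - 1 by omega] at h

lemma nodeInfo_last_le_capacity_binTailSum (hw : Measurable w) (hn : 2 ≤ n)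
    (hwc : ∀ a a' i, i ≠ firstNode hn → w a i = w a' i) {p : ℝ} (hp0 : 0 ≤ p)
    (hp1 : p ≤ 1) (hp : ∀ i, sdpiConst (inChannel K i) ≤ p) :
    ENNReal.ofReal (alg.nodeInfo K κ w le_rfl (lastNode hn) / Real.log 2) ≤
      capacity (K (firstEdge hn)) * ENNReal.ofReal (binTailSum p (n - 2) T) := by
  obtain ⟨C, hC0, hC, hCK⟩ := exists_finCapLE (K (firstEdge hn))
  refine ofReal_div_log_two_le hC0 hCK ?_
  rw [alg.nodeInfo_last_eq K hn]
  exact le_mul_binTailSum_of_recursion hp0 hp1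
    (alg.infoSeq_succ_succ_le K (κ := κ) (c := fun _ => p) hw hn hwc (fun _ => hp0)
      fun i _ _ => hp i)
    (fun j _ => alg.infoSeq_zero_le K hw j)
    (alg.infoSeq_first_succ_le_add K hw hn hwc hC)

end Bounds

end ChainAlgorithm

namespace ChainRun

open ChainAlgorithm

/-! ### The law of a run -/

variable {n T : ℕ} {W : Fin n → Type*} {X Y : ChainEdge n → Type*}
  {U : Fin n → Fin T → Type*} {Z : Type*}
  [∀ i, MeasurableSpace (W i)] [∀ e, MeasurableSpace (X e)] [∀ e, MeasurableSpace (Y e)]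
  [∀ i t, MeasurableSpace (U i t)] [MeasurableSpace Z]
  {alg : ChainAlgorithm T W X Y U Z} {K : ∀ e, Kernel (X e) (Y e)} {P : Measure (∀ i, W i)}
  {Ω : Type*} [MeasurableSpace Ω] {μ : Measure Ω}

lemma priv_eq_privMsg (run : ChainRun alg K P μ) (i : Fin n) (t : Fin T) (ω : Ω) :
    run.priv i t ω = alg.privMsg i (run.obs ω i) (run.rand ω i) t
      fun s j => run.recv (inEdge j) s ω := by
  induction t using WellFoundedLT.induction with
  | ind t ih =>
    rw [run.priv_eq, privMsg]
    congr 4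
    funext s
    exact ih s.1 s.2

lemma sent_eq_input (run : ChainRun alg K P μ) (e : ChainEdge n) (t : Fin T) (ω : Ω) :
    run.sent e t ω = alg.input e t (run.obs ω e.src) (run.rand ω e.src)
      fun s j => run.recv (inEdge j) s ω := by
  rw [input]
  split_ifs with h h'
  · exact run.sent_left e h t ω
  · rw [run.sent_right e h' t ω]
    simp only [run.priv_eq_privMsg]
  · rw [run.sent_self e (le_antisymm (not_lt.1 h) (not_lt.1 h')) t ω]
    simp only [run.priv_eq_privMsg]

/-- Everything received before time `t`. -/
def path (run : ChainRun alg K P μ) {t : ℕ} (ht : t ≤ T) (ω : Ω) (s : Fin t) (e : ChainEdge n) :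
    Y e := run.recv e (Fin.castLE ht s) ω

lemma sent_eq_lastInput (run : ChainRun alg K P μ) (e : ChainEdge n) {t : ℕ} (ht : t < T) (ω : Ω) :
    run.sent e ⟨t, ht⟩ ω =
      alg.lastInput e ht (run.obs ω) (run.rand ω e.src) (run.path ht.le ω) :=
  run.sent_eq_input e _ ω

lemma measurable_path (run : ChainRun alg K P μ) {t : ℕ} (ht : t ≤ T) : Measurable (run.path ht) :=
  measurable_pi_lambda _ fun _ => measurable_pi_lambda _ fun e => run.measurable_recv e _

lemma measurable_obs_rand (run : ChainRun alg K P μ) :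
    Measurable fun ω => (run.obs ω, run.rand ω) :=
  run.measurable_obs.prodMk run.measurable_rand

variable [∀ e, MeasurableSingletonClass (Y e)] [∀ e, DiscreteMeasurableSpace (X e)]
  [∀ e, IsMarkovKernel (K e)]

/-- The joint law of the observations, the private randomness and the received symbols. -/
lemma map_restrict_path (run : ChainRun alg K P μ) {t : ℕ} (ht : t ≤ T) (y : Fin t → ∀ e, Y e) :
    (μ.restrict {ω | run.path ht ω = y}).map (fun ω => (run.obs ω, run.rand ω)) =
      (μ.map fun ω => (run.obs ω, run.rand ω)).withDensity
        fun p => ENNReal.ofReal (alg.pathWt K ht p.1 p.2 y) := by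
  induction t with
  | zero =>
    have h1 : ∀ p : (∀ i, W i) × (Fin n → Fin T → unitInterval),
        ENNReal.ofReal (alg.pathWt K ht p.1 p.2 y) = 1 := fun p => by simp [pathWt, edgeWt]
    have h2 : {ω | run.path ht ω = y} = Set.univ :=
      Set.eq_univ_of_forall fun ω => Subsingleton.elim _ _
    simp only [h1, h2, Measure.restrict_univ]
    exact withDensity_one.symm
  | succ t ih =>
    obtain ⟨y, v, rfl⟩ : ∃ y' v, y = Fin.snoc (α := fun _ => ∀ e, Y e) y' v :=
      ⟨Fin.init y, y (Fin.last t), (Fin.snoc_init_self y).symm⟩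
    have ht' : t < T := ht
    set OR : Ω → (∀ i, W i) × (Fin n → Fin T → unitInterval) :=
      fun ω => (run.obs ω, run.rand ω) with hOR
    have hORm : Measurable OR := run.measurable_obs_rand
    set G : (∀ i, W i) × (Fin n → Fin T → unitInterval) → ℝ := fun p =>
      ∏ e, kernelMatrix (K e) (alg.lastInput e ht' p.1 (p.2 e.src) y) (v e) with hG
    have hGm : Measurable G := by
      refine Finset.measurable_prod _ fun e _ => ?_
      exact (Measurable.of_discrete (f := fun x => kernelMatrix (K e) x (v e))).comp
        ((alg.measurable_lastInput e ht' y).comp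
          (f := fun p : (∀ i, W i) × (Fin n → Fin T → unitInterval) => (p.1, p.2 e.src))
          (measurable_fst.prodMk (measurable_snd.eval (a := e.src))))
    have hwt : Measurable fun p : (∀ i, W i) × (Fin n → Fin T → unitInterval) =>
        ENNReal.ofReal (alg.pathWt K ht'.le p.1 p.2 y) :=
      (alg.measurable_pathWt K ht'.le y).ennreal_ofReal
    have hset : MeasurableSet {ω | run.path ht'.le ω = y} :=
      run.measurable_path ht'.le (measurableSet_singleton y)
    refine Measure.ext fun B hB => ?_
    rw [Measure.map_apply hORm hB, Measure.restrict_apply (hORm hB), withDensity_apply _ hB]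
    -- The event that the initial data lie in `B` and that the past equals `y`, in the form required
    -- by `channel`. The next factor of `pathWt` is then the transition probability at inputs
    -- determined by this past.
    set B' : Set ((∀ i, W i) × (Fin n → Fin T → unitInterval) ×
        (Set.Iio (⟨t, ht'⟩ : Fin T) → ∀ e, Y e)) :=
      {p | (p.1, p.2.1) ∈ B ∧ ∀ s : Fin t, p.2.2 ⟨Fin.castLE ht'.le s, Fin.lt_def.2 s.2⟩ = y s}
      with hB'
    have hB'm : MeasurableSet B' := by
      have : B' = (fun p => (p.1, p.2.1)) ⁻¹' B ∩ ⋂ s : Fin t,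
          (fun p => p.2.2 ⟨Fin.castLE ht'.le s, Fin.lt_def.2 s.2⟩) ⁻¹' {y s} := by
        ext p
        simp [hB']
      rw [this]
      exact ((measurable_fst.prodMk measurable_snd.fst) hB).inter (MeasurableSet.iInter fun s =>
        measurable_snd.snd.eval (measurableSet_singleton (y s)))
    have hB'eq : {ω | (run.obs ω, run.rand ω,
        fun (s : Set.Iio (⟨t, ht'⟩ : Fin T)) e => run.recv e s ω) ∈ B'} =
        OR ⁻¹' B ∩ {ω | run.path ht'.le ω = y} := by
      ext ω
      simp only [hB', Set.mem_ofPred_eq, Set.mem_inter_iff, Set.mem_preimage, hOR]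
      exact and_congr Iff.rfl ⟨fun h => funext h, fun h s => congrFun h s⟩
    have hleft : OR ⁻¹' B ∩ {ω | run.path ht ω = Fin.snoc (α := fun _ => ∀ e, Y e) y v} =
        {ω | (run.obs ω, run.rand ω,
          fun (s : Set.Iio (⟨t, ht'⟩ : Fin T)) e => run.recv e s ω) ∈ B' ∧
          ∀ e, run.recv e ⟨t, ht'⟩ ω = v e} := by
      ext ω
      have := Set.ext_iff.1 hB'eq ω
      simp only [Set.mem_ofPred_eq] at this
      simp only [Set.mem_ofPred_eq, this]
      simp only [Set.mem_inter_iff, Set.mem_ofPred_eq, and_assoc]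
      refine and_congr Iff.rfl ⟨fun h => ⟨?_, ?_⟩, fun h => ?_⟩
      · funext s
        have := congrFun h s.castSucc
        rwa [Fin.snoc_castSucc] at this
      · have := congrFun h (Fin.last t)
        rw [Fin.snoc_last] at this
        exact fun e => congrFun this e
      · funext s
        refine Fin.lastCases ?_ (fun s => ?_) s
        · rw [Fin.snoc_last]
          exact funext h.2
        · rw [Fin.snoc_castSucc]
          exact congrFun h.1 s
    have hint : ∀ ω ∈ OR ⁻¹' B ∩ {ω | run.path ht'.le ω = y},
        ∏ e, K e (run.sent e ⟨t, ht'⟩ ω) {v e} = ENNReal.ofReal (G (OR ω)) := by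
      intro ω hω
      rw [hG, ENNReal.ofReal_prod_of_nonneg fun e _ => kernelMatrix_nonneg _ _ _]
      refine Finset.prod_congr rfl fun e _ => ?_
      rw [run.sent_eq_lastInput e ht', show run.path ht'.le ω = y from hω.2, kernelMatrix,
        ofReal_measureReal]
    rw [hleft, run.channel ⟨t, ht'⟩ v B' hB'm, hB'eq,
      setLIntegral_congr_fun ((hORm hB).inter hset) hint,
      ← Measure.restrict_restrict (hORm hB), ← setLIntegral_map hB hGm.ennreal_ofReal hORm,
      ih ht'.le, setLIntegral_withDensity_eq_setLIntegral_mul _ hwt hGm.ennreal_ofReal hB]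
    refine setLIntegral_congr_fun hB fun p _ => ?_
    rw [Pi.mul_apply, ← ENNReal.ofReal_mul (alg.pathWt_nonneg K _ _ _ _)]
    congr 1
    rw [alg.pathWt_snoc K ht', alg.stepWt_eq]

/-- Splitting over the finitely many paths and integrating out the private randomness shows that
`pathLaw` is the conditional law of the received symbols given the observations. -/
lemma lintegral_path [IsProbabilityMeasure P] [∀ e, Fintype (Y e)] (run : ChainRun alg K P μ)
    {F : (∀ i, W i) → (Fin T → ∀ e, Y e) → ℝ≥0∞} (hF : ∀ y, Measurable fun w => F w y) :
    ∫⁻ ω, F (run.obs ω) (run.path le_rfl ω) ∂μ =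
      ∫⁻ w, ∑ y, F w y * ENNReal.ofReal (alg.pathLaw K le_rfl w y) ∂P := by
  classical
  have hset : ∀ y, MeasurableSet {ω | run.path le_rfl ω = y} := fun y =>
    run.measurable_path le_rfl (measurableSet_singleton y)
  have hFm : ∀ y, Measurable fun p : (∀ i, W i) × (Fin n → Fin T → unitInterval) => F p.1 y :=
    fun y => (hF y).comp measurable_fst
  have hwt : ∀ y, Measurable fun p : (∀ i, W i) × (Fin n → Fin T → unitInterval) =>
      ENNReal.ofReal (alg.pathWt K le_rfl p.1 p.2 y) := fun y =>
    (alg.measurable_pathWt K le_rfl y).ennreal_ofReal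
  have h1 : ∀ ω, F (run.obs ω) (run.path le_rfl ω) =
      ∑ y, Set.indicator {ω | run.path le_rfl ω = y} (fun ω => F (run.obs ω) y) ω := by
    intro ω
    simp [Set.indicator_apply]
  simp only [h1]
  have hFo : ∀ y, Measurable fun ω => F (run.obs ω) y := fun y => (hF y).comp run.measurable_obs
  rw [lintegral_finsetSum _ fun y _ => (hFo y).indicator (hset y), lintegral_finsetSum]
  · refine Finset.sum_congr rfl fun y _ => ?_
    rw [lintegral_indicator (hset y)]
    calc ∫⁻ ω in {ω | run.path le_rfl ω = y}, F (run.obs ω) y ∂μ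
        = ∫⁻ p, F p.1 y ∂((μ.restrict {ω | run.path le_rfl ω = y}).map
            fun ω => (run.obs ω, run.rand ω)) :=
          (lintegral_map (hFm y) run.measurable_obs_rand).symm
      _ = ∫⁻ p, ENNReal.ofReal (alg.pathWt K le_rfl p.1 p.2 y) * F p.1 y
            ∂(P.prod (randLaw n T)) := by
          rw [run.map_restrict_path le_rfl y, run.law_init,
            lintegral_withDensity_eq_lintegral_mul _ (hwt y) (hFm y)]
          rfl
      _ = ∫⁻ w, ∫⁻ r, ENNReal.ofReal (alg.pathWt K le_rfl w r y) * F w y ∂randLaw n T ∂P :=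
          lintegral_prod _ ((hwt y).mul (hFm y)).aemeasurable
      _ = ∫⁻ w, F w y * ENNReal.ofReal (alg.pathLaw K le_rfl w y) ∂P := by
          refine lintegral_congr fun w => ?_
          have hw := (alg.isFinKernel_pathWt K le_rfl
            (measurable_const : Measurable fun _ : Unit => w)).prodMk ()
          rw [lintegral_mul_const _ (hw.measurable y).ennreal_ofReal, mul_comm, pathLaw,
            ofReal_integral_eq_lintegral_ofReal (hw.integrable _ y)
              (ae_of_all _ fun r => hw.nonneg r y)]
  · exact fun y _ => (hF y).mul
      ((alg.isFinKernel_pathLaw K le_rfl measurable_id).measurable y).ennreal_ofReal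

end ChainRun

/-! ### Splitting off the observation of the first node. -/

section Combine

variable {n : ℕ} {W : Fin n → Type*}

/-- The observations of all nodes, from those of the nodes other than the first and that of the
first node. -/
def combineObs (hn : 2 ≤ n) (p : (∀ i : {i : Fin n // i ≠ firstNode hn}, W i) × W (firstNode hn))
    (i : Fin n) : W i :=
  if h : i = firstNode hn then h ▸ p.2 else p.1 ⟨i, h⟩

lemma combineObs_of_ne (hn : 2 ≤ n)
    (p : (∀ i : {i : Fin n // i ≠ firstNode hn}, W i) × W (firstNode hn)) {i : Fin n}
    (h : i ≠ firstNode hn) : combineObs hn p i = p.1 ⟨i, h⟩ := dif_neg h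

lemma combineObs_first (hn : 2 ≤ n)
    (p : (∀ i : {i : Fin n // i ≠ firstNode hn}, W i) × W (firstNode hn)) :
    combineObs hn p (firstNode hn) = p.2 := dif_pos rfl

lemma combineObs_restrict (hn : 2 ≤ n) (w : ∀ i, W i) :
    combineObs hn (fun i : {i : Fin n // i ≠ firstNode hn} => w i, w (firstNode hn)) = w := by
  funext i
  by_cases h : i = firstNode hn
  · subst h
    exact combineObs_first hn _
  · exact combineObs_of_ne hn _ h

lemma measurable_combineObs [∀ i, MeasurableSpace (W i)] (hn : 2 ≤ n) :
    Measurable (combineObs (W := W) hn) := by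
  refine measurable_pi_lambda _ fun i => ?_
  by_cases h : i = firstNode hn
  · subst h
    simp only [combineObs_first]
    exact measurable_snd
  · simp only [combineObs_of_ne hn _ h]
    exact measurable_fst.eval

lemma measurable_combineObs_mk [∀ i, MeasurableSpace (W i)] (hn : 2 ≤ n)
    (s : ∀ i : {i : Fin n // i ≠ firstNode hn}, W i) :
    Measurable fun a => combineObs hn (s, a) :=
  (measurable_combineObs hn).comp measurable_prodMk_left

end Combine

lemma sum_mul_ofReal_finPush {α O β : Type*} [Fintype O] [Fintype β] {q : α → O → ℝ}
    (hq : ∀ a o, 0 ≤ q a o) (f : O → β) (g : β → ℝ≥0∞) (a : α) :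
    ∑ b, g b * ENNReal.ofReal (finPush f q a b) = ∑ o, g (f o) * ENNReal.ofReal (q a o) := by
  classical
  rw [← Finset.sum_fiberwise Finset.univ f]
  refine Finset.sum_congr rfl fun b _ => ?_
  rw [finPush, ENNReal.ofReal_sum_of_nonneg fun o _ => hq a o, Finset.mul_sum]
  refine Finset.sum_congr (by congr) fun o ho => ?_
  rw [(Finset.mem_filter.1 ho).2]

lemma prod_filter_le_val {n : ℕ} (k : ℕ) (g : ℕ → ℝ) :
    ∏ i : Fin n with k ≤ i.val, g i = ∏ i ∈ Finset.range (n - k), g (i + k) := by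
  refine Finset.prod_bij' (i := fun i _ => i.val - k)
    (j := fun i hi => ⟨i + k, by rw [Finset.mem_range] at hi; omega⟩) ?_ ?_ ?_ ?_ ?_
  · intro i hi
    have := (Finset.mem_filter.1 hi).2
    rw [Finset.mem_range]
    omega
  · intro i hi
    simp
  · intro i hi
    have := (Finset.mem_filter.1 hi).2
    exact Fin.ext (by simp; omega)
  · intro i hi
    simp
  · intro i hi
    have := (Finset.mem_filter.1 hi).2
    rw [Nat.sub_add_cancel this]

/-! ### From a run to the bounds for fixed $W_{2:n}$. -/

namespace ChainRun

open ChainAlgorithm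

variable {n T : ℕ} {W : Fin n → Type*} {X Y : ChainEdge n → Type*}
  {U : Fin n → Fin T → Type*} {Z : Type*}
  [∀ i, MeasurableSpace (W i)] [∀ e, MeasurableSpace (X e)] [∀ e, MeasurableSpace (Y e)]
  [∀ i t, MeasurableSpace (U i t)] [MeasurableSpace Z]
  {alg : ChainAlgorithm T W X Y U Z} {K : ∀ e, Kernel (X e) (Y e)} {P : Measure (∀ i, W i)}
  [IsProbabilityMeasure P]
  {Ω : Type*} [MeasurableSpace Ω] {μ : Measure Ω} [IsProbabilityMeasure μ]

lemma measurable_received (run : ChainRun alg K P μ) (i : Fin n) :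
    Measurable fun ω => received i (run.path le_rfl ω) :=
  measurable_pi_lambda _ fun _ => measurable_pi_lambda _ fun _ => run.measurable_recv _ _

lemma map_obs (run : ChainRun alg K P μ) : μ.map run.obs = P := by
  have h := congrArg (Measure.map Prod.fst) run.law_init
  rwa [Measure.map_map measurable_fst run.measurable_obs_rand, Measure.map_fst_prod,
    measure_univ, one_smul] at h

lemma measurable_obsTail (run : ChainRun alg K P μ) (hn : 2 ≤ n) : Measurable (run.obsTail hn) :=
  measurable_pi_lambda _ fun _ => run.measurable_obs.eval

variable [∀ e, DiscreteMeasurableSpace (X e)] [∀ e, Fintype (Y e)]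
  [∀ e, MeasurableSingletonClass (Y e)] [∀ e, IsMarkovKernel (K e)]

/-- The joint law of the observations and of what node `i` received. -/
lemma map_received (run : ChainRun alg K P μ) (hn : 2 ≤ n) (i : Fin n)
    (hp : IsFinKernel fun p => finPush (received (Y := Y) i)
      (fun p => alg.pathLaw K le_rfl (combineObs hn p)) p) :
    μ.map (fun ω => ((run.obsTail hn ω, run.obs ω (firstNode hn)),
        received i (run.path le_rfl ω))) =
      μ.map (fun ω => (run.obsTail hn ω, run.obs ω (firstNode hn))) ⊗ₘ finKernel hp := by
  have hV := run.measurable_obsTail hn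
  have hA : Measurable fun ω => run.obs ω (firstNode hn) := run.measurable_obs.eval
  have hY := run.measurable_received i
  have : IsProbabilityMeasure
      (μ.map fun ω => (run.obsTail hn ω, run.obs ω (firstNode hn))) :=
    Measure.isProbabilityMeasure_map (hV.prodMk hA).aemeasurable
  refine Measure.ext_of_lintegral _ fun g hg => ?_
  rw [lintegral_map hg ((hV.prodMk hA).prodMk hY), lintegral_compProd_finKernel hp _ hg]
  set tail : (∀ i, W i) → (∀ i : {i : Fin n // i ≠ firstNode hn}, W i) × W (firstNode hn) :=
    fun w => (fun i => w i, w (firstNode hn)) with htail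
  have htailm : Measurable tail :=
    (measurable_pi_lambda _ fun i => measurable_pi_apply _).prodMk (measurable_pi_apply _)
  have hS : Measurable fun x => ∑ b, g (x, b) * ENNReal.ofReal (finPush (received (Y := Y) i)
      (fun p => alg.pathLaw K le_rfl (combineObs hn p)) x b) :=
    Finset.measurable_sum _ fun b _ => (hg.comp (measurable_id.prodMk measurable_const)).mul
      (hp.measurable b).ennreal_ofReal
  have hVA : (fun ω => (run.obsTail hn ω, run.obs ω (firstNode hn))) = tail ∘ run.obs := rfl
  rw [hVA, ← Measure.map_map htailm run.measurable_obs, run.map_obs, lintegral_map hS htailm]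
  refine (run.lintegral_path (F := fun w y => g (tail w, received i y)) fun y =>
    hg.comp (htailm.prodMk measurable_const)).trans (lintegral_congr fun w => ?_)
  rw [sum_mul_ofReal_finPush
    (fun p o => (alg.isFinKernel_pathLaw K le_rfl (measurable_combineObs hn)).nonneg p o)]
  simp only [htail, combineObs_restrict]

variable [∀ i, StandardBorelSpace (W i)] [∀ i, Nonempty (W i)] [StandardBorelSpace Z] [Nonempty Z]

/-- Since $n\ge2$, the observation of the last node is part of $W_{2:n}$, so the estimate is a
function of $W_{2:n}$ and of what that node received. -/
lemma condMutualInfo_le_lintegral_nodeInfo (run : ChainRun alg K P μ) (hn : 2 ≤ n)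
    {f : (∀ i, W i) → Z} (hf : Measurable f) :
    condMutualInfo (fun ω => f (run.obs ω)) (run.estimate (lastNode hn)) (run.obsTail hn) μ ≤
      ∫⁻ s, ENNReal.ofReal (alg.nodeInfo K
        (condDistrib (fun ω => run.obs ω (firstNode hn)) (run.obsTail hn) μ s)
        (fun a => combineObs hn (s, a)) le_rfl (lastNode hn) / Real.log 2)
        ∂(μ.map (run.obsTail hn)) := by
  have hp := (alg.isFinKernel_pathLaw K le_rfl (measurable_combineObs hn)).push
    (received (lastNode hn))
  have hlast : lastNode hn ≠ firstNode hn := fun h => by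
    have := congrArg Fin.val h
    change n - 1 = 0 at this
    omega
  have hobs : (fun ω => f (run.obs ω)) =
      fun ω => (f ∘ combineObs hn) (run.obsTail hn ω, run.obs ω (firstNode hn)) := by
    funext ω
    exact congrArg f (combineObs_restrict hn (run.obs ω)).symm
  have hψ : Measurable fun q : (∀ i : {i : Fin n // i ≠ firstNode hn}, W i) ×
      (Fin T → InMsg Y (lastNode hn)) => alg.est (lastNode hn) (q.1 ⟨lastNode hn, hlast⟩, q.2) :=
    (alg.measurable_est (lastNode hn)).comp (measurable_fst.eval.prodMk measurable_snd)
  have hfc : Measurable (f ∘ combineObs hn) := hf.comp (measurable_combineObs hn)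
  have hA : Measurable fun ω => run.obs ω (firstNode hn) := run.measurable_obs.eval
  have hlaw := run.map_received hn (lastNode hn) hp
  have hest : run.estimate (lastNode hn) = fun ω => (fun q : (∀ i : {i : Fin n //
      i ≠ firstNode hn}, W i) × (Fin T → InMsg Y (lastNode hn)) =>
      alg.est (lastNode hn) (q.1 ⟨lastNode hn, hlast⟩, q.2))
      (run.obsTail hn ω, received (lastNode hn) (run.path le_rfl ω)) := rfl
  rw [hobs, hest]
  refine (condMutualInfo_le_lintegral_finMI μ hA (run.measurable_obsTail hn)
    (run.measurable_received (lastNode hn)) hfc hψ hp hlaw).trans_eq ?_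
  refine lintegral_congr fun s => ?_
  rfl

variable [∀ e, Fintype (X e)]

lemma condMutualInfo_le_condEntropy_mul (run : ChainRun alg K P μ) (hn : 2 ≤ n)
    {f : (∀ i, W i) → Z} (hf : Measurable f) {B : ℝ}
    (h : ∀ (κ : Measure (W (firstNode hn))) [IsProbabilityMeasure κ]
      (w : W (firstNode hn) → ∀ i, W i), Measurable w →
      (∀ a a' i, i ≠ firstNode hn → w a i = w a' i) →
      ENNReal.ofReal (alg.nodeInfo K κ w le_rfl (lastNode hn) / Real.log 2) ≤
        measureEntropy κ * ENNReal.ofReal B) :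
    condMutualInfo (fun ω => f (run.obs ω)) (run.estimate (lastNode hn)) (run.obsTail hn) μ ≤
      condEntropy (fun ω => run.obs ω (firstNode hn)) (run.obsTail hn) μ *
        ENNReal.ofReal B := by
  refine (run.condMutualInfo_le_lintegral_nodeInfo hn hf).trans ?_
  rw [condEntropy, ← lintegral_mul_const' _ _ ENNReal.ofReal_ne_top]
  refine lintegral_mono fun s => h _ _ (measurable_combineObs_mk hn s) ?_
  intro a a' i hi
  rw [combineObs_of_ne hn _ hi, combineObs_of_ne hn _ hi]

lemma condMutualInfo_le_const (run : ChainRun alg K P μ) (hn : 2 ≤ n)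
    {f : (∀ i, W i) → Z} (hf : Measurable f) {B : ℝ≥0∞}
    (h : ∀ (κ : Measure (W (firstNode hn))) [IsProbabilityMeasure κ]
      (w : W (firstNode hn) → ∀ i, W i), Measurable w →
      (∀ a a' i, i ≠ firstNode hn → w a i = w a' i) →
      ENNReal.ofReal (alg.nodeInfo K κ w le_rfl (lastNode hn) / Real.log 2) ≤ B) :
    condMutualInfo (fun ω => f (run.obs ω)) (run.estimate (lastNode hn)) (run.obsTail hn) μ ≤
      B := by
  have : IsProbabilityMeasure (μ.map (run.obsTail hn)) :=
    Measure.isProbabilityMeasure_map (run.measurable_obsTail hn).aemeasurable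
  refine (run.condMutualInfo_le_lintegral_nodeInfo hn hf).trans ?_
  refine (lintegral_mono (g := fun _ => B) fun s =>
    h _ _ (measurable_combineObs_mk hn s) ?_).trans (by simp)
  intro a a' i hi
  rw [combineObs_of_ne hn _ hi, combineObs_of_ne hn _ hi]

end ChainRun

/-! ### Assembly of the bounds. -/

theorem mainTheorem6 {n T : ℕ} (hn : 2 ≤ n)
    {W : Fin n → Type*} [∀ i, MeasurableSpace (W i)] [∀ i, StandardBorelSpace (W i)]
    [∀ i, Nonempty (W i)]
    {X Y : ChainEdge n → Type*}
    [∀ e, MeasurableSpace (X e)] [∀ e, Finite (X e)] [∀ e, DiscreteMeasurableSpace (X e)]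
    [∀ e, MeasurableSpace (Y e)] [∀ e, Finite (Y e)] [∀ e, DiscreteMeasurableSpace (Y e)]
    {U : Fin n → Fin T → Type*} [∀ i t, MeasurableSpace (U i t)]
    {Z : Type*} [MeasurableSpace Z] [StandardBorelSpace Z] [Nonempty Z]
    (K : ∀ e, Kernel (X e) (Y e)) [∀ e, IsMarkovKernel (K e)]
    (P : Measure (∀ i, W i)) [IsProbabilityMeasure P]
    (f : (∀ i, W i) → Z) (hf : Measurable f)
    (alg : ChainAlgorithm T W X Y U Z)
    {Ω : Type*} [MeasurableSpace Ω] (μ : Measure Ω) [IsProbabilityMeasure μ]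
    (run : ChainRun alg K P μ)
    (I : ℝ≥0∞) (hI : I = condMutualInfo (fun ω => f (run.obs ω)) (run.estimate (lastNode hn))
      (run.obsTail hn) μ)
    (H : ℝ≥0∞) (hH : H = condEntropy (fun ω => run.obs ω (firstNode hn)) (run.obsTail hn) μ)
    (C : ℝ≥0∞) (hC : C = capacity (K (firstEdge hn)))
    (η : Fin n → ℝ) (hη : ∀ i, η i = sdpiConst (inChannel K i)) :
    (T + 2 ≤ n → I = 0) ∧
    (n ≤ T + 1 →
      I ≤ H * ENNReal.ofReal
        (∏ i : Fin n with 1 ≤ i.val, (1 - (1 - η i) ^ (T + 2 - n))) ∧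
      I ≤ C * ((T + 2 - n : ℕ) : ℝ≥0∞) * ENNReal.ofReal
        (∏ i : Fin n with 2 ≤ i.val, (1 - (1 - η i) ^ (T + 2 - n)))) ∧
    (∀ η' : ℝ, η' ≤ 1 → (∀ i, η i ≤ η') →
      (n ≤ T + 1 →
        (I ≤ H * ENNReal.ofReal
            (η' * ∑ i ∈ Finset.Icc 1 (T + 2 - n), binomProb (T - i) (n - 2) η') ∧
          η' * ∑ i ∈ Finset.Icc 1 (T + 2 - n), binomProb (T - i) (n - 2) η' ≤
            (1 - (1 - η') ^ (T + 2 - n)) ^ (n - 1)) ∧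
        (3 ≤ n →
          I ≤ C * ENNReal.ofReal
            (η' * ∑ i ∈ Finset.Icc 1 (T + 2 - n),
              binomProb (T - i - 1) (n - 3) η' * (i : ℝ)) ∧
          η' * ∑ i ∈ Finset.Icc 1 (T + 2 - n), binomProb (T - i - 1) (n - 3) η' * (i : ℝ) ≤
            ((T + 2 - n : ℕ) : ℝ) * (1 - (1 - η') ^ (T + 2 - n)) ^ (n - 2)) ∧
        I ≤ H * ENNReal.ofReal ((1 - (1 - η') ^ (T + 2 - n)) ^ (n - 1)) ∧
        I ≤ C * ((T + 2 - n : ℕ) : ℝ≥0∞) *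
          ENNReal.ofReal ((1 - (1 - η') ^ (T + 2 - n)) ^ (n - 2))) ∧
      (4 ≤ n → 0 < η' → ∀ γ : ℝ, 0 < γ → γ < 1 → (T : ℝ) ≤ 2 + ((n : ℝ) - 3) * γ / η' →
        I ≤ C * ENNReal.ofReal (((n : ℝ) - 3) ^ 2 * γ ^ 2 / η' *
          Real.exp (-2 * (η' / γ - η') ^ 2 * ((n : ℝ) - 3))))) := by
  subst hI hH hC
  have : ∀ e, Fintype (X e) := fun e => Fintype.ofFinite _
  have : ∀ e, Fintype (Y e) := fun e => Fintype.ofFinite _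
  -- The SDPI constants indexed by position: `c j` belongs to the node of index `j + 1`, with filler
  -- `0` past the end.
  set c : ℕ → ℝ := fun j => if h : j + 1 < n then η ⟨j + 1, h⟩ else 0 with hcdef
  have hη0 : ∀ i, 0 ≤ η i := fun i => hη i ▸ sdpiConst_nonneg _
  have hη1 : ∀ i, η i ≤ 1 := fun i => hη i ▸ sdpiConst_le_one _
  have hc0 : ∀ j, 0 ≤ c j := fun j => by
    simp only [hcdef]
    split_ifs
    exacts [hη0 _, le_rfl]
  have hc1 : ∀ j, c j ≤ 1 := fun j => by
    simp only [hcdef]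
    split_ifs
    exacts [hη1 _, zero_le_one]
  have hc' : ∀ i : Fin n, ∀ j, (i : ℕ) = j + 1 → c j = η i := fun i j hij => by
    simp only [hcdef]
    rw [dif_pos (hij ▸ i.2)]
    exact congrArg η (Fin.ext hij.symm)
  have hc : ∀ i : Fin n, ∀ j, (i : ℕ) = j + 1 → sdpiConst (inChannel K i) ≤ c j :=
    fun i j hij => by rw [hc' i j hij, hη i]
  have hprod : ∀ k, 1 ≤ k → ∏ i : Fin n with k ≤ i.val, (1 - (1 - η i) ^ (T + 2 - n)) =
      ∏ i ∈ Finset.range (n - k), (1 - (1 - c (i + (k - 1))) ^ (T + 2 - n)) := by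
    intro k hk
    have h := prod_filter_le_val (n := n) k fun j => 1 - (1 - c (j - 1)) ^ (T + 2 - n)
    calc _ = ∏ i : Fin n with k ≤ i.val, (1 - (1 - c (i.val - 1)) ^ (T + 2 - n)) := by
          refine Finset.prod_congr rfl fun i hi => ?_
          have := (Finset.mem_filter.1 hi).2
          rw [hc' i _ (by omega)]
      _ = _ := h
      _ = _ := Finset.prod_congr rfl fun i _ => by rw [Nat.add_sub_assoc hk]
  -- This bound holds for all `T`. For $T+2\le n$ its truncated factor `T + 2 - n` is zero, which is
  -- part 1.
  have hcap := run.condMutualInfo_le_const hn hf fun κ _ w hw hwc =>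
    alg.nodeInfo_last_le_capacity_prod K (κ := κ) hw hn hwc hc0 hc1 hc
  have hzero : T + 2 ≤ n → condMutualInfo (fun ω => f (run.obs ω)) (run.estimate (lastNode hn))
      (run.obsTail hn) μ = 0 := by
    intro h
    rw [Nat.sub_eq_zero_of_le h, Nat.cast_zero, mul_zero, zero_mul] at hcap
    exact le_antisymm hcap zero_le
  refine ⟨hzero, fun hT => ⟨?_, ?_⟩, fun η' hη'1 hη' => ?_⟩
  · rw [hprod 1 le_rfl]
    exact run.condMutualInfo_le_condEntropy_mul hn hf fun κ _ w hw hwc =>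
      alg.nodeInfo_last_le_entropy_prod K hw hn hwc hc0 hc1 hc
  · rw [hprod 2 one_le_two]
    exact hcap
  have hη'0 : 0 ≤ η' := (hη0 (firstNode hn)).trans (hη' _)
  have hp : ∀ i, sdpiConst (inChannel K i) ≤ η' := fun i => hη i ▸ hη' i
  have hH := run.condMutualInfo_le_condEntropy_mul hn hf fun κ _ w hw hwc =>
    alg.nodeInfo_last_le_entropy_binTail K hw hn hwc hη'0 hη'1 hp
  have hC := run.condMutualInfo_le_const hn hf fun κ _ w hw hwc =>
    alg.nodeInfo_last_le_capacity_binTailSum K (κ := κ) hw hn hwc hη'0 hη'1 hp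
  have hpowH : binTail η' (n - 1) T ≤ (1 - (1 - η') ^ (T + 2 - n)) ^ (n - 1) := by
    have h := binTail_le_pow hη'0 hη'1 (n - 2) T
    rwa [show n - 2 + 1 = n - 1 by omega, show T - (n - 2) = T + 2 - n by omega] at h
  have hpowC : binTailSum η' (n - 2) T ≤
      ((T + 2 - n : ℕ) : ℝ) * (1 - (1 - η') ^ (T + 2 - n)) ^ (n - 2) := by
    have h := binTailSum_le_pow hη'0 hη'1 (n - 2) T
    rwa [show T - (n - 2) = T + 2 - n by omega] at h
  refine ⟨fun hT => ⟨?_, fun hn3 => ?_, ?_, ?_⟩, fun hn4 hpos γ hγ0 hγ1 hγ => ?_⟩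
  · rw [← binTail_eq_sum hn]
    exact ⟨hH, hpowH⟩
  · rw [← binTailSum_eq_sum hn3]
    exact ⟨hC, hpowC⟩
  · exact hH.trans (mul_le_mul_right (ENNReal.ofReal_le_ofReal hpowH) _)
  · refine hC.trans ((mul_le_mul_right (ENNReal.ofReal_le_ofReal hpowC) _).trans_eq ?_)
    rw [ENNReal.ofReal_mul (Nat.cast_nonneg _), ENNReal.ofReal_natCast, mul_assoc]
  -- Part 4 does not assume $T\ge n-1$; for smaller `T` the information vanishes.
  · rcases Nat.lt_or_ge (T + 1) n with hT | hT
    · rw [hzero hT]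
      exact zero_le
    · exact hC.trans (mul_le_mul_right (ENNReal.ofReal_le_ofReal
        (binTailSum_le_exp hpos hη'1 hn4 hT hγ0 hγ1 hγ)) _)
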